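/- Let $0<q<1$ and $\varphi\in\mathbb R$. All algebras are unital, associative, over $\mathbb C$. **The algebra $A=SU_{q,\varphi}(2)$** is generated by $\alpha,\alpha^*,\gamma,\gamma^*$ with relations $\alpha\gamma=qe^{4i\varphi}\gamma\alpha$, $\alpha\gamma^*=qe^{-4i\varphi}\gamma^*\alpha$, $\gamma\alpha^*=qe^{4i\varphi}\alpha^*\gamma$, $\gamma^*\alpha^*=qe^{-4i\varphi}\alpha^*\gamma^*$, $\alpha\alpha^*+q^2\gamma^*\gamma=1$, $\alpha^*\alpha+\gamma\gamma^*=1$, $\gamma\gamma^*=\gamma^*\gamma$. It is graded by $\delta(\alpha)=\delta(\alpha^*)=0$, $\delta(\gamma)=-2$, $\delta(\gamma^*)=2$, and has structure maps $\Delta\alpha=\alpha\otimes\alpha-qe^{-4i\varphi}\gamma^*\otimes\gamma$, $\Delta\gamma=\gamma\otimes\alpha+\alpha^*\otimes\gamma$, $\Delta\alpha^*=\alpha^*\otimes\alpha^*-qe^{-4i\varphi}\gamma\otimes\gamma^*$, $\Delta\gamma^*=\gamma^*\otimes\alpha^*+\alpha\otimes\gamma^*$; $\epsilon(\alpha)=\epsilon(\alpha^*)=1$,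 $\epsilon(\gamma)=\epsilon(\gamma^*)=0$; $S\alpha=\alpha^*$, $S\alpha^*=\alpha$, $S\gamma=-qe^{4i\varphi}\gamma$, $S\gamma^*=-q^{-1}e^{4i\varphi}\gamma^*$. **The algebra $H=\mathcal U_{q,\varphi}(\hat u(2))$** is generated by $e,f$ and invertible $k,k^*$ with relations $ek=qe^{-4i\varphi}ke$, $kf=qe^{-4i\varphi}fk$, $ek^*=qe^{4i\varphi}k^*e$, $k^*f=qe^{4i\varphi}fk^*$, $kk^*=k^*k$, $ef-fe=\frac{1}{q^{-1}-q}\bigl(kk^*-k^{-1}(k^*)^{-1}\bigr)$. It is graded by $\delta(e)=-2$, $\delta(f)=2$, $\delta(k^{\pm1})=\delta((k^*)^{\pm1})=0$, and has structure maps $\Delta k=k\otimes k$, $\Delta k^*=k^*\otimes k^*$, $\Delta e=e\otimes k+k^{-1}\otimes e$, $\Delta f=f\otimes k^*+(k^*)^{-1}\otimes f$; $\epsilon(e)=\epsilon(f)=0$, $\epsilon(k)=\epsilon(k^*)=1$; $Se=-q^{-1}e^{4i\varphi}e$, $Sf=-qe^{4i\varphi}f$, $Sk=k^{-1}$, $Sk^*=(k^*)^{-1}$.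 On each of them the braiding is $\Psi(x\otimes y)=e^{2i\varphi\delta(x)\delta(y)}\,y\otimes x$ for homogeneous $x,y$; the maps extend from generators by $\Delta(xy)=(m\otimes m)(\mathrm{id}\otimes\Psi\otimes\mathrm{id})(\Delta x\otimes\Delta y)$, $\epsilon(xy)=\epsilon(x)\epsilon(y)$ and $S(xy)=m\Psi(Sx\otimes Sy)$. The mutual braidings are, for homogeneous $h\in H$, $a\in A$, $$\Xi(h\otimes a)=e^{2i\varphi\delta(h)\delta(a)}\,a\otimes h,\qquad \Xi'(a\otimes h)=e^{2i\varphi\delta(h)\delta(a)}\,h\otimes a .$$ A *braided pairing* is a linear map $\langle\cdot,\cdot\rangle:H\otimes A\to\mathbb C$, where $\Xi$ is invertible and compatible with units, products, counits and coproducts of $H$ and $A$, such that $\langle h,ab\rangle=(\langle\cdot,\cdot\rangle\otimes\langle\cdot,\cdot\rangle)(\mathrm{id}\otimes\Xi\otimes\mathrm{id})(\Delta h\otimes a\otimes b)$, $\langle hg,a\rangle=(\langle\cdot,\cdot\rangle\otimes\langle\cdot,\cdot\rangle)(\mathrm{id}\otimes\Xi\otimes\mathrm{id})(h\otimes g\otimes\Delta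 a)$, $\langle h,1\rangle=\epsilon(h)$, $\langle 1,a\rangle=\epsilon(a)$, $\langle Sh,a\rangle=\langle h,Sa\rangle$. A *left braided action* of $H$ on $A$ with mutual braiding $\Xi$ is a linear map $\triangleright:H\otimes A\to A$, where $\Xi$ is invertible and compatible with units and products of $H$ and $A$ and with $\Delta,\epsilon$ of $H$, such that $h\triangleright(ab)=m(\triangleright\otimes\triangleright)(\mathrm{id}\otimes\Xi\otimes\mathrm{id})(\Delta h\otimes a\otimes b)$, $(hg)\triangleright a=h\triangleright(g\triangleright a)$, $\Xi(h\otimes(g\triangleright a))=(\triangleright\otimes\mathrm{id})(\mathrm{id}\otimes\Xi)(\Psi\otimes\mathrm{id})(h\otimes g\otimes a)$, $1\triangleright a=a$, $h\triangleright1=\epsilon(h)1$. A *right braided action* $\triangleleft:A\otimes H\to A$ with mutual braiding $A\otimes H\to H\otimes A$ is defined by the mirror-image conditions. **Theorem.** $H$ and $A$, with these structure maps, are braided Hopf algebras. There is exactly one braided pairing with the following values on generators, all other pairs from $\{e,f,k^{\pm1},(k^*)^{\pm1}\}\times\{\alpha,\alpha^*,\gamma,\gamma^*\}$ being paired to $0$: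 $\langle e,\gamma^*\rangle=-q^{-1}e^{-4i\varphi}$, $\langle f,\gamma\rangle=1$, $\langle k^{\pm1},\alpha\rangle=q^{\mp1/2}e^{\pm2i\varphi}$, $\langle k^{\pm1},\alpha^*\rangle=q^{\pm1/2}e^{\mp2i\varphi}$, $\langle (k^*)^{\pm1},\alpha\rangle=q^{\mp1/2}e^{\mp2i\varphi}$, $\langle (k^*)^{\pm1},\alpha^*\rangle=q^{\pm1/2}e^{\pm2i\varphi}$. This pairing satisfies $(\mathrm{id}\otimes\langle\cdot,\cdot\rangle)(\Xi\otimes\mathrm{id})(\mathrm{id}\otimes\Psi)(h\otimes a\otimes b)=\langle h,a\rangle b$ and $(\langle\cdot,\cdot\rangle\otimes\mathrm{id})(\mathrm{id}\otimes\Xi)(\Psi\otimes\mathrm{id})(g\otimes h\otimes a)=\langle h,a\rangle g$, and: 1. The formula $$h\triangleright x=(\mathrm{id}\otimes\langle\cdot,\cdot\rangle)(\Xi\otimes\mathrm{id})(\mathrm{id}\otimes\Delta)(h\otimes x)$$ defines a left braided action of $H$ on $A$ with mutual braiding $\Xi$. On generators it is given by $e\triangleright\alpha=e\triangleright\gamma=0$,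 $e\triangleright\alpha^*=\gamma$, $e\triangleright\gamma^*=-q^{-1}e^{-4i\varphi}\alpha$; $f\triangleright\alpha^*=f\triangleright\gamma^*=0$, $f\triangleright\alpha=-qe^{4i\varphi}\gamma^*$, $f\triangleright\gamma=\alpha^*$; $k^{\pm1}\triangleright x=q^{\mp1/2}e^{\pm2i\varphi}x$ and $(k^*)^{\pm1}\triangleright x=q^{\mp1/2}e^{\mp2i\varphi}x$ for $x\in\{\alpha,\gamma\}$; $k^{\pm1}\triangleright x=q^{\pm1/2}e^{\mp2i\varphi}x$ and $(k^*)^{\pm1}\triangleright x=q^{\pm1/2}e^{\pm2i\varphi}x$ for $x\in\{\alpha^*,\gamma^*\}$. 2. The formula $$x\triangleleft h=(\langle\cdot,\cdot\rangle\otimes\mathrm{id})(\mathrm{id}\otimes\Xi')(\Delta\otimes\mathrm{id})(x\otimes h),$$ where the pairing is read as a map $A\otimes H\to\mathbb C$, $a\otimes h\mapsto\langle h,a\rangle$, defines a right braided action of $H$ on $A$ with mutual braiding $\Xi'$. On generators it is given by $\alpha\triangleleft e=\gamma$, $\alpha^*\triangleleft e=\gamma\triangleleft e=0$, $\gamma^*\triangleleft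 e=-q^{-1}e^{-4i\varphi}\alpha^*$; $\alpha\triangleleft f=\gamma^*\triangleleft f=0$, $\alpha^*\triangleleft f=-qe^{4i\varphi}\gamma^*$, $\gamma\triangleleft f=\alpha$; $x\triangleleft k^{\pm1}=q^{\mp1/2}e^{\pm2i\varphi}x$ and $x\triangleleft (k^*)^{\pm1}=q^{\mp1/2}e^{\mp2i\varphi}x$ for $x\in\{\alpha,\gamma^*\}$; $x\triangleleft k^{\pm1}=q^{\pm1/2}e^{\mp2i\varphi}x$ and $x\triangleleft (k^*)^{\pm1}=q^{\pm1/2}e^{\pm2i\varphi}x$ for $x\in\{\alpha^*,\gamma\}$. -/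

import Mathlib

open scoped TensorProduct

set_option linter.unusedSimpArgs false
set_option linter.unnecessarySeqFocus false

noncomputable section

namespace BraidedSU2

/-! ### Braided Hopf algebras, pairings and actions over `ℂ`

Iterated tensor products are written right-nested or left-nested as needed; the two maps
`braidFst` and `braidSnd` apply a braiding to the first two, respectively last two, factors. -/

section General

/-- `Ξ ⊗ id` as a map `X ⊗ (Y ⊗ Z) → Y ⊗ (X ⊗ Z)`. -/
def braidFst {X Y Z : Type} [AddCommGroup X] [Module ℂ X] [AddCommGroup Y] [Module ℂ Y]
    [AddCommGroup Z] [Module ℂ Z] (Ξ : X ⊗[ℂ] Y →ₗ[ℂ] Y ⊗[ℂ] X) :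
    X ⊗[ℂ] (Y ⊗[ℂ] Z) →ₗ[ℂ] Y ⊗[ℂ] (X ⊗[ℂ] Z) :=
  (TensorProduct.assoc ℂ Y X Z).toLinearMap ∘ₗ Ξ.rTensor Z ∘ₗ
    (TensorProduct.assoc ℂ X Y Z).symm.toLinearMap

/-- `id ⊗ Ξ` as a map `(Z ⊗ X) ⊗ Y → (Z ⊗ Y) ⊗ X`. -/
def braidSnd {X Y Z : Type} [AddCommGroup X] [Module ℂ X] [AddCommGroup Y] [Module ℂ Y]
    [AddCommGroup Z] [Module ℂ Z] (Ξ : X ⊗[ℂ] Y →ₗ[ℂ] Y ⊗[ℂ] X) :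
    (Z ⊗[ℂ] X) ⊗[ℂ] Y →ₗ[ℂ] (Z ⊗[ℂ] Y) ⊗[ℂ] X :=
  (TensorProduct.assoc ℂ Z Y X).symm.toLinearMap ∘ₗ Ξ.lTensor Z ∘ₗ
    (TensorProduct.assoc ℂ Z X Y).toLinearMap

/-- `id ⊗ Ξ ⊗ id` as a map `(W ⊗ X) ⊗ (Y ⊗ Z) → (W ⊗ Y) ⊗ (X ⊗ Z)`. -/
def braidMid {W X Y Z : Type} [AddCommGroup W] [Module ℂ W] [AddCommGroup X] [Module ℂ X]
    [AddCommGroup Y] [Module ℂ Y] [AddCommGroup Z] [Module ℂ Z]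
    (Ξ : X ⊗[ℂ] Y →ₗ[ℂ] Y ⊗[ℂ] X) :
    (W ⊗[ℂ] X) ⊗[ℂ] (Y ⊗[ℂ] Z) →ₗ[ℂ] (W ⊗[ℂ] Y) ⊗[ℂ] (X ⊗[ℂ] Z) :=
  (TensorProduct.assoc ℂ W Y (X ⊗[ℂ] Z)).symm.toLinearMap ∘ₗ (braidFst (Z := Z) Ξ).lTensor W ∘ₗ
    (TensorProduct.assoc ℂ W X (Y ⊗[ℂ] Z)).toLinearMap

/-- The multiplication `(a ⊗ b)(c ⊗ d) = (m ⊗ m)(id ⊗ Ψ ⊗ id)(a ⊗ b ⊗ c ⊗ d)` of the braided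
tensor square of an algebra. -/
def braidedMul {X : Type} [Ring X] [Algebra ℂ X] (Ψ : X ⊗[ℂ] X →ₗ[ℂ] X ⊗[ℂ] X) :
    (X ⊗[ℂ] X) ⊗[ℂ] (X ⊗[ℂ] X) →ₗ[ℂ] X ⊗[ℂ] X :=
  TensorProduct.map (LinearMap.mul' ℂ X) (LinearMap.mul' ℂ X) ∘ₗ braidMid Ψ

/-- An invertible map `Ξ : X ⊗ Y → Y ⊗ X` compatible with the units and the products of the two
algebras. -/
structure IsAlgebraBraiding {X Y : Type} [Ring X] [Algebra ℂ X] [Ring Y] [Algebra ℂ Y]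
    (Ξ : X ⊗[ℂ] Y →ₗ[ℂ] Y ⊗[ℂ] X) : Prop where
  bijective : Function.Bijective Ξ
  one_left : ∀ y : Y, Ξ (1 ⊗ₜ y) = y ⊗ₜ 1
  one_right : ∀ x : X, Ξ (x ⊗ₜ 1) = 1 ⊗ₜ x
  mul_left : ∀ (x x' : X) (y : Y),
    Ξ ((x * x') ⊗ₜ y) = (LinearMap.mul' ℂ X).lTensor Y (braidFst Ξ (x ⊗ₜ Ξ (x' ⊗ₜ y)))
  mul_right : ∀ (x : X) (y y' : Y),
    Ξ (x ⊗ₜ (y * y')) = (LinearMap.mul' ℂ Y).rTensor X (braidSnd Ξ (Ξ (x ⊗ₜ y) ⊗ₜ y'))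

/-- Compatibility of `Ξ : X ⊗ Y → Y ⊗ X` with a coproduct and a counit on `X`. -/
structure BraidsComulLeft {X Y : Type} [Ring X] [Algebra ℂ X] [Ring Y] [Algebra ℂ Y]
    (Ξ : X ⊗[ℂ] Y →ₗ[ℂ] Y ⊗[ℂ] X) (Δ : X →ₗ[ℂ] X ⊗[ℂ] X) (ε : X →ₗ[ℂ] ℂ) : Prop where
  comul : ∀ (x : X) (y : Y),
    braidFst Ξ (Ξ.lTensor X (TensorProduct.assoc ℂ X X Y (Δ x ⊗ₜ y))) =
      Δ.lTensor Y (Ξ (x ⊗ₜ y))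
  counit : ∀ (x : X) (y : Y), ε.lTensor Y (Ξ (x ⊗ₜ y)) = y ⊗ₜ ε x

/-- Compatibility of `Ξ : X ⊗ Y → Y ⊗ X` with a coproduct and a counit on `Y`. -/
structure BraidsComulRight {X Y : Type} [Ring X] [Algebra ℂ X] [Ring Y] [Algebra ℂ Y]
    (Ξ : X ⊗[ℂ] Y →ₗ[ℂ] Y ⊗[ℂ] X) (Δ : Y →ₗ[ℂ] Y ⊗[ℂ] Y) (ε : Y →ₗ[ℂ] ℂ) : Prop where
  comul : ∀ (x : X) (y : Y),
    braidSnd Ξ (Ξ.rTensor Y ((TensorProduct.assoc ℂ X Y Y).symm (x ⊗ₜ Δ y))) =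
      Δ.rTensor X (Ξ (x ⊗ₜ y))
  counit : ∀ (x : X) (y : Y), ε.rTensor X (Ξ (x ⊗ₜ y)) = ε y ⊗ₜ x

/-- The algebra `H` with coproduct `Δ`, counit `ε`, antipode `S` and braiding `Ψ` is a braided
Hopf algebra. -/
structure IsBraidedHopfAlgebra {H : Type} [Ring H] [Algebra ℂ H]
    (Δ : H →ₗ[ℂ] H ⊗[ℂ] H) (ε : H →ₗ[ℂ] ℂ) (S : H →ₗ[ℂ] H)
    (Ψ : H ⊗[ℂ] H →ₗ[ℂ] H ⊗[ℂ] H) : Prop where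
  braiding : IsAlgebraBraiding Ψ
  braid_comul_left : BraidsComulLeft Ψ Δ ε
  braid_comul_right : BraidsComulRight Ψ Δ ε
  yang_baxter : ∀ t : H ⊗[ℂ] (H ⊗[ℂ] H),
    braidFst Ψ (Ψ.lTensor H (braidFst Ψ t)) = Ψ.lTensor H (braidFst Ψ (Ψ.lTensor H t))
  coassoc : ∀ x : H, TensorProduct.assoc ℂ H H H (Δ.rTensor H (Δ x)) = Δ.lTensor H (Δ x)
  counit_comul : ∀ x : H, ε.rTensor H (Δ x) = 1 ⊗ₜ x
  comul_counit : ∀ x : H, ε.lTensor H (Δ x) = x ⊗ₜ 1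
  comul_one : Δ 1 = 1 ⊗ₜ 1
  comul_mul : ∀ x y : H, Δ (x * y) = braidedMul Ψ (Δ x ⊗ₜ Δ y)
  counit_one : ε 1 = 1
  counit_mul : ∀ x y : H, ε (x * y) = ε x * ε y
  antipode_left : ∀ x : H, LinearMap.mul' ℂ H (S.rTensor H (Δ x)) = algebraMap ℂ H (ε x)
  antipode_right : ∀ x : H, LinearMap.mul' ℂ H (S.lTensor H (Δ x)) = algebraMap ℂ H (ε x)

/-- `p : H ⊗ A → ℂ` is a braided pairing of braided Hopf algebras, with mutual braiding `Ξ`. -/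
structure IsBraidedPairing {H A : Type} [Ring H] [Algebra ℂ H] [Ring A] [Algebra ℂ A]
    (ΔH : H →ₗ[ℂ] H ⊗[ℂ] H) (εH : H →ₗ[ℂ] ℂ) (SH : H →ₗ[ℂ] H)
    (ΔA : A →ₗ[ℂ] A ⊗[ℂ] A) (εA : A →ₗ[ℂ] ℂ) (SA : A →ₗ[ℂ] A)
    (Ξ : H ⊗[ℂ] A →ₗ[ℂ] A ⊗[ℂ] H) (p : H ⊗[ℂ] A →ₗ[ℂ] ℂ) : Prop where
  braiding : IsAlgebraBraiding Ξ
  braid_comul_left : BraidsComulLeft Ξ ΔH εH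
  braid_comul_right : BraidsComulRight Ξ ΔA εA
  pair_mul : ∀ (h : H) (a b : A),
    p (h ⊗ₜ (a * b)) =
      LinearMap.mul' ℂ ℂ (TensorProduct.map p p (braidMid Ξ (ΔH h ⊗ₜ (a ⊗ₜ b))))
  mul_pair : ∀ (h g : H) (a : A),
    p ((h * g) ⊗ₜ a) =
      LinearMap.mul' ℂ ℂ (TensorProduct.map p p (braidMid Ξ ((h ⊗ₜ g) ⊗ₜ ΔA a)))
  pair_one : ∀ h : H, p (h ⊗ₜ 1) = εH h
  one_pair : ∀ a : A, p (1 ⊗ₜ a) = εA a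
  antipode : ∀ (h : H) (a : A), p (SH h ⊗ₜ a) = p (h ⊗ₜ SA a)

/-- The two additional compatibility conditions between a pairing and the braidings `ΨH`, `ΨA`
and `Ξ`. -/
structure PairingIsBraidInvariant {H A : Type} [Ring H] [Algebra ℂ H] [Ring A] [Algebra ℂ A]
    (ΨH : H ⊗[ℂ] H →ₗ[ℂ] H ⊗[ℂ] H) (ΨA : A ⊗[ℂ] A →ₗ[ℂ] A ⊗[ℂ] A)
    (Ξ : H ⊗[ℂ] A →ₗ[ℂ] A ⊗[ℂ] H) (p : H ⊗[ℂ] A →ₗ[ℂ] ℂ) : Prop where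
  right : ∀ (h : H) (a b : A),
    p.lTensor A (braidFst Ξ (h ⊗ₜ ΨA (a ⊗ₜ b))) = b ⊗ₜ p (h ⊗ₜ a)
  left : ∀ (g h : H) (a : A),
    p.rTensor H (braidSnd Ξ (ΨH (g ⊗ₜ h) ⊗ₜ a)) = p (h ⊗ₜ a) ⊗ₜ g

/-- `act : H ⊗ A → A` is a left braided action of the braided Hopf algebra `(H, Δ, ε, Ψ)` on the
algebra `A`, with mutual braiding `Ξ`; that is, `A` is a left braided `H`-module algebra. -/
structure IsLeftBraidedAction {H A : Type} [Ring H] [Algebra ℂ H] [Ring A] [Algebra ℂ A]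
    (Δ : H →ₗ[ℂ] H ⊗[ℂ] H) (ε : H →ₗ[ℂ] ℂ) (Ψ : H ⊗[ℂ] H →ₗ[ℂ] H ⊗[ℂ] H)
    (Ξ : H ⊗[ℂ] A →ₗ[ℂ] A ⊗[ℂ] H) (act : H ⊗[ℂ] A →ₗ[ℂ] A) : Prop where
  braiding : IsAlgebraBraiding Ξ
  braid_comul : BraidsComulLeft Ξ Δ ε
  act_mul : ∀ (h : H) (a b : A),
    act (h ⊗ₜ (a * b)) =
      LinearMap.mul' ℂ A (TensorProduct.map act act (braidMid Ξ (Δ h ⊗ₜ (a ⊗ₜ b))))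
  mul_act : ∀ (h g : H) (a : A), act ((h * g) ⊗ₜ a) = act (h ⊗ₜ act (g ⊗ₜ a))
  braid_act : ∀ (h g : H) (a : A),
    Ξ (h ⊗ₜ act (g ⊗ₜ a)) = act.rTensor H (braidSnd Ξ (Ψ (h ⊗ₜ g) ⊗ₜ a))
  one_act : ∀ a : A, act (1 ⊗ₜ a) = a
  act_one : ∀ h : H, act (h ⊗ₜ 1) = algebraMap ℂ A (ε h)

/-- `act : A ⊗ H → A` is a right braided action of the braided Hopf algebra `(H, Δ, ε, Ψ)` on the
algebra `A`, with mutual braiding `Ξ`: the mirror image of `IsLeftBraidedAction`. -/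
structure IsRightBraidedAction {H A : Type} [Ring H] [Algebra ℂ H] [Ring A] [Algebra ℂ A]
    (Δ : H →ₗ[ℂ] H ⊗[ℂ] H) (ε : H →ₗ[ℂ] ℂ) (Ψ : H ⊗[ℂ] H →ₗ[ℂ] H ⊗[ℂ] H)
    (Ξ : A ⊗[ℂ] H →ₗ[ℂ] H ⊗[ℂ] A) (act : A ⊗[ℂ] H →ₗ[ℂ] A) : Prop where
  braiding : IsAlgebraBraiding Ξ
  braid_comul : BraidsComulRight Ξ Δ ε
  mul_act : ∀ (a b : A) (h : H),
    act ((a * b) ⊗ₜ h) =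
      LinearMap.mul' ℂ A (TensorProduct.map act act (braidMid Ξ ((a ⊗ₜ b) ⊗ₜ Δ h)))
  act_mul : ∀ (a : A) (h g : H), act (a ⊗ₜ (h * g)) = act (act (a ⊗ₜ h) ⊗ₜ g)
  braid_act : ∀ (a : A) (h g : H),
    Ξ (act (a ⊗ₜ h) ⊗ₜ g) = act.lTensor H (braidFst Ξ (a ⊗ₜ Ψ (h ⊗ₜ g)))
  act_one : ∀ a : A, act (a ⊗ₜ 1) = a
  one_act : ∀ h : H, act (1 ⊗ₜ h) = algebraMap ℂ A (ε h)

/-- `h ⊗ x ↦ (id ⊗ ⟨·,·⟩)(Ξ ⊗ id)(id ⊗ Δ)(h ⊗ x)`. -/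
def leftAct {H A : Type} [Ring H] [Algebra ℂ H] [Ring A] [Algebra ℂ A]
    (ΔA : A →ₗ[ℂ] A ⊗[ℂ] A) (Ξ : H ⊗[ℂ] A →ₗ[ℂ] A ⊗[ℂ] H) (p : H ⊗[ℂ] A →ₗ[ℂ] ℂ) :
    H ⊗[ℂ] A →ₗ[ℂ] A :=
  (TensorProduct.rid ℂ A).toLinearMap ∘ₗ p.lTensor A ∘ₗ braidFst Ξ ∘ₗ ΔA.lTensor H

/-- `x ⊗ h ↦ (⟨·,·⟩ ⊗ id)(id ⊗ Ξ)(Δ ⊗ id)(x ⊗ h)`, where the pairing is now read as a map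
`A ⊗ H → ℂ` and `Ξ` is a braiding `A ⊗ H → H ⊗ A`. -/
def rightAct {H A : Type} [Ring H] [Algebra ℂ H] [Ring A] [Algebra ℂ A]
    (ΔA : A →ₗ[ℂ] A ⊗[ℂ] A) (Ξ : A ⊗[ℂ] H →ₗ[ℂ] H ⊗[ℂ] A) (p : H ⊗[ℂ] A →ₗ[ℂ] ℂ) :
    A ⊗[ℂ] H →ₗ[ℂ] A :=
  (TensorProduct.lid ℂ A).toLinearMap ∘ₗ
    (p ∘ₗ (TensorProduct.comm ℂ A H).toLinearMap).rTensor A ∘ₗ braidSnd Ξ ∘ₗ ΔA.rTensor H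

end General

/-! ### Braidings given by the phase `e^{2iφ δ(x) δ(y)}` -/

section Graded

/-- The phase `e^{inφ}`. -/
def ph (φ : ℝ) (n : ℤ) : ℂ := Complex.exp (n * φ * Complex.I)

theorem ph_zero (φ : ℝ) : ph φ 0 = 1 := by simp [ph]

theorem ph_ne_zero (φ : ℝ) (n : ℤ) : ph φ n ≠ 0 := Complex.exp_ne_zero _

theorem ph_add (φ : ℝ) (m n : ℤ) : ph φ (m + n) = ph φ m * ph φ n := by
  simp only [ph, ← Complex.exp_add]; congr 1; push_cast; ring

theorem ph_eight (φ : ℝ) : ph φ 8 = ph φ 4 ^ 2 := by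
  rw [show (8 : ℤ) = 4 + 4 by norm_num, ph_add]; ring

theorem ph_neg (φ : ℝ) (n : ℤ) : ph φ (-n) = (ph φ n)⁻¹ := by
  refine eq_inv_of_mul_eq_one_left ?_
  rw [← ph_add]; simp [ph_zero]

/-- A grading of `X` by `ℤ` is encoded by the map `c`, which sends `x = ∑ₙ xₙ` to `∑ₙ xₙ Tⁿ`.
`phaseTwist φ c m` is the map `x ↦ ∑ₙ e^{2iφmn} xₙ`. -/
def phaseTwist {X : Type} [Ring X] [Algebra ℂ X] (φ : ℝ) (c : X →ₐ[ℂ] AddMonoidAlgebra X ℤ)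
    (m : ℤ) : X →ₗ[ℂ] X :=
  (Finsupp.lsum ℂ fun n : ℤ => ph φ (2 * m * n) • (LinearMap.id : X →ₗ[ℂ] X)) ∘ₗ
    (AddMonoidAlgebra.coeffLinearEquiv ℂ).toLinearMap ∘ₗ c.toLinearMap

/-- The braiding `x ⊗ y ↦ e^{2iφ δ(x) δ(y)} y ⊗ x` for homogeneous `x`, `y`, that is
`x ⊗ y ↦ ∑ₘ ∑ₙ e^{2iφmn} yₙ ⊗ xₘ`, where the gradings of `X` and `Y` are encoded by
`cX : x ↦ ∑ₘ xₘ Tᵐ` and `cY : y ↦ ∑ₙ yₙ Tⁿ`. -/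
def phaseBraiding {X Y : Type} [Ring X] [Algebra ℂ X] [Ring Y] [Algebra ℂ Y] (φ : ℝ)
    (cX : X →ₐ[ℂ] AddMonoidAlgebra X ℤ) (cY : Y →ₐ[ℂ] AddMonoidAlgebra Y ℤ) :
    X ⊗[ℂ] Y →ₗ[ℂ] Y ⊗[ℂ] X :=
  TensorProduct.lift
    ((Finsupp.lsum ℂ fun m : ℤ =>
        LinearMap.lcomp ℂ (Y ⊗[ℂ] X) (phaseTwist φ cY m) ∘ₗ (TensorProduct.mk ℂ Y X).flip) ∘ₗ
      (AddMonoidAlgebra.coeffLinearEquiv ℂ).toLinearMap ∘ₗ cX.toLinearMap)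

theorem phaseTwist_of_single {X : Type} [Ring X] [Algebra ℂ X] (φ : ℝ)
    (c : X →ₐ[ℂ] AddMonoidAlgebra X ℤ) (m n : ℤ) (x : X)
    (hx : c x = AddMonoidAlgebra.single n x) :
    phaseTwist φ c m x = ph φ (2 * m * n) • x := by
  simp [phaseTwist, hx, -LaurentPolynomial.single_eq_C_mul_T]

theorem phaseBraiding_of_single {X Y : Type} [Ring X] [Algebra ℂ X] [Ring Y] [Algebra ℂ Y]
    (φ : ℝ) (cX : X →ₐ[ℂ] AddMonoidAlgebra X ℤ) (cY : Y →ₐ[ℂ] AddMonoidAlgebra Y ℤ)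
    (m : ℤ) (x : X) (y : Y) (hx : cX x = AddMonoidAlgebra.single m x) :
    phaseBraiding φ cX cY (x ⊗ₜ y) = phaseTwist φ cY m y ⊗ₜ x := by
  simp [phaseBraiding, hx, -LaurentPolynomial.single_eq_C_mul_T]

theorem phaseBraiding_homogeneous {X Y : Type} [Ring X] [Algebra ℂ X] [Ring Y] [Algebra ℂ Y]
    (φ : ℝ) (cX : X →ₐ[ℂ] AddMonoidAlgebra X ℤ) (cY : Y →ₐ[ℂ] AddMonoidAlgebra Y ℤ)
    (m n : ℤ) (x : X) (y : Y) (hx : cX x = AddMonoidAlgebra.single m x)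
    (hy : cY y = AddMonoidAlgebra.single n y) :
    phaseBraiding φ cX cY (x ⊗ₜ y) = ph φ (2 * m * n) • (y ⊗ₜ x) := by
  rw [phaseBraiding_of_single φ cX cY m x y hx, phaseTwist_of_single φ cY m n y hy,
    TensorProduct.smul_tmul']

theorem phaseTwist_mul {X : Type} [Ring X] [Algebra ℂ X] (φ : ℝ)
    (c : X →ₐ[ℂ] AddMonoidAlgebra X ℤ) (m : ℤ) (x y : X) :
    phaseTwist φ c m (x * y) = phaseTwist φ c m x * phaseTwist φ c m y := by
  have key : ∀ f g : AddMonoidAlgebra X ℤ,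
      (Finsupp.lsum ℂ fun n : ℤ => ph φ (2 * m * n) • (LinearMap.id : X →ₗ[ℂ] X)) (f * g).coeff =
      (Finsupp.lsum ℂ fun n : ℤ => ph φ (2 * m * n) • (LinearMap.id : X →ₗ[ℂ] X)) f.coeff *
      (Finsupp.lsum ℂ fun n : ℤ => ph φ (2 * m * n) • (LinearMap.id : X →ₗ[ℂ] X)) g.coeff := by
    intro f g
    induction f using AddMonoidAlgebra.induction_linear with
    | zero => simp
    | add f₁ f₂ h₁ h₂ => simp only [add_mul, AddMonoidAlgebra.coeff_add, map_add, h₁, h₂]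
    | single a r =>
      induction g using AddMonoidAlgebra.induction_linear with
      | zero => simp
      | add f₁ f₂ h₁ h₂ => simp only [mul_add, AddMonoidAlgebra.coeff_add, map_add, h₁, h₂]
      | single b s =>
        rw [AddMonoidAlgebra.single_mul_single]
        simp [mul_add, ph_add, smul_smul, -LaurentPolynomial.single_eq_C_mul_T,
          -Finsupp.single_mul, mul_comm (ph φ _) (ph φ _)]
  simpa [phaseTwist] using key (c x) (c y)

theorem phaseTwist_one {X : Type} [Ring X] [Algebra ℂ X] (φ : ℝ)
    (c : X →ₐ[ℂ] AddMonoidAlgebra X ℤ) (m : ℤ) : phaseTwist φ c m 1 = 1 := by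
  rw [phaseTwist_of_single φ c m 0 1 (by rw [map_one, AddMonoidAlgebra.one_def])]
  simp [ph_zero]

theorem braidedMul_of_single {X : Type} [Ring X] [Algebra ℂ X] (φ : ℝ)
    (c : X →ₐ[ℂ] AddMonoidAlgebra X ℤ) (m : ℤ) (a b x y : X)
    (hb : c b = AddMonoidAlgebra.single m b) :
    braidedMul (phaseBraiding φ c c) ((a ⊗ₜ b) ⊗ₜ (x ⊗ₜ y)) =
      (a * phaseTwist φ c m x) ⊗ₜ (b * y) := by
  simp [braidedMul, braidMid, braidFst, phaseBraiding_of_single φ c c m b x hb]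

end Graded

/-! ### The braided quantum group `SU_{q,φ}(2)` -/

section SU

/-- The generators `α, α*, γ, γ*`. -/
inductive SUGen : Type
  | α | αs | γ | γs

open SUGen in
/-- The defining relations of `SU_{q,φ}(2)`. -/
inductive SURel (q φ : ℝ) : FreeAlgebra ℂ SUGen → FreeAlgebra ℂ SUGen → Prop
  | αγ : SURel q φ (.ι ℂ α * .ι ℂ γ) ((q * ph φ 4) • (.ι ℂ γ * .ι ℂ α))
  | αγs : SURel q φ (.ι ℂ α * .ι ℂ γs) ((q * ph φ (-4)) • (.ι ℂ γs * .ι ℂ α))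
  | γαs : SURel q φ (.ι ℂ γ * .ι ℂ αs) ((q * ph φ 4) • (.ι ℂ αs * .ι ℂ γ))
  | γsαs : SURel q φ (.ι ℂ γs * .ι ℂ αs) ((q * ph φ (-4)) • (.ι ℂ αs * .ι ℂ γs))
  | ααs : SURel q φ (.ι ℂ α * .ι ℂ αs + (q ^ 2 : ℂ) • (.ι ℂ γs * .ι ℂ γ)) 1
  | αsα : SURel q φ (.ι ℂ αs * .ι ℂ α + .ι ℂ γ * .ι ℂ γs) 1
  | γγs : SURel q φ (.ι ℂ γ * .ι ℂ γs) (.ι ℂ γs * .ι ℂ γ)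

/-- The algebra `SU_{q,φ}(2)` over `ℂ`. -/
def SU (q φ : ℝ) : Type := RingQuot (SURel q φ)

instance (q φ : ℝ) : Ring (SU q φ) := inferInstanceAs (Ring (RingQuot (SURel q φ)))

instance (q φ : ℝ) : Algebra ℂ (SU q φ) := inferInstanceAs (Algebra ℂ (RingQuot (SURel q φ)))

namespace SU

/-- The quotient map from the free algebra. -/
def mk (q φ : ℝ) : FreeAlgebra ℂ SUGen →ₐ[ℂ] SU q φ := RingQuot.mkAlgHom ℂ (SURel q φ)

/-- The generators as elements of `SU_{q,φ}(2)`. -/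
def gen (q φ : ℝ) (x : SUGen) : SU q φ := mk q φ (.ι ℂ x)

theorem mk_rel {q φ : ℝ} {x y : FreeAlgebra ℂ SUGen} (h : SURel q φ x y) : mk q φ x = mk q φ y :=
  RingQuot.mkAlgHom_rel ℂ h

/-- The generator `α`. -/
def α (q φ : ℝ) : SU q φ := gen q φ .α
/-- The generator `α*`. -/
def αs (q φ : ℝ) : SU q φ := gen q φ .αs
/-- The generator `γ`. -/
def γ (q φ : ℝ) : SU q φ := gen q φ .γ
/-- The generator `γ*`. -/
def γs (q φ : ℝ) : SU q φ := gen q φ .γs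

theorem α_γ (q φ : ℝ) : α q φ * γ q φ = (q * ph φ 4) • (γ q φ * α q φ) := by
  simpa [α, αs, γ, γs, gen] using mk_rel (SURel.αγ (q := q) (φ := φ))
theorem α_γs (q φ : ℝ) : α q φ * γs q φ = (q * ph φ (-4)) • (γs q φ * α q φ) := by
  simpa [α, αs, γ, γs, gen] using mk_rel (SURel.αγs (q := q) (φ := φ))
theorem γ_αs (q φ : ℝ) : γ q φ * αs q φ = (q * ph φ 4) • (αs q φ * γ q φ) := by
  simpa [α, αs, γ, γs, gen] using mk_rel (SURel.γαs (q := q) (φ := φ))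
theorem γs_αs (q φ : ℝ) : γs q φ * αs q φ = (q * ph φ (-4)) • (αs q φ * γs q φ) := by
  simpa [α, αs, γ, γs, gen] using mk_rel (SURel.γsαs (q := q) (φ := φ))
theorem α_αs (q φ : ℝ) : α q φ * αs q φ + (q ^ 2 : ℂ) • (γs q φ * γ q φ) = 1 := by
  simpa [α, αs, γ, γs, gen] using mk_rel (SURel.ααs (q := q) (φ := φ))
theorem αs_α (q φ : ℝ) : αs q φ * α q φ + γ q φ * γs q φ = 1 := by
  simpa [α, αs, γ, γs, gen] using mk_rel (SURel.αsα (q := q) (φ := φ))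
theorem γ_γs (q φ : ℝ) : γ q φ * γs q φ = γs q φ * γ q φ := by
  simpa [α, αs, γ, γs, gen] using mk_rel (SURel.γγs (q := q) (φ := φ))

/-- The homomorphism out of `SU_{q,φ}(2)` with prescribed values on the generators. -/
def lift (q φ : ℝ) {B : Type} [Ring B] [Algebra ℂ B] (f : SUGen → B)
    (hf : ∀ ⦃x y⦄, SURel q φ x y → FreeAlgebra.lift ℂ f x = FreeAlgebra.lift ℂ f y) :
    SU q φ →ₐ[ℂ] B :=
  RingQuot.liftAlgHom ℂ ⟨FreeAlgebra.lift ℂ f, hf⟩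

theorem lift_gen (q φ : ℝ) {B : Type} [Ring B] [Algebra ℂ B] (f : SUGen → B)
    (hf : ∀ ⦃x y⦄, SURel q φ x y → FreeAlgebra.lift ℂ f x = FreeAlgebra.lift ℂ f y) (x : SUGen) :
    lift q φ f hf (gen q φ x) = f x := by
  change RingQuot.liftAlgHom ℂ _ (RingQuot.mkAlgHom ℂ (SURel q φ) (.ι ℂ x)) = _
  rw [RingQuot.liftAlgHom_mkAlgHom_apply, FreeAlgebra.lift_ι_apply]

theorem algHom_ext {q φ : ℝ} {B : Type} [Ring B] [Algebra ℂ B] {f g : SU q φ →ₐ[ℂ] B}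
    (h : ∀ x, f (gen q φ x) = g (gen q φ x)) : f = g := by
  refine RingQuot.ringQuot_ext' ℂ f g (FreeAlgebra.hom_ext ?_)
  funext x
  exact h x

/-- The degree `μ` of the generators. -/
def μ : SUGen → ℤ
  | .α => 1 | .αs => -1 | .γ => -1 | .γs => 1

/-- The degree `ν` of the generators. -/
def ν : SUGen → ℤ
  | .α => 1 | .αs => -1 | .γ => 1 | .γs => -1

/-- The index `δ = μ - ν` of the generators. -/
def δ (x : SUGen) : ℤ := μ x - ν x

/-- The grading of `SU_{q,φ}(2)` by the index `δ`, additive on products of generators. -/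
def grading (q φ : ℝ) : SU q φ →ₐ[ℂ] AddMonoidAlgebra (SU q φ) ℤ :=
  lift q φ (fun x => AddMonoidAlgebra.single (δ x) (gen q φ x)) (by
    intro x y h
    cases h <;>
      simp only [map_mul, map_add, map_smul, map_one, FreeAlgebra.lift_ι_apply,
        AddMonoidAlgebra.single_mul_single, AddMonoidAlgebra.smul_single, AddMonoidAlgebra.one_def]
    · congr 1; exact α_γ q φ
    · congr 1; exact α_γs q φ
    · congr 1; exact γ_αs q φ
    · congr 1; exact γs_αs q φ
    · rw [← α_αs q φ, AddMonoidAlgebra.single_add]; rfl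
    · rw [← αs_α q φ, AddMonoidAlgebra.single_add]; rfl
    · congr 1; exact γ_γs q φ)

/-- The braiding of `SU_{q,φ}(2)`. -/
def braiding (q φ : ℝ) : SU q φ ⊗[ℂ] SU q φ →ₗ[ℂ] SU q φ ⊗[ℂ] SU q φ :=
  phaseBraiding φ (grading q φ) (grading q φ)

/-- The coproduct on the generators. -/
def comulGen (q φ : ℝ) : SUGen → SU q φ ⊗[ℂ] SU q φ
  | .α => α q φ ⊗ₜ α q φ - (q * ph φ (-4)) • (γs q φ ⊗ₜ γ q φ)
  | .γ => γ q φ ⊗ₜ α q φ + αs q φ ⊗ₜ γ q φ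
  | .αs => αs q φ ⊗ₜ αs q φ - (q * ph φ (-4)) • (γ q φ ⊗ₜ γs q φ)
  | .γs => γs q φ ⊗ₜ αs q φ + α q φ ⊗ₜ γs q φ

theorem grading_gen (q φ : ℝ) (x : SUGen) :
    grading q φ (gen q φ x) = AddMonoidAlgebra.single (δ x) (gen q φ x) :=
  lift_gen q φ _ _ x

theorem twist_gen_mul (q φ : ℝ) (m : ℤ) (x : SUGen) (y : SU q φ) :
    phaseTwist φ (grading q φ) m (gen q φ x * y) =
      ph φ (2 * m * δ x) • (gen q φ x * phaseTwist φ (grading q φ) m y) := by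
  rw [phaseTwist_mul, phaseTwist_of_single _ _ _ _ _ (grading_gen q φ x), smul_mul_assoc]

theorem twist_zero (q φ : ℝ) (y : SU q φ) : phaseTwist φ (grading q φ) 0 y = y := by
  have h : AlgHom.ofLinearMap (phaseTwist φ (grading q φ) 0) (phaseTwist_one φ _ 0)
      (phaseTwist_mul φ _ 0) = AlgHom.id ℂ (SU q φ) := by
    apply algHom_ext
    intro x
    simp [phaseTwist_of_single _ _ _ _ _ (grading_gen q φ x), ph_zero]
  exact congrArg (fun f => f y) h

theorem twist_twist (q φ : ℝ) (m n : ℤ) (y : SU q φ) :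
    phaseTwist φ (grading q φ) m (phaseTwist φ (grading q φ) n y) =
      phaseTwist φ (grading q φ) (m + n) y := by
  let T : ℤ → SU q φ →ₐ[ℂ] SU q φ := fun k =>
    AlgHom.ofLinearMap (phaseTwist φ (grading q φ) k) (phaseTwist_one φ _ k) (phaseTwist_mul φ _ k)
  have h : (T m).comp (T n) = T (m + n) := by
    apply algHom_ext
    intro x
    have hx := fun k => phaseTwist_of_single φ (grading q φ) k (δ x) _ (grading_gen q φ x)
    simp only [T, AlgHom.comp_apply, AlgHom.ofLinearMap_apply, hx, map_smul, smul_smul, ← ph_add]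
    congr 2
    ring
  exact congrArg (fun f => f y) h

/-- Braided multiplication from the left by `Δ(x)`, for a generator `x`. -/
def comulOp (q φ : ℝ) (x : SUGen) : Module.End ℂ (SU q φ ⊗[ℂ] SU q φ) :=
  TensorProduct.curry (braidedMul (braiding q φ)) (comulGen q φ x)

theorem braidedMul_gen (q φ : ℝ) (a x y : SU q φ) (b : SUGen) :
    braidedMul (braiding q φ) ((a ⊗ₜ gen q φ b) ⊗ₜ (x ⊗ₜ y)) =
      (a * phaseTwist φ (grading q φ) (δ b) x) ⊗ₜ (gen q φ b * y) :=
  braidedMul_of_single φ _ _ _ _ _ _ (grading_gen q φ b)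

theorem comulOp_α (q φ : ℝ) (x y : SU q φ) :
    comulOp q φ .α (x ⊗ₜ y) = (α q φ * x) ⊗ₜ (α q φ * y) -
      (q * ph φ (-4)) • ((γs q φ * phaseTwist φ (grading q φ) (-2) x) ⊗ₜ (γ q φ * y)) := by
  simp only [comulOp, comulGen, α, γ, map_sub, map_smul, LinearMap.sub_apply,
    LinearMap.smul_apply, TensorProduct.curry_apply, braidedMul_gen]
  simp [δ, μ, ν, twist_zero]

theorem comulOp_αs (q φ : ℝ) (x y : SU q φ) :
    comulOp q φ .αs (x ⊗ₜ y) = (αs q φ * x) ⊗ₜ (αs q φ * y) -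
      (q * ph φ (-4)) • ((γ q φ * phaseTwist φ (grading q φ) 2 x) ⊗ₜ (γs q φ * y)) := by
  simp only [comulOp, comulGen, αs, γs, map_sub, map_smul, LinearMap.sub_apply,
    LinearMap.smul_apply, TensorProduct.curry_apply, braidedMul_gen]
  simp [δ, μ, ν, twist_zero]

theorem comulOp_γ (q φ : ℝ) (x y : SU q φ) :
    comulOp q φ .γ (x ⊗ₜ y) = (γ q φ * x) ⊗ₜ (α q φ * y) +
      (αs q φ * phaseTwist φ (grading q φ) (-2) x) ⊗ₜ (γ q φ * y) := by
  simp only [comulOp, comulGen, α, γ, map_add, LinearMap.add_apply,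
    TensorProduct.curry_apply, braidedMul_gen]
  simp [δ, μ, ν, twist_zero]

theorem comulOp_γs (q φ : ℝ) (x y : SU q φ) :
    comulOp q φ .γs (x ⊗ₜ y) = (γs q φ * x) ⊗ₜ (αs q φ * y) +
      (α q φ * phaseTwist φ (grading q φ) 2 x) ⊗ₜ (γs q φ * y) := by
  simp only [comulOp, comulGen, αs, γs, map_add, LinearMap.add_apply,
    TensorProduct.curry_apply, braidedMul_gen]
  simp [δ, μ, ν, twist_zero]

/-! Reordering rules, used only to check that the structure maps below are well defined. -/

theorem rα_γ (q φ : ℝ) (x : SU q φ) :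
    α q φ * (γ q φ * x) = (q * ph φ 4) • (γ q φ * (α q φ * x)) := by
  rw [← mul_assoc, α_γ, smul_mul_assoc, mul_assoc]

theorem rα_γs (q φ : ℝ) (x : SU q φ) :
    α q φ * (γs q φ * x) = (q * (ph φ 4)⁻¹) • (γs q φ * (α q φ * x)) := by
  rw [← mul_assoc, α_γs, smul_mul_assoc, mul_assoc, ph_neg]

theorem αs_γ (q φ : ℝ) (hq : q ≠ 0) :
    αs q φ * γ q φ = ((q : ℂ)⁻¹ * (ph φ 4)⁻¹) • (γ q φ * αs q φ) := by
  have hq' : (q : ℂ) ≠ 0 := by exact_mod_cast hq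
  have := ph_ne_zero φ 4
  rw [γ_αs, smul_smul]
  field_simp
  simp

theorem αs_γs (q φ : ℝ) (hq : q ≠ 0) :
    αs q φ * γs q φ = ((q : ℂ)⁻¹ * ph φ 4) • (γs q φ * αs q φ) := by
  have hq' : (q : ℂ) ≠ 0 := by exact_mod_cast hq
  have := ph_ne_zero φ 4
  rw [γs_αs, smul_smul, ph_neg]
  field_simp
  simp

theorem rαs_γ (q φ : ℝ) (hq : q ≠ 0) (x : SU q φ) :
    αs q φ * (γ q φ * x) = ((q : ℂ)⁻¹ * (ph φ 4)⁻¹) • (γ q φ * (αs q φ * x)) := by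
  rw [← mul_assoc, αs_γ q φ hq, smul_mul_assoc, mul_assoc]

theorem rαs_γs (q φ : ℝ) (hq : q ≠ 0) (x : SU q φ) :
    αs q φ * (γs q φ * x) = ((q : ℂ)⁻¹ * ph φ 4) • (γs q φ * (αs q φ * x)) := by
  rw [← mul_assoc, αs_γs q φ hq, smul_mul_assoc, mul_assoc]

theorem rγs_γ (q φ : ℝ) (x : SU q φ) :
    γs q φ * (γ q φ * x) = γ q φ * (γs q φ * x) := by
  rw [← mul_assoc, ← γ_γs, mul_assoc]

theorem rα_αs (q φ : ℝ) (x : SU q φ) :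
    α q φ * (αs q φ * x) = x - (q ^ 2 : ℂ) • (γ q φ * (γs q φ * x)) := by
  rw [← mul_assoc, eq_sub_of_add_eq (α_αs q φ), ← γ_γs, sub_mul, one_mul, smul_mul_assoc,
    mul_assoc]

theorem rαs_α (q φ : ℝ) (x : SU q φ) :
    αs q φ * (α q φ * x) = x - γ q φ * (γs q φ * x) := by
  rw [← mul_assoc, eq_sub_of_add_eq (αs_α q φ), sub_mul, one_mul, mul_assoc]

theorem twist_α (q φ : ℝ) (m : ℤ) (y : SU q φ) :
    phaseTwist φ (grading q φ) m (α q φ * y) = α q φ * phaseTwist φ (grading q φ) m y := by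
  simpa [α, δ, μ, ν, ph_zero] using twist_gen_mul q φ m .α y

theorem twist_αs (q φ : ℝ) (m : ℤ) (y : SU q φ) :
    phaseTwist φ (grading q φ) m (αs q φ * y) = αs q φ * phaseTwist φ (grading q φ) m y := by
  simpa [αs, δ, μ, ν, ph_zero] using twist_gen_mul q φ m .αs y

theorem twist_γ (q φ : ℝ) (m : ℤ) (y : SU q φ) :
    phaseTwist φ (grading q φ) m (γ q φ * y) =
      ph φ (2 * m * (-2)) • (γ q φ * phaseTwist φ (grading q φ) m y) := by
  simpa [γ, δ, μ, ν, ph_zero] using twist_gen_mul q φ m .γ y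

theorem twist_γs (q φ : ℝ) (m : ℤ) (y : SU q φ) :
    phaseTwist φ (grading q φ) m (γs q φ * y) =
      ph φ (2 * m * 2) • (γs q φ * phaseTwist φ (grading q φ) m y) := by
  simpa [γs, δ, μ, ν, ph_zero] using twist_gen_mul q φ m .γs y

/-- Left multiplication by `Δ(x)` in the braided tensor square, as a homomorphism in `x`. -/
def comulHom (q φ : ℝ) (hq : q ≠ 0) : SU q φ →ₐ[ℂ] Module.End ℂ (SU q φ ⊗[ℂ] SU q φ) :=
  lift q φ (comulOp q φ) (by
    intro r s h
    have hq' : (q : ℂ) ≠ 0 := by exact_mod_cast hq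
    have hw := ph_ne_zero φ 4
    refine TensorProduct.ext' fun x y => ?_
    cases h <;>
    · simp only [map_mul, map_add, map_smul, map_one, FreeAlgebra.lift_ι_apply,
        Module.End.mul_apply, Module.End.one_apply, LinearMap.add_apply, LinearMap.smul_apply,
        comulOp_α, comulOp_αs, comulOp_γ, comulOp_γs, map_sub, twist_α, twist_αs, twist_γ,
        twist_γs, twist_twist, twist_zero, mul_smul_comm, mul_sub, rα_γ, rα_γs, rα_αs, rαs_α,
        rγs_γ, rαs_γ q φ hq, rαs_γs q φ hq, TensorProduct.tmul_smul, ← TensorProduct.smul_tmul',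
        TensorProduct.tmul_sub, TensorProduct.sub_tmul, Int.reduceMul, Int.reduceNeg,
        Int.reduceAdd, ph_neg, ph_eight, ph_zero]
      match_scalars <;> field_simp <;> ring)

/-- The coproduct: `Δ(1) = 1 ⊗ 1` and `Δ(x y) = Δ(x) Δ(y)` in the braided tensor square. -/
def comul (q φ : ℝ) (hq : q ≠ 0) : SU q φ →ₗ[ℂ] SU q φ ⊗[ℂ] SU q φ :=
  LinearMap.applyₗ (1 ⊗ₜ 1) ∘ₗ (comulHom q φ hq).toLinearMap

theorem comul_one (q φ : ℝ) (hq : q ≠ 0) : comul q φ hq 1 = 1 ⊗ₜ 1 := by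
  simp [comul]

theorem comul_gen_mul (q φ : ℝ) (hq : q ≠ 0) (x : SUGen) (y : SU q φ) :
    comul q φ hq (gen q φ x * y) =
      braidedMul (braiding q φ) (comulGen q φ x ⊗ₜ comul q φ hq y) := by
  simp [comul, comulHom, lift_gen, comulOp]

theorem comul_gen (q φ : ℝ) (hq : q ≠ 0) (x : SUGen) :
    comul q φ hq (gen q φ x) = comulGen q φ x := by
  have h : comul q φ hq (gen q φ x) = comulOp q φ x (1 ⊗ₜ 1) := by
    simp [comul, comulHom, lift_gen]
  rw [h]
  cases x <;>
    simp [comulOp_α, comulOp_αs, comulOp_γ, comulOp_γs, comulGen, phaseTwist_one]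

/-- The counit. -/
def counit (q φ : ℝ) : SU q φ →ₐ[ℂ] ℂ :=
  lift q φ (fun | .α => 1 | .αs => 1 | .γ => 0 | .γs => 0) (by
    intro r s h
    cases h <;> simp)

/-- The antipode on the generators. -/
def antipodeGen (q φ : ℝ) : SUGen → SU q φ
  | .α => αs q φ
  | .αs => α q φ
  | .γ => (-(q : ℂ) * ph φ 4) • γ q φ
  | .γs => (-(q : ℂ)⁻¹ * ph φ 4) • γs q φ

/-- The map `y ↦ m Ψ(S(x) ⊗ y)`, for a generator `x`. -/
def antipodeOp (q φ : ℝ) (x : SUGen) : Module.End ℂ (SU q φ) :=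
  LinearMap.mul' ℂ (SU q φ) ∘ₗ
    TensorProduct.curry (braiding q φ) (antipodeGen q φ x)

theorem braiding_gen (q φ : ℝ) (x : SUGen) (y : SU q φ) :
    braiding q φ (gen q φ x ⊗ₜ y) = phaseTwist φ (grading q φ) (δ x) y ⊗ₜ gen q φ x :=
  phaseBraiding_of_single _ _ _ _ _ _ (grading_gen q φ x)

theorem antipodeOp_α (q φ : ℝ) (y : SU q φ) : antipodeOp q φ .α y = y * αs q φ := by
  simp [antipodeOp, antipodeGen, αs, braiding_gen, δ, μ, ν, twist_zero]

theorem antipodeOp_αs (q φ : ℝ) (y : SU q φ) : antipodeOp q φ .αs y = y * α q φ := by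
  simp [antipodeOp, antipodeGen, α, braiding_gen, δ, μ, ν, twist_zero]

theorem antipodeOp_γ (q φ : ℝ) (y : SU q φ) :
    antipodeOp q φ .γ y =
      (-(q : ℂ) * ph φ 4) • (phaseTwist φ (grading q φ) (-2) y * γ q φ) := by
  simp only [antipodeOp, antipodeGen, γ, map_smul, LinearMap.comp_apply, LinearMap.smul_apply,
    TensorProduct.curry_apply, braiding_gen, LinearMap.mul'_apply]
  simp [δ, μ, ν]

theorem antipodeOp_γs (q φ : ℝ) (y : SU q φ) :
    antipodeOp q φ .γs y =
      (-(q : ℂ)⁻¹ * ph φ 4) • (phaseTwist φ (grading q φ) 2 y * γs q φ) := by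
  simp only [antipodeOp, antipodeGen, γs, map_smul, LinearMap.comp_apply, LinearMap.smul_apply,
    TensorProduct.curry_apply, braiding_gen, LinearMap.mul'_apply]
  simp [δ, μ, ν]

theorem twist_gen (q φ : ℝ) (m : ℤ) (x : SUGen) :
    phaseTwist φ (grading q φ) m (gen q φ x) = ph φ (2 * m * δ x) • gen q φ x :=
  phaseTwist_of_single _ _ _ _ _ (grading_gen q φ x)

/-- The homomorphism `x ↦ (S(y) ↦ S(x y))`, `S(x y) = m Ψ(S(x) ⊗ S(y))`. -/
def antipodeHom (q φ : ℝ) (hq : q ≠ 0) : SU q φ →ₐ[ℂ] Module.End ℂ (SU q φ) :=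
  lift q φ (antipodeOp q φ) (by
    intro r s h
    have hq' : (q : ℂ) ≠ 0 := by exact_mod_cast hq
    have hw := ph_ne_zero φ 4
    have t1 := fun m => twist_gen q φ m .α
    have t2 := fun m => twist_gen q φ m .αs
    have t3 := fun m => twist_gen q φ m .γ
    have t4 := fun m => twist_gen q φ m .γs
    change ∀ m, phaseTwist φ (grading q φ) m (α q φ) = _ • α q φ at t1
    change ∀ m, phaseTwist φ (grading q φ) m (αs q φ) = _ • αs q φ at t2
    change ∀ m, phaseTwist φ (grading q φ) m (γ q φ) = _ • γ q φ at t3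
    change ∀ m, phaseTwist φ (grading q φ) m (γs q φ) = _ • γs q φ at t4
    refine LinearMap.ext fun y => ?_
    cases h <;>
    · simp only [map_mul, map_add, map_smul, map_one, FreeAlgebra.lift_ι_apply,
        Module.End.mul_apply, Module.End.one_apply, LinearMap.add_apply, LinearMap.smul_apply,
        antipodeOp_α, antipodeOp_αs, antipodeOp_γ, antipodeOp_γs, phaseTwist_mul, t1, t2, t3, t4,
        twist_twist, twist_zero, mul_smul_comm, smul_mul_assoc, mul_sub, mul_assoc, mul_one,
        α_γ, α_γs, αs_γ q φ hq, αs_γs q φ hq, ← γ_γs, eq_sub_of_add_eq (α_αs q φ),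
        eq_sub_of_add_eq (αs_α q φ), δ, μ, ν, Int.reduceMul, Int.reduceNeg,
        Int.reduceAdd, Int.reduceSub, ph_neg, ph_eight, ph_zero]
      match_scalars <;> field_simp <;> ring)

/-- The antipode: `S(1) = 1` and `S(x y) = m Ψ(S(x) ⊗ S(y))`. -/
def antipode (q φ : ℝ) (hq : q ≠ 0) : SU q φ →ₗ[ℂ] SU q φ :=
  LinearMap.applyₗ 1 ∘ₗ (antipodeHom q φ hq).toLinearMap

theorem antipode_gen (q φ : ℝ) (hq : q ≠ 0) (x : SUGen) :
    antipode q φ hq (gen q φ x) = antipodeGen q φ x := by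
  have h : antipode q φ hq (gen q φ x) = antipodeOp q φ x 1 := by
    simp [antipode, antipodeHom, lift_gen]
  rw [h]
  cases x <;>
    simp [antipodeOp_α, antipodeOp_αs, antipodeOp_γ, antipodeOp_γs, antipodeGen, phaseTwist_one]

end SU

end SU

/-! ### The braided Hopf algebra `U_{q,φ}(û(2))` -/

section U

/-- The generators `e`, `f`, `k`, `k*`, `k⁻¹`, `(k*)⁻¹`. -/
inductive UGen : Type
  | e | f | k | ks | ki | ksi

open UGen in
/-- The defining relations of `U_{q,φ}(û(2))`, including those obtained by conjugation
(with `e* = f`). -/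
inductive URel (q φ : ℝ) : FreeAlgebra ℂ UGen → FreeAlgebra ℂ UGen → Prop
  | k_ki : URel q φ (.ι ℂ k * .ι ℂ ki) 1
  | ki_k : URel q φ (.ι ℂ ki * .ι ℂ k) 1
  | ks_ksi : URel q φ (.ι ℂ ks * .ι ℂ ksi) 1
  | ksi_ks : URel q φ (.ι ℂ ksi * .ι ℂ ks) 1
  | e_k : URel q φ (.ι ℂ e * .ι ℂ k) ((q * ph φ (-4)) • (.ι ℂ k * .ι ℂ e))
  | ks_f : URel q φ (.ι ℂ ks * .ι ℂ f) ((q * ph φ 4) • (.ι ℂ f * .ι ℂ ks))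
  | k_f : URel q φ (.ι ℂ k * .ι ℂ f) ((q * ph φ (-4)) • (.ι ℂ f * .ι ℂ k))
  | e_ks : URel q φ (.ι ℂ e * .ι ℂ ks) ((q * ph φ 4) • (.ι ℂ ks * .ι ℂ e))
  | e_f : URel q φ (.ι ℂ e * .ι ℂ f - .ι ℂ f * .ι ℂ e)
      ((1 / ((q : ℂ)⁻¹ - q)) • (.ι ℂ k * .ι ℂ ks - .ι ℂ ki * .ι ℂ ksi))
  | k_ks : URel q φ (.ι ℂ k * .ι ℂ ks) (.ι ℂ ks * .ι ℂ k)

/-- The algebra `U_{q,φ}(û(2))` over `ℂ`. -/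
def U (q φ : ℝ) : Type := RingQuot (URel q φ)

instance (q φ : ℝ) : Ring (U q φ) := inferInstanceAs (Ring (RingQuot (URel q φ)))

instance (q φ : ℝ) : Algebra ℂ (U q φ) := inferInstanceAs (Algebra ℂ (RingQuot (URel q φ)))

namespace U

/-- The quotient map from the free algebra. -/
def mk (q φ : ℝ) : FreeAlgebra ℂ UGen →ₐ[ℂ] U q φ := RingQuot.mkAlgHom ℂ (URel q φ)

/-- The generators as elements of `U_{q,φ}(û(2))`. -/
def gen (q φ : ℝ) (x : UGen) : U q φ := mk q φ (.ι ℂ x)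

theorem mk_rel {q φ : ℝ} {x y : FreeAlgebra ℂ UGen} (h : URel q φ x y) : mk q φ x = mk q φ y :=
  RingQuot.mkAlgHom_rel ℂ h

/-- The generator `e`. -/
def e (q φ : ℝ) : U q φ := gen q φ .e
/-- The generator `f`. -/
def f (q φ : ℝ) : U q φ := gen q φ .f
/-- The generator `k`. -/
def k (q φ : ℝ) : U q φ := gen q φ .k
/-- The generator `k*`. -/
def ks (q φ : ℝ) : U q φ := gen q φ .ks
/-- The generator `k⁻¹`. -/
def ki (q φ : ℝ) : U q φ := gen q φ .ki
/-- The generator `(k*)⁻¹`. -/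
def ksi (q φ : ℝ) : U q φ := gen q φ .ksi

theorem k_ki (q φ : ℝ) :
    k q φ * ki q φ = 1 := by
  simpa [e, f, k, ks, ki, ksi, gen] using mk_rel (URel.k_ki (q := q) (φ := φ))

theorem ki_k (q φ : ℝ) :
    ki q φ * k q φ = 1 := by
  simpa [e, f, k, ks, ki, ksi, gen] using mk_rel (URel.ki_k (q := q) (φ := φ))

theorem ks_ksi (q φ : ℝ) :
    ks q φ * ksi q φ = 1 := by
  simpa [e, f, k, ks, ki, ksi, gen] using mk_rel (URel.ks_ksi (q := q) (φ := φ))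

theorem ksi_ks (q φ : ℝ) :
    ksi q φ * ks q φ = 1 := by
  simpa [e, f, k, ks, ki, ksi, gen] using mk_rel (URel.ksi_ks (q := q) (φ := φ))

theorem e_k (q φ : ℝ) :
    e q φ * k q φ = (q * (ph φ 4)⁻¹) • (k q φ * e q φ) := by
  rw [← ph_neg]; simpa [e, f, k, ks, ki, ksi, gen] using mk_rel (URel.e_k (q := q) (φ := φ))

theorem e_ks (q φ : ℝ) :
    e q φ * ks q φ = (q * ph φ 4) • (ks q φ * e q φ) := by
  simpa [e, f, k, ks, ki, ksi, gen] using mk_rel (URel.e_ks (q := q) (φ := φ))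

theorem k_f (q φ : ℝ) :
    k q φ * f q φ = (q * (ph φ 4)⁻¹) • (f q φ * k q φ) := by
  rw [← ph_neg]; simpa [e, f, k, ks, ki, ksi, gen] using mk_rel (URel.k_f (q := q) (φ := φ))

theorem ks_f (q φ : ℝ) :
    ks q φ * f q φ = (q * ph φ 4) • (f q φ * ks q φ) := by
  simpa [e, f, k, ks, ki, ksi, gen] using mk_rel (URel.ks_f (q := q) (φ := φ))

theorem e_f (q φ : ℝ) :
    e q φ * f q φ = f q φ * e q φ +
      (1 / ((q : ℂ)⁻¹ - q)) • (k q φ * ks q φ - ki q φ * ksi q φ) := by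
  rw [← sub_eq_iff_eq_add']
  simpa [e, f, k, ks, ki, ksi, gen] using mk_rel (URel.e_f (q := q) (φ := φ))

theorem ks_k (q φ : ℝ) :
    ks q φ * k q φ = k q φ * ks q φ := by
  symm
  simpa [e, f, k, ks, ki, ksi, gen] using mk_rel (URel.k_ks (q := q) (φ := φ))

theorem comm_inv {q φ : ℝ} {a b b' : U q φ} {s : ℂ} (hs : s ≠ 0) (h : a * b = s • (b * a))
    (h₁ : b * b' = 1) (h₂ : b' * b = 1) : a * b' = s⁻¹ • (b' * a) := by
  have h₃ : b' * (a * b) * b' = s • (a * b') := by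
    rw [h, mul_smul_comm, smul_mul_assoc, ← mul_assoc b' b a, h₂, one_mul]
  rw [mul_assoc, mul_assoc, h₁, mul_one] at h₃
  rw [h₃, smul_smul, inv_mul_cancel₀ hs, one_smul]

theorem comm_symm {q φ : ℝ} {a b : U q φ} {s : ℂ} (hs : s ≠ 0) (h : a * b = s • (b * a)) :
    b * a = s⁻¹ • (a * b) := by
  rw [h, smul_smul, inv_mul_cancel₀ hs, one_smul]

theorem ne₁ {q φ : ℝ} (hq : q ≠ 0) : (q : ℂ) * ph φ 4 ≠ 0 :=
  mul_ne_zero (by exact_mod_cast hq) (ph_ne_zero φ 4)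

theorem ne₂ {q φ : ℝ} (hq : q ≠ 0) : (q : ℂ) * (ph φ 4)⁻¹ ≠ 0 :=
  mul_ne_zero (by exact_mod_cast hq) (inv_ne_zero (ph_ne_zero φ 4))

theorem f_k (q φ : ℝ) (hq : q ≠ 0) :
    f q φ * k q φ = (q * (ph φ 4)⁻¹ : ℂ)⁻¹ • (k q φ * f q φ) := by
  exact comm_symm (ne₂ hq) (k_f q φ)

theorem f_ks (q φ : ℝ) (hq : q ≠ 0) :
    f q φ * ks q φ = (q * ph φ 4 : ℂ)⁻¹ • (ks q φ * f q φ) := by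
  exact comm_symm (ne₁ hq) (ks_f q φ)

theorem e_ki (q φ : ℝ) (hq : q ≠ 0) :
    e q φ * ki q φ = (q * (ph φ 4)⁻¹ : ℂ)⁻¹ • (ki q φ * e q φ) := by
  exact comm_inv (ne₂ hq) (e_k q φ) (k_ki q φ) (ki_k q φ)

theorem e_ksi (q φ : ℝ) (hq : q ≠ 0) :
    e q φ * ksi q φ = (q * ph φ 4 : ℂ)⁻¹ • (ksi q φ * e q φ) := by
  exact comm_inv (ne₁ hq) (e_ks q φ) (ks_ksi q φ) (ksi_ks q φ)

theorem f_ki (q φ : ℝ) (hq : q ≠ 0) :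
    f q φ * ki q φ = (q * (ph φ 4)⁻¹ : ℂ) • (ki q φ * f q φ) := by
  simpa using comm_inv (inv_ne_zero (ne₂ hq)) (f_k q φ hq) (k_ki q φ) (ki_k q φ)

theorem f_ksi (q φ : ℝ) (hq : q ≠ 0) :
    f q φ * ksi q φ = (q * ph φ 4 : ℂ) • (ksi q φ * f q φ) := by
  simpa using comm_inv (inv_ne_zero (ne₁ hq)) (f_ks q φ hq) (ks_ksi q φ) (ksi_ks q φ)

theorem ks_ki (q φ : ℝ) :
    ks q φ * ki q φ = ki q φ * ks q φ := by
  simpa using comm_inv one_ne_zero (by rw [one_smul]; exact ks_k q φ) (k_ki q φ) (ki_k q φ)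

theorem ksi_k (q φ : ℝ) :
    ksi q φ * k q φ = k q φ * ksi q φ := by
  symm
  simpa using comm_inv one_ne_zero (by rw [one_smul]; exact (ks_k q φ).symm) (ks_ksi q φ) (ksi_ks q φ)

theorem ksi_ki (q φ : ℝ) :
    ksi q φ * ki q φ = ki q φ * ksi q φ := by
  simpa using comm_inv one_ne_zero (by rw [one_smul]; exact ksi_k q φ) (k_ki q φ) (ki_k q φ)

/-! The same rules inside longer products. -/

theorem assoc_smul {q φ : ℝ} {a b : U q φ} {s : ℂ} (h : a * b = s • (b * a)) (x : U q φ) :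
    a * (b * x) = s • (b * (a * x)) := by
  rw [← mul_assoc, h, smul_mul_assoc, mul_assoc]

theorem assoc_comm {q φ : ℝ} {a b : U q φ} (h : a * b = b * a) (x : U q φ) :
    a * (b * x) = b * (a * x) := by
  rw [← mul_assoc, h, mul_assoc]

theorem assoc_one {q φ : ℝ} {a b : U q φ} (h : a * b = 1) (x : U q φ) : a * (b * x) = x := by
  rw [← mul_assoc, h, one_mul]

theorem re_f (q φ : ℝ) (x : U q φ) :
    e q φ * (f q φ * x) = f q φ * (e q φ * x) +
      (1 / ((q : ℂ)⁻¹ - q)) • (k q φ * (ks q φ * x) - ki q φ * (ksi q φ * x)) := by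
  rw [← mul_assoc, e_f, add_mul, smul_mul_assoc, sub_mul, mul_assoc, mul_assoc, mul_assoc]

/-- The homomorphism out of `U_{q,φ}(û(2))` with prescribed values on the generators. -/
def lift (q φ : ℝ) {B : Type} [Ring B] [Algebra ℂ B] (f : UGen → B)
    (hf : ∀ ⦃x y⦄, URel q φ x y → FreeAlgebra.lift ℂ f x = FreeAlgebra.lift ℂ f y) :
    U q φ →ₐ[ℂ] B :=
  RingQuot.liftAlgHom ℂ ⟨FreeAlgebra.lift ℂ f, hf⟩

theorem lift_gen (q φ : ℝ) {B : Type} [Ring B] [Algebra ℂ B] (f : UGen → B)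
    (hf : ∀ ⦃x y⦄, URel q φ x y → FreeAlgebra.lift ℂ f x = FreeAlgebra.lift ℂ f y) (x : UGen) :
    lift q φ f hf (gen q φ x) = f x := by
  change RingQuot.liftAlgHom ℂ _ (RingQuot.mkAlgHom ℂ (URel q φ) (.ι ℂ x)) = _
  rw [RingQuot.liftAlgHom_mkAlgHom_apply, FreeAlgebra.lift_ι_apply]

theorem algHom_ext {q φ : ℝ} {B : Type} [Ring B] [Algebra ℂ B] {f g : U q φ →ₐ[ℂ] B}
    (h : ∀ x, f (gen q φ x) = g (gen q φ x)) : f = g := by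
  refine RingQuot.ringQuot_ext' ℂ f g (FreeAlgebra.hom_ext ?_)
  funext x
  exact h x

/-- The degree `μ` of the generators. -/
def μ : UGen → ℤ
  | .e => -1 | .f => 1 | .k => 1 | .ks => -1 | .ki => -1 | .ksi => 1

/-- The degree `ν` of the generators. -/
def ν : UGen → ℤ
  | .e => 1 | .f => -1 | .k => 1 | .ks => -1 | .ki => -1 | .ksi => 1

/-- The index `δ = μ - ν` of the generators. -/
def δ (x : UGen) : ℤ := μ x - ν x

/-- The grading of `U_{q,φ}(û(2))` by the index `δ`, additive on products of generators. -/
def grading (q φ : ℝ) : U q φ →ₐ[ℂ] AddMonoidAlgebra (U q φ) ℤ :=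
  lift q φ (fun x => AddMonoidAlgebra.single (δ x) (gen q φ x)) (by
    intro x y h
    cases h <;>
      simp only [map_mul, map_add, map_sub, map_smul, map_one, FreeAlgebra.lift_ι_apply,
        AddMonoidAlgebra.single_mul_single, AddMonoidAlgebra.smul_single, AddMonoidAlgebra.one_def]
    · congr 1; exact k_ki q φ
    · congr 1; exact ki_k q φ
    · congr 1; exact ks_ksi q φ
    · congr 1; exact ksi_ks q φ
    · rw [ph_neg]; congr 1; exact e_k q φ
    · congr 1; exact ks_f q φ
    · rw [ph_neg]; congr 1; exact k_f q φ
    · congr 1; exact e_ks q φ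
    · have h := eq_sub_of_add_eq' (e_f q φ).symm
      have h' := congrArg (AddMonoidAlgebra.single (0 : ℤ)) h.symm
      rw [← AddMonoidAlgebra.smul_single, AddMonoidAlgebra.single_sub,
        AddMonoidAlgebra.single_sub] at h'
      exact h'
    · congr 1; exact (ks_k q φ).symm)

/-- The braiding of `U_{q,φ}(û(2))`. -/
def braiding (q φ : ℝ) : U q φ ⊗[ℂ] U q φ →ₗ[ℂ] U q φ ⊗[ℂ] U q φ :=
  phaseBraiding φ (grading q φ) (grading q φ)

/-- The coproduct on the generators. -/
def comulGen (q φ : ℝ) : UGen → U q φ ⊗[ℂ] U q φ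
  | .e => e q φ ⊗ₜ k q φ + ki q φ ⊗ₜ e q φ
  | .f => f q φ ⊗ₜ ks q φ + ksi q φ ⊗ₜ f q φ
  | .k => k q φ ⊗ₜ k q φ
  | .ks => ks q φ ⊗ₜ ks q φ
  | .ki => ki q φ ⊗ₜ ki q φ
  | .ksi => ksi q φ ⊗ₜ ksi q φ

theorem grading_gen (q φ : ℝ) (x : UGen) :
    grading q φ (gen q φ x) = AddMonoidAlgebra.single (δ x) (gen q φ x) :=
  lift_gen q φ _ _ x

theorem twist_gen_mul (q φ : ℝ) (m : ℤ) (x : UGen) (y : U q φ) :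
    phaseTwist φ (grading q φ) m (gen q φ x * y) =
      ph φ (2 * m * δ x) • (gen q φ x * phaseTwist φ (grading q φ) m y) := by
  rw [phaseTwist_mul, phaseTwist_of_single _ _ _ _ _ (grading_gen q φ x), smul_mul_assoc]

theorem twist_zero (q φ : ℝ) (y : U q φ) : phaseTwist φ (grading q φ) 0 y = y := by
  have h : AlgHom.ofLinearMap (phaseTwist φ (grading q φ) 0) (phaseTwist_one φ _ 0)
      (phaseTwist_mul φ _ 0) = AlgHom.id ℂ (U q φ) := by
    apply algHom_ext
    intro x
    simp [phaseTwist_of_single _ _ _ _ _ (grading_gen q φ x), ph_zero]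
  exact congrArg (fun f => f y) h

theorem twist_twist (q φ : ℝ) (m n : ℤ) (y : U q φ) :
    phaseTwist φ (grading q φ) m (phaseTwist φ (grading q φ) n y) =
      phaseTwist φ (grading q φ) (m + n) y := by
  let T : ℤ → U q φ →ₐ[ℂ] U q φ := fun k =>
    AlgHom.ofLinearMap (phaseTwist φ (grading q φ) k) (phaseTwist_one φ _ k) (phaseTwist_mul φ _ k)
  have h : (T m).comp (T n) = T (m + n) := by
    apply algHom_ext
    intro x
    have hx := fun k => phaseTwist_of_single φ (grading q φ) k (δ x) _ (grading_gen q φ x)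
    simp only [T, AlgHom.comp_apply, AlgHom.ofLinearMap_apply, hx, map_smul, smul_smul, ← ph_add]
    congr 2
    ring
  exact congrArg (fun f => f y) h

/-- Braided multiplication from the left by `Δ(x)`, for a generator `x`. -/
def comulOp (q φ : ℝ) (x : UGen) : Module.End ℂ (U q φ ⊗[ℂ] U q φ) :=
  TensorProduct.curry (braidedMul (braiding q φ)) (comulGen q φ x)

theorem braidedMul_gen (q φ : ℝ) (a x y : U q φ) (b : UGen) :
    braidedMul (braiding q φ) ((a ⊗ₜ gen q φ b) ⊗ₜ (x ⊗ₜ y)) =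
      (a * phaseTwist φ (grading q φ) (δ b) x) ⊗ₜ (gen q φ b * y) :=
  braidedMul_of_single φ _ _ _ _ _ _ (grading_gen q φ b)

theorem comulOp_e (q φ : ℝ) (x y : U q φ) :
    comulOp q φ .e (x ⊗ₜ y) = (e q φ * x) ⊗ₜ (k q φ * y) +
      (ki q φ * phaseTwist φ (grading q φ) (-2) x) ⊗ₜ (e q φ * y) := by
  simp only [comulOp, comulGen, e, k, map_add, LinearMap.add_apply,
    TensorProduct.curry_apply, braidedMul_gen]
  simp [δ, μ, ν, twist_zero]

theorem comulOp_f (q φ : ℝ) (x y : U q φ) :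
    comulOp q φ .f (x ⊗ₜ y) = (f q φ * x) ⊗ₜ (ks q φ * y) +
      (ksi q φ * phaseTwist φ (grading q φ) 2 x) ⊗ₜ (f q φ * y) := by
  simp only [comulOp, comulGen, f, ks, map_add, LinearMap.add_apply,
    TensorProduct.curry_apply, braidedMul_gen]
  simp [δ, μ, ν, twist_zero]

theorem comulOp_k (q φ : ℝ) (x y : U q φ) :
    comulOp q φ .k (x ⊗ₜ y) = (k q φ * x) ⊗ₜ (k q φ * y) := by
  simp [comulOp, comulGen, k, braidedMul_gen, δ, μ, ν, twist_zero]

theorem comulOp_ks (q φ : ℝ) (x y : U q φ) :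
    comulOp q φ .ks (x ⊗ₜ y) = (ks q φ * x) ⊗ₜ (ks q φ * y) := by
  simp [comulOp, comulGen, ks, braidedMul_gen, δ, μ, ν, twist_zero]

theorem comulOp_ki (q φ : ℝ) (x y : U q φ) :
    comulOp q φ .ki (x ⊗ₜ y) = (ki q φ * x) ⊗ₜ (ki q φ * y) := by
  simp [comulOp, comulGen, ki, braidedMul_gen, δ, μ, ν, twist_zero]

theorem comulOp_ksi (q φ : ℝ) (x y : U q φ) :
    comulOp q φ .ksi (x ⊗ₜ y) = (ksi q φ * x) ⊗ₜ (ksi q φ * y) := by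
  simp [comulOp, comulGen, ksi, braidedMul_gen, δ, μ, ν, twist_zero]

theorem twist_e (q φ : ℝ) (m : ℤ) (y : U q φ) :
    phaseTwist φ (grading q φ) m (e q φ * y) =
      ph φ (2 * m * (-2)) • (e q φ * phaseTwist φ (grading q φ) m y) := by
  simpa [e, δ, μ, ν, ph_zero] using twist_gen_mul q φ m .e y

theorem twist_f (q φ : ℝ) (m : ℤ) (y : U q φ) :
    phaseTwist φ (grading q φ) m (f q φ * y) =
      ph φ (2 * m * 2) • (f q φ * phaseTwist φ (grading q φ) m y) := by
  simpa [f, δ, μ, ν, ph_zero] using twist_gen_mul q φ m .f y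

theorem twist_k (q φ : ℝ) (m : ℤ) (y : U q φ) :
    phaseTwist φ (grading q φ) m (k q φ * y) = k q φ * phaseTwist φ (grading q φ) m y := by
  simpa [k, δ, μ, ν, ph_zero] using twist_gen_mul q φ m .k y

theorem twist_ks (q φ : ℝ) (m : ℤ) (y : U q φ) :
    phaseTwist φ (grading q φ) m (ks q φ * y) = ks q φ * phaseTwist φ (grading q φ) m y := by
  simpa [ks, δ, μ, ν, ph_zero] using twist_gen_mul q φ m .ks y

theorem twist_ki (q φ : ℝ) (m : ℤ) (y : U q φ) :
    phaseTwist φ (grading q φ) m (ki q φ * y) = ki q φ * phaseTwist φ (grading q φ) m y := by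
  simpa [ki, δ, μ, ν, ph_zero] using twist_gen_mul q φ m .ki y

theorem twist_ksi (q φ : ℝ) (m : ℤ) (y : U q φ) :
    phaseTwist φ (grading q φ) m (ksi q φ * y) = ksi q φ * phaseTwist φ (grading q φ) m y := by
  simpa [ksi, δ, μ, ν, ph_zero] using twist_gen_mul q φ m .ksi y

/-- Left multiplication by `Δ(x)` in the braided tensor square, as a homomorphism in `x`. -/
def comulHom (q φ : ℝ) (hq : q ≠ 0) : U q φ →ₐ[ℂ] Module.End ℂ (U q φ ⊗[ℂ] U q φ) :=
  lift q φ (comulOp q φ) (by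
    intro r s h
    have hq' : (q : ℂ) ≠ 0 := by exact_mod_cast hq
    have hw := ph_ne_zero φ 4
    refine TensorProduct.ext' fun x y => ?_
    cases h <;>
    · simp only [map_mul, map_add, map_smul, map_one, FreeAlgebra.lift_ι_apply,
        Module.End.mul_apply, Module.End.one_apply, LinearMap.add_apply, LinearMap.smul_apply,
        LinearMap.sub_apply, comulOp_e, comulOp_f, comulOp_k, comulOp_ks, comulOp_ki, comulOp_ksi,
        map_sub, twist_e, twist_f, twist_k, twist_ks, twist_ki, twist_ksi,
        twist_twist, mul_smul_comm, mul_add, mul_sub, smul_sub, smul_add,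
        assoc_smul (e_k q φ), assoc_smul (e_ks q φ),
        assoc_smul (e_ki q φ hq), assoc_smul (e_ksi q φ hq), assoc_smul (f_k q φ hq),
        assoc_smul (f_ks q φ hq), assoc_smul (f_ki q φ hq), assoc_smul (f_ksi q φ hq),
        assoc_comm (ks_k q φ), assoc_comm (ks_ki q φ), assoc_comm (ksi_k q φ),
        assoc_comm (ksi_ki q φ), assoc_one (k_ki q φ), assoc_one (ki_k q φ),
        assoc_one (ks_ksi q φ), assoc_one (ksi_ks q φ), re_f,
        TensorProduct.tmul_smul, ← TensorProduct.smul_tmul', TensorProduct.tmul_add,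
        TensorProduct.add_tmul, TensorProduct.tmul_sub, TensorProduct.sub_tmul, Int.reduceMul,
        Int.reduceNeg, Int.reduceAdd, twist_zero, ph_neg, ph_eight, ph_zero]
      try generalize 1 / ((q : ℂ)⁻¹ - q) = c
      try match_scalars <;> field_simp <;> ring)

/-- The coproduct: `Δ(1) = 1 ⊗ 1` and `Δ(x y) = Δ(x) Δ(y)` in the braided tensor square. -/
def comul (q φ : ℝ) (hq : q ≠ 0) : U q φ →ₗ[ℂ] U q φ ⊗[ℂ] U q φ :=
  LinearMap.applyₗ (1 ⊗ₜ 1) ∘ₗ (comulHom q φ hq).toLinearMap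

theorem comul_one (q φ : ℝ) (hq : q ≠ 0) : comul q φ hq 1 = 1 ⊗ₜ 1 := by
  simp [comul]

theorem comul_gen_mul (q φ : ℝ) (hq : q ≠ 0) (x : UGen) (y : U q φ) :
    comul q φ hq (gen q φ x * y) =
      braidedMul (braiding q φ) (comulGen q φ x ⊗ₜ comul q φ hq y) := by
  simp [comul, comulHom, lift_gen, comulOp]

theorem comul_gen (q φ : ℝ) (hq : q ≠ 0) (x : UGen) :
    comul q φ hq (gen q φ x) = comulGen q φ x := by
  have h : comul q φ hq (gen q φ x) = comulOp q φ x (1 ⊗ₜ 1) := by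
    simp [comul, comulHom, lift_gen]
  rw [h]
  cases x <;>
    simp [comulOp_e, comulOp_f, comulOp_k, comulOp_ks, comulOp_ki, comulOp_ksi, comulGen,
      phaseTwist_one]

/-- The counit. -/
def counit (q φ : ℝ) : U q φ →ₐ[ℂ] ℂ :=
  lift q φ (fun | .e => 0 | .f => 0 | .k => 1 | .ks => 1 | .ki => 1 | .ksi => 1) (by
    intro r s h
    cases h <;> simp)

/-- The antipode on the generators. -/
def antipodeGen (q φ : ℝ) : UGen → U q φ
  | .e => (-(q : ℂ)⁻¹ * ph φ 4) • e q φ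
  | .f => (-(q : ℂ) * ph φ 4) • f q φ
  | .k => ki q φ
  | .ks => ksi q φ
  | .ki => k q φ
  | .ksi => ks q φ

/-- The map `y ↦ m Ψ(S(x) ⊗ y)`, for a generator `x`. -/
def antipodeOp (q φ : ℝ) (x : UGen) : Module.End ℂ (U q φ) :=
  LinearMap.mul' ℂ (U q φ) ∘ₗ
    TensorProduct.curry (braiding q φ) (antipodeGen q φ x)

theorem braiding_gen (q φ : ℝ) (x : UGen) (y : U q φ) :
    braiding q φ (gen q φ x ⊗ₜ y) = phaseTwist φ (grading q φ) (δ x) y ⊗ₜ gen q φ x :=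
  phaseBraiding_of_single _ _ _ _ _ _ (grading_gen q φ x)

theorem antipodeOp_k (q φ : ℝ) (y : U q φ) : antipodeOp q φ .k y = y * ki q φ := by
  simp [antipodeOp, antipodeGen, ki, braiding_gen, δ, μ, ν, twist_zero]

theorem antipodeOp_ks (q φ : ℝ) (y : U q φ) : antipodeOp q φ .ks y = y * ksi q φ := by
  simp [antipodeOp, antipodeGen, ksi, braiding_gen, δ, μ, ν, twist_zero]

theorem antipodeOp_ki (q φ : ℝ) (y : U q φ) : antipodeOp q φ .ki y = y * k q φ := by
  simp [antipodeOp, antipodeGen, k, braiding_gen, δ, μ, ν, twist_zero]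

theorem antipodeOp_ksi (q φ : ℝ) (y : U q φ) : antipodeOp q φ .ksi y = y * ks q φ := by
  simp [antipodeOp, antipodeGen, ks, braiding_gen, δ, μ, ν, twist_zero]

theorem antipodeOp_e (q φ : ℝ) (y : U q φ) :
    antipodeOp q φ .e y =
      (-(q : ℂ)⁻¹ * ph φ 4) • (phaseTwist φ (grading q φ) (-2) y * e q φ) := by
  simp only [antipodeOp, antipodeGen, e, map_smul, LinearMap.comp_apply, LinearMap.smul_apply,
    TensorProduct.curry_apply, braiding_gen, LinearMap.mul'_apply]
  simp [δ, μ, ν]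

theorem antipodeOp_f (q φ : ℝ) (y : U q φ) :
    antipodeOp q φ .f y =
      (-(q : ℂ) * ph φ 4) • (phaseTwist φ (grading q φ) 2 y * f q φ) := by
  simp only [antipodeOp, antipodeGen, f, map_smul, LinearMap.comp_apply, LinearMap.smul_apply,
    TensorProduct.curry_apply, braiding_gen, LinearMap.mul'_apply]
  simp [δ, μ, ν]

theorem twist_gen (q φ : ℝ) (m : ℤ) (x : UGen) :
    phaseTwist φ (grading q φ) m (gen q φ x) = ph φ (2 * m * δ x) • gen q φ x :=
  phaseTwist_of_single _ _ _ _ _ (grading_gen q φ x)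

/-- The homomorphism `x ↦ (S(y) ↦ S(x y))`, `S(x y) = m Ψ(S(x) ⊗ S(y))`. -/
def antipodeHom (q φ : ℝ) (hq : q ≠ 0) : U q φ →ₐ[ℂ] Module.End ℂ (U q φ) :=
  lift q φ (antipodeOp q φ) (by
    intro r s h
    have hq' : (q : ℂ) ≠ 0 := by exact_mod_cast hq
    have hw := ph_ne_zero φ 4
    have t1 := fun m => twist_gen q φ m .e
    have t2 := fun m => twist_gen q φ m .f
    have t3 := fun m => twist_gen q φ m .k
    have t4 := fun m => twist_gen q φ m .ks
    have t5 := fun m => twist_gen q φ m .ki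
    have t6 := fun m => twist_gen q φ m .ksi
    change ∀ m, phaseTwist φ (grading q φ) m (e q φ) = _ • e q φ at t1
    change ∀ m, phaseTwist φ (grading q φ) m (f q φ) = _ • f q φ at t2
    change ∀ m, phaseTwist φ (grading q φ) m (k q φ) = _ • k q φ at t3
    change ∀ m, phaseTwist φ (grading q φ) m (ks q φ) = _ • ks q φ at t4
    change ∀ m, phaseTwist φ (grading q φ) m (ki q φ) = _ • ki q φ at t5
    change ∀ m, phaseTwist φ (grading q φ) m (ksi q φ) = _ • ksi q φ at t6
    refine LinearMap.ext fun y => ?_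
    cases h <;>
    · simp only [map_mul, map_add, map_smul, map_one, FreeAlgebra.lift_ι_apply,
        Module.End.mul_apply, Module.End.one_apply, LinearMap.add_apply, LinearMap.smul_apply,
        LinearMap.sub_apply, map_sub, antipodeOp_e, antipodeOp_f, antipodeOp_k, antipodeOp_ks,
        antipodeOp_ki, antipodeOp_ksi, phaseTwist_mul, t1, t2, t3, t4, t5, t6,
        twist_twist, mul_smul_comm, smul_mul_assoc, mul_add, mul_sub, smul_sub, smul_add,
        mul_assoc, mul_one,
        e_k, e_ks, e_ki q φ hq, e_ksi q φ hq, f_k q φ hq, f_ks q φ hq, f_ki q φ hq,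
        f_ksi q φ hq, ks_k, ks_ki, ksi_k, ksi_ki, k_ki, ki_k, ks_ksi, ksi_ks, e_f,
        δ, μ, ν, Int.reduceMul, Int.reduceNeg, Int.reduceAdd, Int.reduceSub, twist_zero,
        ph_neg, ph_eight, ph_zero]
      try generalize 1 / ((q : ℂ)⁻¹ - q) = c
      try match_scalars <;> field_simp <;> ring)

/-- The antipode: `S(1) = 1` and `S(x y) = m Ψ(S(x) ⊗ S(y))`. -/
def antipode (q φ : ℝ) (hq : q ≠ 0) : U q φ →ₗ[ℂ] U q φ :=
  LinearMap.applyₗ 1 ∘ₗ (antipodeHom q φ hq).toLinearMap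

theorem antipode_gen (q φ : ℝ) (hq : q ≠ 0) (x : UGen) :
    antipode q φ hq (gen q φ x) = antipodeGen q φ x := by
  have h : antipode q φ hq (gen q φ x) = antipodeOp q φ x 1 := by
    simp [antipode, antipodeHom, lift_gen]
  rw [h]
  cases x <;>
    simp [antipodeOp_e, antipodeOp_f, antipodeOp_k, antipodeOp_ks, antipodeOp_ki, antipodeOp_ksi,
      antipodeGen, phaseTwist_one]

end U

end U

/-! ### The mutual braidings, the pairing and the actions on generators -/

section Mutual

/-- The mutual braiding `Ξ(h ⊗ a) = e^{2iφ δ(h) δ(a)} a ⊗ h`. -/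
def mutualBraiding (q φ : ℝ) : U q φ ⊗[ℂ] SU q φ →ₗ[ℂ] SU q φ ⊗[ℂ] U q φ :=
  phaseBraiding φ (U.grading q φ) (SU.grading q φ)

/-- The mutual braiding in the opposite direction, `a ⊗ h ↦ e^{2iφ δ(h) δ(a)} h ⊗ a`. -/
def mutualBraidingRev (q φ : ℝ) : SU q φ ⊗[ℂ] U q φ →ₗ[ℂ] U q φ ⊗[ℂ] SU q φ :=
  phaseBraiding φ (SU.grading q φ) (U.grading q φ)

/-- The values of the pairing on generators. -/
def pairingGen (q φ : ℝ) : UGen → SUGen → ℂ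
  | .e, .γs => -(q : ℂ)⁻¹ * ph φ (-4)
  | .f, .γ => 1
  | .k, .α => (Real.sqrt q : ℂ)⁻¹ * ph φ 2
  | .k, .αs => (Real.sqrt q : ℂ) * ph φ (-2)
  | .ks, .α => (Real.sqrt q : ℂ)⁻¹ * ph φ (-2)
  | .ks, .αs => (Real.sqrt q : ℂ) * ph φ 2
  | .ki, .α => (Real.sqrt q : ℂ) * ph φ (-2)
  | .ki, .αs => (Real.sqrt q : ℂ)⁻¹ * ph φ 2
  | .ksi, .α => (Real.sqrt q : ℂ) * ph φ 2
  | .ksi, .αs => (Real.sqrt q : ℂ)⁻¹ * ph φ (-2)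
  | _, _ => 0

/-- The values `h ▷ x` of the left action on generators. -/
def leftActGen (q φ : ℝ) : UGen → SUGen → SU q φ
  | .e, .α => 0
  | .e, .αs => SU.γ q φ
  | .e, .γ => 0
  | .e, .γs => (-(q : ℂ)⁻¹ * ph φ (-4)) • SU.α q φ
  | .f, .α => (-(q : ℂ) * ph φ 4) • SU.γs q φ
  | .f, .αs => 0
  | .f, .γ => SU.αs q φ
  | .f, .γs => 0
  | .k, .α => ((Real.sqrt q : ℂ)⁻¹ * ph φ 2) • SU.α q φ
  | .k, .αs => ((Real.sqrt q : ℂ) * ph φ (-2)) • SU.αs q φ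
  | .k, .γ => ((Real.sqrt q : ℂ)⁻¹ * ph φ 2) • SU.γ q φ
  | .k, .γs => ((Real.sqrt q : ℂ) * ph φ (-2)) • SU.γs q φ
  | .ks, .α => ((Real.sqrt q : ℂ)⁻¹ * ph φ (-2)) • SU.α q φ
  | .ks, .αs => ((Real.sqrt q : ℂ) * ph φ 2) • SU.αs q φ
  | .ks, .γ => ((Real.sqrt q : ℂ)⁻¹ * ph φ (-2)) • SU.γ q φ
  | .ks, .γs => ((Real.sqrt q : ℂ) * ph φ 2) • SU.γs q φ
  | .ki, .α => ((Real.sqrt q : ℂ) * ph φ (-2)) • SU.α q φ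
  | .ki, .αs => ((Real.sqrt q : ℂ)⁻¹ * ph φ 2) • SU.αs q φ
  | .ki, .γ => ((Real.sqrt q : ℂ) * ph φ (-2)) • SU.γ q φ
  | .ki, .γs => ((Real.sqrt q : ℂ)⁻¹ * ph φ 2) • SU.γs q φ
  | .ksi, .α => ((Real.sqrt q : ℂ) * ph φ 2) • SU.α q φ
  | .ksi, .αs => ((Real.sqrt q : ℂ)⁻¹ * ph φ (-2)) • SU.αs q φ
  | .ksi, .γ => ((Real.sqrt q : ℂ) * ph φ 2) • SU.γ q φ
  | .ksi, .γs => ((Real.sqrt q : ℂ)⁻¹ * ph φ (-2)) • SU.γs q φ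

/-- The values `x ◁ h` of the right action on generators. -/
def rightActGen (q φ : ℝ) : SUGen → UGen → SU q φ
  | .α, .e => SU.γ q φ
  | .αs, .e => 0
  | .γ, .e => 0
  | .γs, .e => (-(q : ℂ)⁻¹ * ph φ (-4)) • SU.αs q φ
  | .α, .f => 0
  | .αs, .f => (-(q : ℂ) * ph φ 4) • SU.γs q φ
  | .γ, .f => SU.α q φ
  | .γs, .f => 0
  | .α, .k => ((Real.sqrt q : ℂ)⁻¹ * ph φ 2) • SU.α q φ
  | .αs, .k => ((Real.sqrt q : ℂ) * ph φ (-2)) • SU.αs q φ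
  | .γ, .k => ((Real.sqrt q : ℂ) * ph φ (-2)) • SU.γ q φ
  | .γs, .k => ((Real.sqrt q : ℂ)⁻¹ * ph φ 2) • SU.γs q φ
  | .α, .ks => ((Real.sqrt q : ℂ)⁻¹ * ph φ (-2)) • SU.α q φ
  | .αs, .ks => ((Real.sqrt q : ℂ) * ph φ 2) • SU.αs q φ
  | .γ, .ks => ((Real.sqrt q : ℂ) * ph φ 2) • SU.γ q φ
  | .γs, .ks => ((Real.sqrt q : ℂ)⁻¹ * ph φ (-2)) • SU.γs q φ
  | .α, .ki => ((Real.sqrt q : ℂ) * ph φ (-2)) • SU.α q φ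
  | .αs, .ki => ((Real.sqrt q : ℂ)⁻¹ * ph φ 2) • SU.αs q φ
  | .γ, .ki => ((Real.sqrt q : ℂ)⁻¹ * ph φ 2) • SU.γ q φ
  | .γs, .ki => ((Real.sqrt q : ℂ) * ph φ (-2)) • SU.γs q φ
  | .α, .ksi => ((Real.sqrt q : ℂ) * ph φ 2) • SU.α q φ
  | .αs, .ksi => ((Real.sqrt q : ℂ)⁻¹ * ph φ (-2)) • SU.αs q φ
  | .γ, .ksi => ((Real.sqrt q : ℂ)⁻¹ * ph φ (-2)) • SU.γ q φ
  | .γs, .ksi => ((Real.sqrt q : ℂ) * ph φ 2) • SU.γs q φ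

end Mutual

end BraidedSU2

end

/-! Write T_k for the twist x ↦ e^{2iφkδ(x)} x, an algebra endomorphism. When one argument is
homogeneous, a phase braiding is the flip together with a twist of the other argument. All braid
axioms therefore reduce to three facts: twists are multiplicative, they commute with one another,
and they commute with the structure maps.

The braided Hopf axioms need only be checked on generators. Coassociativity compares two maps that
are multiplicative into the braided tensor cube. The counit laws compare multiplicative maps into
the algebra itself. The antipode laws telescope: in m(S ⊗ id)Δ(xy) and m(id ⊗ S)Δ(xy) one factor
collapses to a scalar inside the other. What is left on generators is a finite list of identities,
which follow from the defining relations.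

The pairing is obtained from the left action, not conversely, so no basis of H or A is needed. The
product rule forces x ▷ (y w), for generators x of H and y of A, to be a combination of the elements
x' ▷ w with x' a generator of H. Hence y acts on tuples indexed by the generators of H, and these
operators satisfy the relations of A (`SU.leftActHom`). Evaluating at the tuple (ε(x)1) yields
operators x ▷ on A. They satisfy the relations of H, by induction along words in A, and so define
`actHom`.

The decisive property of this action is covariance, Δ(h ▷ a) = (id ⊗ ▷)(Ξ ⊗ id)(h ⊗ Δa)
(`comul_actHom`). Put ⟨h, a⟩ = ε(h ▷ a). Applying id ⊗ ε to covariance shows that the action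
recovered from the pairing is ▷ itself (`leftAct_pairing`), so the first numbered claim of the
theorem concerns an action already understood. The rule for ⟨h, ab⟩ is ε applied to the module
algebra property. The rule for ⟨hg, a⟩ = ⟨h, g ▷ a⟩ is the formula for g ▷ a. The antipode rule is
proved first for generators of H and then for products, using that S reverses the coproduct of A up
to the braiding (`SU.comul_antipode`). Uniqueness holds because the two product rules propagate the
values on generators to all of H ⊗ A.

The right action is treated directly through its contraction formula. It is an action by
coassociativity, and compatible with products because phases can be traded inside a nonvanishing
pairing (`ph_mul_pairing`). -/

noncomputable section

namespace BraidedSU2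

/-! ### Phase braidings on algebras spanned by homogeneous elements. -/

section GradedSpan

variable {X Y : Type} [Ring X] [Algebra ℂ X] [Ring Y] [Algebra ℂ Y]

/-- The homogeneous elements of the grading encoded by `c` span `X`. -/
def SpannedByHomogeneous (c : X →ₐ[ℂ] AddMonoidAlgebra X ℤ) : Prop :=
  ∀ x : X, x ∈ Submodule.span ℂ {y : X | ∃ n : ℤ, c y = AddMonoidAlgebra.single n y}

@[elab_as_elim]
theorem SpannedByHomogeneous.induction {c : X →ₐ[ℂ] AddMonoidAlgebra X ℤ}
    (hc : SpannedByHomogeneous c) {P : X → Prop} (zero : P 0)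
    (add : ∀ x y, P x → P y → P (x + y))
    (homog : ∀ (n : ℤ) (x : X), c x = AddMonoidAlgebra.single n x → P x) (x : X) : P x := by
  -- `P` is not assumed stable under scalars, but homogeneous elements are; proving all multiples at
  -- once supplies the missing closure.
  have key : ∀ r : ℂ, P (r • x) := by
    refine Submodule.span_induction (p := fun x _ => ∀ r : ℂ, P (r • x)) ?_ ?_ ?_ ?_ (hc x)
    · rintro y ⟨n, hy⟩ r
      exact homog n _ (by rw [map_smul, hy, AddMonoidAlgebra.smul_single])
    · intro r; rwa [smul_zero]
    · intro x y _ _ hx hy r; rw [smul_add]; exact add _ _ (hx r) (hy r)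
    · intro s x _ hx r; rw [smul_smul]; exact hx _
  simpa using key 1

@[elab_as_elim]
theorem SpannedByHomogeneous.induction_tmul {c : X →ₐ[ℂ] AddMonoidAlgebra X ℤ}
    {d : Y →ₐ[ℂ] AddMonoidAlgebra Y ℤ} (hc : SpannedByHomogeneous c)
    (hd : SpannedByHomogeneous d) {P : X ⊗[ℂ] Y → Prop} (zero : P 0)
    (add : ∀ s t, P s → P t → P (s + t))
    (homog : ∀ (m n : ℤ) (x : X) (y : Y), c x = AddMonoidAlgebra.single m x →
      d y = AddMonoidAlgebra.single n y → P (x ⊗ₜ y)) (t : X ⊗[ℂ] Y) : P t := by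
  induction t using TensorProduct.induction_on with
  | zero => exact zero
  | add s t hs ht => exact add s t hs ht
  | tmul x y =>
    refine hc.induction (P := fun x => P (x ⊗ₜ y)) (by simpa using zero)
      (fun x x' hx hx' => by rw [TensorProduct.add_tmul]; exact add _ _ hx hx')
      (fun m x hx => ?_) x
    exact hd.induction (P := fun y => P (x ⊗ₜ y)) (by simpa using zero)
      (fun y y' hy hy' => by rw [TensorProduct.tmul_add]; exact add _ _ hy hy')
      (fun n y hy => homog m n x y hx hy) y

variable (φ : ℝ) {cX : X →ₐ[ℂ] AddMonoidAlgebra X ℤ} {cY : Y →ₐ[ℂ] AddMonoidAlgebra Y ℤ}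

theorem ph_mul_ph_neg (n : ℤ) : ph φ n * ph φ (-n) = 1 := by
  rw [← ph_add, add_neg_cancel, ph_zero]

theorem ph_neg_phi (n : ℤ) : ph (-φ) n = ph φ (-n) := by
  simp [ph]

theorem phaseTwist_homogeneous (k n : ℤ) (x : X) (hx : cX x = AddMonoidAlgebra.single n x) :
    cX (phaseTwist φ cX k x) = AddMonoidAlgebra.single n (phaseTwist φ cX k x) := by
  rw [phaseTwist_of_single φ cX k n x hx, map_smul, hx, AddMonoidAlgebra.smul_single]

/-- The braiding with a homogeneous right factor. -/
theorem phaseBraiding_of_single_right (hX : SpannedByHomogeneous cX) (n : ℤ) (x : X) (y : Y)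
    (hy : cY y = AddMonoidAlgebra.single n y) :
    phaseBraiding φ cX cY (x ⊗ₜ y) = y ⊗ₜ phaseTwist φ cX n x := by
  refine hX.induction
    (by simp) (fun x x' hx hx' => by
      rw [TensorProduct.add_tmul, map_add, hx, hx', map_add, TensorProduct.tmul_add])
    (fun m x hx => ?_) x
  rw [phaseBraiding_homogeneous φ cX cY m n x y hx hy, phaseTwist_of_single φ cX n m x hx,
    TensorProduct.tmul_smul, mul_right_comm]

@[simp] theorem braidFst_tmul {Z : Type} [AddCommGroup Z] [Module ℂ Z]
    (Ξ : X ⊗[ℂ] Y →ₗ[ℂ] Y ⊗[ℂ] X) (x : X) (y : Y) (z : Z) :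
    braidFst Ξ (x ⊗ₜ (y ⊗ₜ z)) = TensorProduct.assoc ℂ Y X Z (Ξ (x ⊗ₜ y) ⊗ₜ z) := rfl

@[simp] theorem braidSnd_tmul {Z : Type} [AddCommGroup Z] [Module ℂ Z]
    (Ξ : X ⊗[ℂ] Y →ₗ[ℂ] Y ⊗[ℂ] X) (z : Z) (x : X) (y : Y) :
    braidSnd Ξ ((z ⊗ₜ x) ⊗ₜ y) = (TensorProduct.assoc ℂ Z Y X).symm (z ⊗ₜ Ξ (x ⊗ₜ y)) := rfl

@[simp] theorem braidMid_tmul {W Z : Type} [AddCommGroup W] [Module ℂ W] [AddCommGroup Z]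
    [Module ℂ Z] (Ξ : X ⊗[ℂ] Y →ₗ[ℂ] Y ⊗[ℂ] X) (w : W) (x : X) (y : Y) (z : Z) :
    braidMid Ξ ((w ⊗ₜ x) ⊗ₜ (y ⊗ₜ z)) = (TensorProduct.assoc ℂ W Y (X ⊗[ℂ] Z)).symm
      (w ⊗ₜ TensorProduct.assoc ℂ Y X Z (Ξ (x ⊗ₜ y) ⊗ₜ z)) := rfl

/-- Replacing φ by -φ inverts every phase, so the opposite braiding at -φ undoes the given one. -/
theorem phaseBraiding_inverse (hX : SpannedByHomogeneous cX) (hY : SpannedByHomogeneous cY)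
    (t : X ⊗[ℂ] Y) : phaseBraiding (-φ) cY cX (phaseBraiding φ cX cY t) = t := by
  refine hX.induction_tmul hY (by simp)
    (fun s t hs ht => by rw [map_add, map_add, hs, ht])
    (fun m n x y hx hy => ?_) t
  rw [phaseBraiding_homogeneous φ cX cY m n x y hx hy, map_smul,
    phaseBraiding_homogeneous _ cY cX n m y x hy hx, smul_smul, ph_neg_phi,
    mul_right_comm 2 n m, ph_mul_ph_neg, one_smul]

/-- Moving a homogeneous element of degree n past the other algebra is the twist T_n, which respects
units and products. Each product rule is proved by making the factor that is not multiplied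
homogeneous. -/
theorem isAlgebraBraiding_phaseBraiding (hX : SpannedByHomogeneous cX)
    (hY : SpannedByHomogeneous cY) : IsAlgebraBraiding (phaseBraiding φ cX cY) where
  bijective := by
    refine Function.bijective_iff_has_inverse.2 ⟨phaseBraiding (-φ) cY cX, fun t => ?_, fun t => ?_⟩
    · exact phaseBraiding_inverse φ hX hY t
    · simpa using phaseBraiding_inverse (-φ) hY hX t
  one_left y := by
    rw [phaseBraiding_of_single φ cX cY 0 1 y (by rw [map_one, AddMonoidAlgebra.one_def])]
    congr 1
    refine hY.induction (by simp)
      (fun x y hx hy => by rw [map_add, hx, hy]) (fun n y hy => ?_) y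
    rw [phaseTwist_of_single φ cY 0 n y hy]; simp [ph_zero]
  one_right x := by
    rw [phaseBraiding_of_single_right φ hX 0 x 1 (by rw [map_one, AddMonoidAlgebra.one_def])]
    congr 1
    refine hX.induction (by simp)
      (fun x y hx hy => by rw [map_add, hx, hy]) (fun n y hy => ?_) x
    rw [phaseTwist_of_single φ cX 0 n y hy]; simp [ph_zero]
  mul_left x x' y := by
    refine hY.induction (by simp)
      (fun y y' h h' => by simp only [TensorProduct.tmul_add, map_add, h, h'])
      (fun n y hy => ?_) y
    simp [phaseBraiding_of_single_right φ hX n _ y hy, phaseTwist_mul]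
  mul_right x y y' := by
    refine hX.induction (by simp)
      (fun x x' h h' => by simp only [TensorProduct.add_tmul, map_add, h, h'])
      (fun n x hx => ?_) x
    simp [phaseBraiding_of_single φ cX cY n x _ hx, phaseTwist_mul]

/-- For homogeneous y both ways of sliding y past Δ differ only by applying the twist before or
after Δ. Thus compatibility is exactly the two hypotheses that Δ and ε respect twists. -/
theorem braidsComulLeft_phaseBraiding (hX : SpannedByHomogeneous cX)
    (hY : SpannedByHomogeneous cY) (Δ : X →ₗ[ℂ] X ⊗[ℂ] X) (ε : X →ₗ[ℂ] ℂ)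
    (hΔ : ∀ k x, Δ (phaseTwist φ cX k x) =
      TensorProduct.map (phaseTwist φ cX k) (phaseTwist φ cX k) (Δ x))
    (hε : ∀ k x, ε (phaseTwist φ cX k x) = ε x) :
    BraidsComulLeft (phaseBraiding φ cX cY) Δ ε where
  comul x y := by
    refine hY.induction (by simp)
      (fun y y' h h' => by simp only [TensorProduct.tmul_add, map_add, h, h'])
      (fun n y hy => ?_) y
    rw [phaseBraiding_of_single_right φ hX n _ y hy, LinearMap.lTensor_tmul, hΔ]
    induction Δ x using TensorProduct.induction_on with
    | zero => simp
    | add s t hs ht => simp only [TensorProduct.add_tmul, TensorProduct.tmul_add, map_add, hs, ht]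
    | tmul a b => simp [phaseBraiding_of_single_right φ hX n _ y hy]
  counit x y := by
    refine hY.induction
      (by simp) (fun y y' h h' => by
        simp only [TensorProduct.tmul_add, TensorProduct.add_tmul, map_add, h, h'])
      (fun n y hy => ?_) y
    rw [phaseBraiding_of_single_right φ hX n _ y hy, LinearMap.lTensor_tmul, hε]

theorem braidsComulRight_phaseBraiding (hX : SpannedByHomogeneous cX) (Δ : Y →ₗ[ℂ] Y ⊗[ℂ] Y)
    (ε : Y →ₗ[ℂ] ℂ)
    (hΔ : ∀ k y, Δ (phaseTwist φ cY k y) =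
      TensorProduct.map (phaseTwist φ cY k) (phaseTwist φ cY k) (Δ y))
    (hε : ∀ k y, ε (phaseTwist φ cY k y) = ε y) :
    BraidsComulRight (phaseBraiding φ cX cY) Δ ε where
  comul x y := by
    refine hX.induction (by simp)
      (fun x x' h h' => by simp only [TensorProduct.add_tmul, map_add, h, h'])
      (fun n x hx => ?_) x
    rw [phaseBraiding_of_single φ cX cY n x _ hx, LinearMap.rTensor_tmul, hΔ]
    induction Δ y using TensorProduct.induction_on with
    | zero => simp
    | add s t hs ht => simp only [TensorProduct.add_tmul, TensorProduct.tmul_add, map_add, hs, ht]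
    | tmul a b => simp [phaseBraiding_of_single φ cX cY n x _ hx]
  counit x y := by
    refine hX.induction
      (by simp) (fun x x' h h' => by
        simp only [TensorProduct.tmul_add, TensorProduct.add_tmul, map_add, h, h'])
      (fun n x hx => ?_) x
    rw [phaseBraiding_of_single φ cX cY n x _ hx, LinearMap.rTensor_tmul, hε]

/-- With the last two factors homogeneous, both sides reverse the three factors with the same
scalar, and the first factor receives the same two twists in opposite orders. Twists commute. -/
theorem phaseBraiding_yang_baxter (hX : SpannedByHomogeneous cX) (t : X ⊗[ℂ] (X ⊗[ℂ] X)) :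
    braidFst (phaseBraiding φ cX cX) ((phaseBraiding φ cX cX).lTensor X
      (braidFst (phaseBraiding φ cX cX) t)) =
    (phaseBraiding φ cX cX).lTensor X (braidFst (phaseBraiding φ cX cX)
      ((phaseBraiding φ cX cX).lTensor X t)) := by
  induction t using TensorProduct.induction_on with
  | zero => simp
  | add s t hs ht => simp only [map_add, hs, ht]
  | tmul x t =>
    refine hX.induction_tmul hX (by simp)
      (fun s t hs ht => by simp only [TensorProduct.tmul_add, map_add, hs, ht])
      (fun m n y z hy hz => ?_) t
    have hT : phaseTwist φ cX n (phaseTwist φ cX m x) =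
        phaseTwist φ cX m (phaseTwist φ cX n x) :=
      hX.induction (by simp)
        (fun x y hx hy => by simp only [map_add, hx, hy]) (fun k x hx => by
          simp only [phaseTwist_of_single φ cX _ k x hx, map_smul, smul_smul, mul_comm]) x
    simp only [braidFst_tmul, LinearMap.lTensor_tmul, TensorProduct.assoc_tmul,
      phaseBraiding_of_single_right φ hX m _ y hy, phaseBraiding_of_single_right φ hX n _ z hz,
      phaseTwist_of_single φ cX n m y hy, TensorProduct.tmul_smul, ← TensorProduct.smul_tmul',
      map_smul, hT]

/-- Companion of `braidedMul_of_single`, with the phase charged to b instead of x; homogeneity of x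
suffices here. -/
theorem braidedMul_tmul (hX : SpannedByHomogeneous cX) (n : ℤ) (a b x y : X)
    (hx : cX x = AddMonoidAlgebra.single n x) :
    braidedMul (phaseBraiding φ cX cX) ((a ⊗ₜ b) ⊗ₜ (x ⊗ₜ y)) =
      (a * x) ⊗ₜ (phaseTwist φ cX n b * y) := by
  simp [braidedMul, phaseBraiding_of_single_right φ hX n b x hx]

/-- Both bracketings multiply leg by leg, and the phases agree because e^{2iφmn} is additive in each
degree. The last leg is never moved, so it need not be homogeneous. -/
theorem braidedMul_assoc (hX : SpannedByHomogeneous cX) (r s t : X ⊗[ℂ] X) :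
    braidedMul (phaseBraiding φ cX cX) (braidedMul (phaseBraiding φ cX cX) (r ⊗ₜ s) ⊗ₜ t) =
      braidedMul (phaseBraiding φ cX cX)
        (r ⊗ₜ braidedMul (phaseBraiding φ cX cX) (s ⊗ₜ t)) := by
  refine hX.induction_tmul hX (by simp)
    (fun r r' h h' => by simp only [TensorProduct.add_tmul, map_add, h, h'])
    (fun k l a b ha hb => ?_) r
  refine hX.induction_tmul hX (by simp)
    (fun r r' h h' => by simp only [TensorProduct.add_tmul, TensorProduct.tmul_add, map_add, h, h'])
    (fun m n x y hx hy => ?_) s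
  induction t using TensorProduct.induction_on with
  | zero => simp
  | add s t hs ht => simp only [TensorProduct.tmul_add, map_add, hs, ht]
  | tmul u v =>
    refine hX.induction (by simp)
      (fun r r' h h' => by
        simp only [TensorProduct.add_tmul, TensorProduct.tmul_add, map_add, h, h'])
      (fun p u hu => ?_) u
    have hxu : cX (x * u) = AddMonoidAlgebra.single (m + p) (x * u) := by
      rw [map_mul, hx, hu, AddMonoidAlgebra.single_mul_single]
    rw [braidedMul_tmul φ hX m _ _ _ _ hx, braidedMul_tmul φ hX p _ _ _ _ hu,
      braidedMul_tmul φ hX p _ _ _ _ hu, braidedMul_tmul φ hX _ _ _ _ _ hxu, phaseTwist_mul]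
    simp only [phaseTwist_of_single φ cX _ _ _ hb, map_smul, smul_mul_assoc, mul_assoc, smul_smul,
      ← ph_add]
    ring_nf

end GradedSpan

/-! ### Reduction of the braided Hopf axioms to homogeneous generators. -/

section Generators

variable {X : Type} [Ring X] [Algebra ℂ X]

theorem SpannedByHomogeneous.twist_twist {φ : ℝ} {c : X →ₐ[ℂ] AddMonoidAlgebra X ℤ}
    (hc : SpannedByHomogeneous c) (m n : ℤ) (x : X) :
    phaseTwist φ c m (phaseTwist φ c n x) = phaseTwist φ c (m + n) x := by
  refine hc.induction (by simp) (fun x y hx hy => by simp only [map_add, hx, hy])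
    (fun k x hx => ?_) x
  simp only [phaseTwist_of_single φ c _ k x hx, map_smul, smul_smul, ← ph_add]
  ring_nf

theorem SpannedByHomogeneous.twist_comm {φ : ℝ} {c : X →ₐ[ℂ] AddMonoidAlgebra X ℤ}
    (hc : SpannedByHomogeneous c) (m n : ℤ) (x : X) :
    phaseTwist φ c m (phaseTwist φ c n x) = phaseTwist φ c n (phaseTwist φ c m x) := by
  rw [hc.twist_twist, hc.twist_twist, add_comm]

/-- The data of a braided Hopf algebra, given and checked on homogeneous generators. -/
structure HopfGenerators {G : Type} (φ : ℝ) (c : X →ₐ[ℂ] AddMonoidAlgebra X ℤ) (gen : G → X)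
    (δ : G → ℤ) (Δ : X →ₗ[ℂ] X ⊗[ℂ] X) (ε : X →ₐ[ℂ] ℂ) (S : X →ₗ[ℂ] X) : Prop where
  grading_gen : ∀ x, c (gen x) = AddMonoidAlgebra.single (δ x) (gen x)
  induction : ∀ P : X → Prop, P 1 → (∀ x y, P x → P y → P (x + y)) →
    (∀ (r : ℂ) x, P x → P (r • x)) → (∀ x y, P y → P (gen x * y)) → ∀ y, P y
  comul_one : Δ 1 = 1 ⊗ₜ 1
  comul_gen_mul : ∀ x y, Δ (gen x * y) = braidedMul (phaseBraiding φ c c) (Δ (gen x) ⊗ₜ Δ y)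
  comul_twist_gen : ∀ k x, TensorProduct.map (phaseTwist φ c k) (phaseTwist φ c k) (Δ (gen x)) =
    ph φ (2 * k * δ x) • Δ (gen x)
  counit_gen : ∀ x, δ x ≠ 0 → ε (gen x) = 0
  antipode_one : S 1 = 1
  antipode_gen_mul : ∀ x y, S (gen x * y) = phaseTwist φ c (δ x) (S y) * S (gen x)
  antipode_twist_gen : ∀ k x, phaseTwist φ c k (S (gen x)) = ph φ (2 * k * δ x) • S (gen x)
  coassoc_gen : ∀ x, TensorProduct.assoc ℂ X X X (Δ.rTensor X (Δ (gen x))) =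
    Δ.lTensor X (Δ (gen x))
  counit_comul_gen : ∀ x, ε.toLinearMap.rTensor X (Δ (gen x)) = 1 ⊗ₜ gen x
  comul_counit_gen : ∀ x, ε.toLinearMap.lTensor X (Δ (gen x)) = gen x ⊗ₜ 1
  antipode_left_gen : ∀ x, LinearMap.mul' ℂ X (S.rTensor X (Δ (gen x))) =
    algebraMap ℂ X (ε (gen x))
  antipode_right_gen : ∀ x, LinearMap.mul' ℂ X (S.lTensor X (Δ (gen x))) =
    algebraMap ℂ X (ε (gen x))

/-- A twist is multiplicative and commutes with the twists hidden in the braiding, so its tensor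
square is an endomorphism of the braided tensor square. -/
theorem map_twist_braidedMul {φ : ℝ} {c : X →ₐ[ℂ] AddMonoidAlgebra X ℤ}
    (hc : SpannedByHomogeneous c) (k : ℤ) (s t : X ⊗[ℂ] X) :
    TensorProduct.map (phaseTwist φ c k) (phaseTwist φ c k)
      (braidedMul (phaseBraiding φ c c) (s ⊗ₜ t)) =
    braidedMul (phaseBraiding φ c c)
      (TensorProduct.map (phaseTwist φ c k) (phaseTwist φ c k) s ⊗ₜ
        TensorProduct.map (phaseTwist φ c k) (phaseTwist φ c k) t) := by
  induction s using TensorProduct.induction_on with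
  | zero => simp
  | add s s' h h' => simp only [TensorProduct.add_tmul, map_add, h, h']
  | tmul a b =>
    refine hc.induction_tmul hc (by simp)
      (fun s t hs ht => by simp only [TensorProduct.tmul_add, map_add, hs, ht])
      (fun m n x y hx hy => ?_) t
    rw [braidedMul_tmul φ hc m _ _ _ _ hx, TensorProduct.map_tmul, TensorProduct.map_tmul,
      TensorProduct.map_tmul,
      braidedMul_tmul φ hc m _ _ _ _ (phaseTwist_homogeneous φ k m x hx), phaseTwist_mul,
      phaseTwist_mul, hc.twist_comm]

/-- The braiding of `X ⊗ X` with `X`, composed of two braidings of `X`. -/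
def braidPair (Ψ : X ⊗[ℂ] X →ₗ[ℂ] X ⊗[ℂ] X) :
    (X ⊗[ℂ] X) ⊗[ℂ] X →ₗ[ℂ] X ⊗[ℂ] (X ⊗[ℂ] X) :=
  braidFst Ψ ∘ₗ Ψ.lTensor X ∘ₗ (TensorProduct.assoc ℂ X X X).toLinearMap

/-- The multiplication of the braided tensor cube of an algebra. -/
def braidedMulThree (Ψ : X ⊗[ℂ] X →ₗ[ℂ] X ⊗[ℂ] X) :
    (X ⊗[ℂ] (X ⊗[ℂ] X)) ⊗[ℂ] (X ⊗[ℂ] (X ⊗[ℂ] X)) →ₗ[ℂ] X ⊗[ℂ] (X ⊗[ℂ] X) :=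
  TensorProduct.map (LinearMap.mul' ℂ X) (braidedMul Ψ) ∘ₗ
    (TensorProduct.assoc ℂ X X ((X ⊗[ℂ] X) ⊗[ℂ] (X ⊗[ℂ] X))).symm.toLinearMap ∘ₗ
    ((TensorProduct.assoc ℂ X (X ⊗[ℂ] X) (X ⊗[ℂ] X)).toLinearMap ∘ₗ
      (braidPair Ψ).rTensor (X ⊗[ℂ] X) ∘ₗ
      (TensorProduct.assoc ℂ (X ⊗[ℂ] X) X (X ⊗[ℂ] X)).symm.toLinearMap).lTensor X ∘ₗ
    (TensorProduct.assoc ℂ X (X ⊗[ℂ] X) (X ⊗[ℂ] (X ⊗[ℂ] X))).toLinearMap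

/-- A homogeneous x of degree n passes s by T_n ⊗ T_n. The cube is thereby the braided product of X
with X ⊗ X, and computations in it reduce to `braidedMul`. -/
theorem braidedMulThree_tmul {φ : ℝ} {c : X →ₐ[ℂ] AddMonoidAlgebra X ℤ}
    (hc : SpannedByHomogeneous c) (n : ℤ) (a x : X) (s t : X ⊗[ℂ] X)
    (hx : c x = AddMonoidAlgebra.single n x) :
    braidedMulThree (phaseBraiding φ c c) ((a ⊗ₜ s) ⊗ₜ (x ⊗ₜ t)) =
      (a * x) ⊗ₜ braidedMul (phaseBraiding φ c c)
        (TensorProduct.map (phaseTwist φ c n) (phaseTwist φ c n) s ⊗ₜ t) := by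
  induction s using TensorProduct.induction_on with
  | zero => simp
  | add s s' h h' =>
    simp only [TensorProduct.add_tmul, TensorProduct.tmul_add, map_add, h, h']
  | tmul u v =>
    simp [braidedMulThree, braidPair, phaseBraiding_of_single_right φ hc n _ x hx]

namespace HopfGenerators

variable {G : Type} {φ : ℝ} {c : X →ₐ[ℂ] AddMonoidAlgebra X ℤ} {gen : G → X} {δ : G → ℤ}
  {Δ : X →ₗ[ℂ] X ⊗[ℂ] X} {ε : X →ₐ[ℂ] ℂ} {S : X →ₗ[ℂ] X}

/-- The unit has degree zero, and left multiplication by a generator shifts degree by a constant. -/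
theorem spannedByHomogeneous (h : HopfGenerators φ c gen δ Δ ε S) : SpannedByHomogeneous c := by
  refine h.induction _ ?_ (fun x y hx hy => Submodule.add_mem _ hx hy)
    (fun r x hx => Submodule.smul_mem _ r hx) (fun x y hy => ?_)
  · exact Submodule.subset_span ⟨0, by rw [map_one, AddMonoidAlgebra.one_def]⟩
  · refine Submodule.span_induction (p := fun y _ => gen x * y ∈ Submodule.span ℂ
      {y : X | ∃ n : ℤ, c y = AddMonoidAlgebra.single n y}) ?_ ?_ ?_ ?_ hy
    · rintro y ⟨n, hy⟩
      exact Submodule.subset_span ⟨δ x + n, by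
        rw [map_mul, hy, h.grading_gen, AddMonoidAlgebra.single_mul_single]⟩
    · simp
    · intro y z _ _ hy hz; rw [mul_add]; exact Submodule.add_mem _ hy hz
    · intro r y _ hy; rw [mul_smul_comm]; exact Submodule.smul_mem _ r hy

theorem twist_gen (h : HopfGenerators φ c gen δ Δ ε S) (k : ℤ) (x : G) :
    phaseTwist φ c k (gen x) = ph φ (2 * k * δ x) • gen x :=
  phaseTwist_of_single φ c k _ _ (h.grading_gen x)

theorem comul_twist (h : HopfGenerators φ c gen δ Δ ε S) (k : ℤ) (y : X) :
    Δ (phaseTwist φ c k y) = TensorProduct.map (phaseTwist φ c k) (phaseTwist φ c k) (Δ y) := by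
  refine h.induction (fun y => Δ (phaseTwist φ c k y) =
    TensorProduct.map (phaseTwist φ c k) (phaseTwist φ c k) (Δ y)) ?_
    (fun x y hx hy => by simp only [map_add, hx, hy])
    (fun r x hx => by simp only [map_smul, hx]) (fun x y hy => ?_) y
  · simp [phaseTwist_one, h.comul_one]
  · rw [phaseTwist_mul, h.twist_gen, smul_mul_assoc, map_smul, h.comul_gen_mul, hy,
      h.comul_gen_mul, map_twist_braidedMul h.spannedByHomogeneous, h.comul_twist_gen,
      ← TensorProduct.smul_tmul', map_smul]

/-- A generator of degree zero is fixed by twists and one of nonzero degree is killed by ε, so ε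
never sees a phase. -/
theorem counit_twist (h : HopfGenerators φ c gen δ Δ ε S) (k : ℤ) (y : X) :
    ε (phaseTwist φ c k y) = ε y := by
  refine h.induction (fun y => ε (phaseTwist φ c k y) = ε y) (by simp [phaseTwist_one])
    (fun x y hx hy => by simp only [map_add, hx, hy])
    (fun r x hx => by simp only [map_smul, hx]) (fun x y hy => ?_) y
  rw [phaseTwist_mul, h.twist_gen, map_mul, map_mul, hy, map_smul]
  by_cases hx : δ x = 0
  · simp [hx, ph_zero]
  · simp [h.counit_gen x hx]

theorem antipode_twist (h : HopfGenerators φ c gen δ Δ ε S) (k : ℤ) (y : X) :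
    S (phaseTwist φ c k y) = phaseTwist φ c k (S y) := by
  refine h.induction (fun y => S (phaseTwist φ c k y) = phaseTwist φ c k (S y))
    (by simp [phaseTwist_one, h.antipode_one])
    (fun x y hx hy => by simp only [map_add, hx, hy])
    (fun r x hx => by simp only [map_smul, hx]) (fun x y hy => ?_) y
  rw [phaseTwist_mul, h.twist_gen, smul_mul_assoc, map_smul, h.antipode_gen_mul, hy,
    h.antipode_gen_mul, phaseTwist_mul, h.antipode_twist_gen, mul_smul_comm,
    h.spannedByHomogeneous.twist_comm]

/-- The rule is given only for a generator on the left. Associativity of the braided square extends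
it along words; the base case is that 1 ⊗ 1 is a left unit. -/
theorem comul_mul (h : HopfGenerators φ c gen δ Δ ε S) (x y : X) :
    Δ (x * y) = braidedMul (phaseBraiding φ c c) (Δ x ⊗ₜ Δ y) := by
  have hc := h.spannedByHomogeneous
  refine h.induction (fun x => Δ (x * y) = braidedMul (phaseBraiding φ c c) (Δ x ⊗ₜ Δ y)) ?_
    (fun x x' hx hx' => by simp only [add_mul, TensorProduct.add_tmul, map_add, hx, hx'])
    (fun r x hx => by
      simp only [smul_mul_assoc, ← TensorProduct.smul_tmul', map_smul, hx])
    (fun g x hx => ?_) x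
  · rw [one_mul, h.comul_one]
    refine hc.induction_tmul hc (by simp)
      (fun s t hs ht => by rw [TensorProduct.tmul_add, map_add, ← hs, ← ht])
      (fun m n a b ha hb => ?_) (Δ y)
    rw [braidedMul_tmul φ hc m _ _ _ _ ha, phaseTwist_one, one_mul, one_mul]
  · rw [mul_assoc, h.comul_gen_mul, hx, h.comul_gen_mul, braidedMul_assoc φ hc]

/-- Δ ⊗ id is multiplicative from the braided square to the braided cube. On homogeneous legs this
is a count of phases, with the degree-preserving property of Δ used where the middle leg crosses. -/
theorem rTensor_comul_braidedMul (h : HopfGenerators φ c gen δ Δ ε S) (s t : X ⊗[ℂ] X) :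
    TensorProduct.assoc ℂ X X X (Δ.rTensor X (braidedMul (phaseBraiding φ c c) (s ⊗ₜ t))) =
      braidedMulThree (phaseBraiding φ c c)
        (TensorProduct.assoc ℂ X X X (Δ.rTensor X s) ⊗ₜ
          TensorProduct.assoc ℂ X X X (Δ.rTensor X t)) := by
  have hc := h.spannedByHomogeneous
  refine hc.induction_tmul hc (by simp)
    (fun s s' h h' => by simp only [TensorProduct.add_tmul, map_add, h, h'])
    (fun l m a b ha hb => ?_) s
  induction t using TensorProduct.induction_on with
  | zero => simp
  | add t t' h h' => simp only [TensorProduct.tmul_add, map_add, h, h']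
  | tmul u v =>
    rw [braidedMul_of_single φ c m _ _ _ _ hb, LinearMap.rTensor_tmul, LinearMap.rTensor_tmul,
      LinearMap.rTensor_tmul, h.comul_mul, h.comul_twist]
    refine hc.induction_tmul hc
      (by simp) (fun s s' h h' => by simp only [TensorProduct.add_tmul, map_add, h, h'])
      (fun k l a₁ a₂ ha₁ ha₂ => ?_) (Δ a)
    refine hc.induction_tmul hc
      (by simp) (fun s s' h h' => by
        simp only [TensorProduct.add_tmul, TensorProduct.tmul_add, map_add, h, h'])
      (fun p r u₁ u₂ hu₁ hu₂ => ?_) (Δ u)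
    simp only [TensorProduct.assoc_tmul, TensorProduct.map_tmul,
      braidedMulThree_tmul hc p _ _ _ _ hu₁, braidedMul_tmul φ hc r _ _ _ _ hu₂,
      phaseTwist_of_single φ c _ _ _ hu₁, phaseTwist_of_single φ c _ _ _ hu₂,
      phaseTwist_of_single φ c _ _ _ ha₂, phaseTwist_of_single φ c _ _ _ hb, map_smul,
      TensorProduct.tmul_smul, ← TensorProduct.smul_tmul', smul_mul_assoc, mul_smul_comm,
      braidedMul_tmul φ hc p _ _ _ _ hu₁, smul_smul, ← ph_add]
    ring_nf

theorem lTensor_comul_braidedMul (h : HopfGenerators φ c gen δ Δ ε S) (s t : X ⊗[ℂ] X) :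
    Δ.lTensor X (braidedMul (phaseBraiding φ c c) (s ⊗ₜ t)) =
      braidedMulThree (phaseBraiding φ c c) (Δ.lTensor X s ⊗ₜ Δ.lTensor X t) := by
  have hc := h.spannedByHomogeneous
  induction s using TensorProduct.induction_on with
  | zero => simp
  | add s s' h h' => simp only [TensorProduct.add_tmul, map_add, h, h']
  | tmul a b =>
    refine hc.induction_tmul hc (by simp)
      (fun s t hs ht => by simp only [TensorProduct.tmul_add, map_add, hs, ht])
      (fun m n x y hx hy => ?_) t
    rw [braidedMul_tmul φ hc m _ _ _ _ hx, LinearMap.lTensor_tmul, LinearMap.lTensor_tmul,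
      LinearMap.lTensor_tmul, braidedMulThree_tmul hc m _ _ _ _ hx, h.comul_mul, h.comul_twist]

/-- Both iterated coproducts are multiplicative into the braided cube, so agreement on generators
propagates to products. -/
theorem coassoc (h : HopfGenerators φ c gen δ Δ ε S) (y : X) :
    TensorProduct.assoc ℂ X X X (Δ.rTensor X (Δ y)) = Δ.lTensor X (Δ y) := by
  refine h.induction (fun y => TensorProduct.assoc ℂ X X X (Δ.rTensor X (Δ y)) =
    Δ.lTensor X (Δ y)) (by simp [h.comul_one])
    (fun x y hx hy => by simp only [map_add, hx, hy])
    (fun r x hx => by simp only [map_smul, hx]) (fun x y hy => ?_) y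
  rw [h.comul_gen_mul, h.rTensor_comul_braidedMul, h.lTensor_comul_braidedMul, hy, h.coassoc_gen]

/-- Because ε ignores twists, ε ⊗ id becomes a homomorphism from the braided square to X; it then
suffices to know its effect on Δ of generators. -/
theorem counit_comul (h : HopfGenerators φ c gen δ Δ ε S) (y : X) :
    ε.toLinearMap.rTensor X (Δ y) = 1 ⊗ₜ y := by
  have hc := h.spannedByHomogeneous
  have key : ∀ s t : X ⊗[ℂ] X, TensorProduct.lid ℂ X (ε.toLinearMap.rTensor X
      (braidedMul (phaseBraiding φ c c) (s ⊗ₜ t))) = TensorProduct.lid ℂ X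
      (ε.toLinearMap.rTensor X s) * TensorProduct.lid ℂ X (ε.toLinearMap.rTensor X t) := by
    intro s t
    refine hc.induction_tmul hc (by simp)
      (fun s s' h h' => by simp only [TensorProduct.add_tmul, map_add, h, h', add_mul])
      (fun l m a b ha hb => ?_) s
    induction t using TensorProduct.induction_on with
    | zero => simp
    | add t t' h h' => simp only [TensorProduct.tmul_add, map_add, h, h', mul_add]
    | tmul u v =>
      simp [braidedMul_of_single φ c m _ _ _ _ hb, h.counit_twist, smul_smul, mul_comm]
  apply (TensorProduct.lid ℂ X).injective
  refine h.induction (fun y => TensorProduct.lid ℂ X (ε.toLinearMap.rTensor X (Δ y)) =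
    TensorProduct.lid ℂ X (1 ⊗ₜ y)) (by simp [h.comul_one])
    (fun x y hx hy => by simp only [TensorProduct.tmul_add, map_add, hx, hy])
    (fun r x hx => by simp only [TensorProduct.tmul_smul, map_smul, hx]) (fun x y hy => ?_) y
  rw [h.comul_gen_mul, key, hy, h.counit_comul_gen]
  simp

theorem comul_counit (h : HopfGenerators φ c gen δ Δ ε S) (y : X) :
    ε.toLinearMap.lTensor X (Δ y) = y ⊗ₜ 1 := by
  have hc := h.spannedByHomogeneous
  have key : ∀ s t : X ⊗[ℂ] X, TensorProduct.rid ℂ X (ε.toLinearMap.lTensor X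
      (braidedMul (phaseBraiding φ c c) (s ⊗ₜ t))) = TensorProduct.rid ℂ X
      (ε.toLinearMap.lTensor X s) * TensorProduct.rid ℂ X (ε.toLinearMap.lTensor X t) := by
    intro s t
    induction s using TensorProduct.induction_on with
    | zero => simp
    | add s s' h h' => simp only [TensorProduct.add_tmul, map_add, h, h', add_mul]
    | tmul a b =>
      refine hc.induction_tmul hc
        (by simp) (fun s s' h h' => by simp only [TensorProduct.tmul_add, map_add, h, h', mul_add])
        (fun l m x y hx hy => ?_) t
      simp [braidedMul_tmul φ hc l _ _ _ _ hx, h.counit_twist, smul_smul, mul_comm]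
  apply (TensorProduct.rid ℂ X).injective
  refine h.induction (fun y => TensorProduct.rid ℂ X (ε.toLinearMap.lTensor X (Δ y)) =
    TensorProduct.rid ℂ X (y ⊗ₜ 1)) (by simp [h.comul_one])
    (fun x y hx hy => by simp only [TensorProduct.add_tmul, map_add, hx, hy])
    (fun r x hx => by simp only [← TensorProduct.smul_tmul', map_smul, hx]) (fun x y hy => ?_) y
  rw [h.comul_gen_mul, key, hy, h.comul_counit_gen]
  simp

/-- `S(x y) = m Ψ(S(x) ⊗ S(y))` for homogeneous `y`. -/
theorem antipode_mul_of_single_right (h : HopfGenerators φ c gen δ Δ ε S) (n : ℤ) (x y : X)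
    (hy : c y = AddMonoidAlgebra.single n y) :
    S (x * y) = S y * phaseTwist φ c n (S x) := by
  have hc := h.spannedByHomogeneous
  refine h.induction (fun x => S (x * y) = S y * phaseTwist φ c n (S x))
    (by simp [h.antipode_one, phaseTwist_one])
    (fun x x' hx hx' => by simp only [add_mul, mul_add, map_add, hx, hx'])
    (fun r x hx => by simp only [smul_mul_assoc, mul_smul_comm, map_smul, hx])
    (fun g x hx => ?_) x
  rw [mul_assoc, h.antipode_gen_mul, hx, h.antipode_gen_mul, phaseTwist_mul, phaseTwist_mul,
    ← h.antipode_twist _ y, phaseTwist_of_single φ c _ _ _ hy, h.antipode_twist_gen, map_smul,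
    smul_mul_assoc, smul_mul_assoc, mul_smul_comm, mul_smul_comm, hc.twist_comm, mul_assoc (S y),
    mul_right_comm 2 n]

/-- For bihomogeneous x and y the phase may be charged to either factor, since S preserves degree.
-/
theorem antipode_mul_of_single (h : HopfGenerators φ c gen δ Δ ε S) (m : ℤ) (x y : X)
    (hx : c x = AddMonoidAlgebra.single m x) :
    S (x * y) = phaseTwist φ c m (S y) * S x := by
  refine h.spannedByHomogeneous.induction
    (by simp) (fun y y' hy hy' => by simp only [add_mul, mul_add, map_add, hy, hy'])
    (fun n y hy => ?_) y
  rw [h.antipode_mul_of_single_right n x y hy, ← h.antipode_twist, ← h.antipode_twist,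
    phaseTwist_of_single φ c _ _ _ hx, phaseTwist_of_single φ c _ _ _ hy, map_smul, map_smul,
    smul_mul_assoc, mul_smul_comm, mul_right_comm]

/-- In m(S ⊗ id)(Δ(x)Δ(y)) the factor coming from the generator x ends up innermost, where it
collapses to ε(x); what remains is m(S ⊗ id)Δ(y). -/
theorem antipode_left (h : HopfGenerators φ c gen δ Δ ε S) (y : X) :
    LinearMap.mul' ℂ X (S.rTensor X (Δ y)) = algebraMap ℂ X (ε y) := by
  have hc := h.spannedByHomogeneous
  have key : ∀ (x : G) (t : X ⊗[ℂ] X), LinearMap.mul' ℂ X (S.rTensor X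
      (braidedMul (phaseBraiding φ c c) (Δ (gen x) ⊗ₜ t))) =
        ε (gen x) • LinearMap.mul' ℂ X (S.rTensor X t) := by
    intro x t
    refine hc.induction_tmul hc (by simp)
      (fun s s' h h' => by simp only [TensorProduct.tmul_add, map_add, h, h', smul_add])
      (fun n m u v hu hv => ?_) t
    -- Braided antimultiplicativity brings S(u) to the far left, so the contribution of z is
    -- enclosed between S(u) and v, twisted by the degree of u.
    have key' : ∀ z : X ⊗[ℂ] X, LinearMap.mul' ℂ X (S.rTensor X
        (braidedMul (phaseBraiding φ c c) (z ⊗ₜ (u ⊗ₜ v)))) =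
        S u * LinearMap.mul' ℂ X (S.rTensor X
          (TensorProduct.map (phaseTwist φ c n) (phaseTwist φ c n) z)) * v := by
      intro z
      induction z using TensorProduct.induction_on with
      | zero => simp
      | add s s' h h' => simp only [TensorProduct.add_tmul, map_add, h, h', add_mul, mul_add]
      | tmul a b =>
        simp [braidedMul_tmul φ hc n _ _ _ _ hu, h.antipode_mul_of_single_right n _ _ hu,
          h.antipode_twist, mul_assoc]
    rw [key', ← h.comul_twist, h.twist_gen, map_smul, map_smul, map_smul, h.antipode_left_gen]
    -- The leftover phase from twisting x is 1 in degree zero, and is multiplied by ε(x) = 0 in any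
    -- other degree.
    by_cases hx : δ x = 0
    · simp [hx, ph_zero, ← Algebra.commutes, ← Algebra.smul_def]
    · simp [h.counit_gen x hx]
  refine h.induction (fun y => LinearMap.mul' ℂ X (S.rTensor X (Δ y)) = algebraMap ℂ X (ε y))
    (by simp [h.comul_one, h.antipode_one])
    (fun x y hx hy => by simp only [map_add, hx, hy])
    (fun r x hx => by simp only [map_smul, hx, Algebra.algebraMap_eq_smul_one, smul_smul,
      smul_eq_mul]) (fun x y hy => ?_) y
  rw [h.comul_gen_mul, key, hy, map_mul, map_mul, Algebra.smul_def]

theorem antipode_right (h : HopfGenerators φ c gen δ Δ ε S) (y : X) :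
    LinearMap.mul' ℂ X (S.lTensor X (Δ y)) = algebraMap ℂ X (ε y) := by
  have hc := h.spannedByHomogeneous
  refine h.induction (fun y => LinearMap.mul' ℂ X (S.lTensor X (Δ y)) = algebraMap ℂ X (ε y))
    (by simp [h.comul_one, h.antipode_one])
    (fun x y hx hy => by simp only [map_add, hx, hy])
    (fun r x hx => by simp only [map_smul, hx, Algebra.algebraMap_eq_smul_one, smul_smul,
      smul_eq_mul]) (fun x y hy => ?_) y
  -- Here Δ(y) is the innermost factor, so the induction hypothesis for y collapses first and the
  -- generator is left for the end.
  have key : ∀ z : X ⊗[ℂ] X, LinearMap.mul' ℂ X (S.lTensor X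
      (braidedMul (phaseBraiding φ c c) (z ⊗ₜ Δ y))) =
      ε y • LinearMap.mul' ℂ X (S.lTensor X z) := by
    intro z
    refine hc.induction_tmul hc (by simp)
      (fun s s' h h' => by simp only [TensorProduct.add_tmul, map_add, h, h', smul_add])
      (fun l m a b ha hb => ?_) z
    have key' : ∀ t : X ⊗[ℂ] X, LinearMap.mul' ℂ X (S.lTensor X
        (braidedMul (phaseBraiding φ c c) ((a ⊗ₜ b) ⊗ₜ t))) =
        a * phaseTwist φ c m (LinearMap.mul' ℂ X (S.lTensor X t)) * S b := by
      intro t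
      induction t using TensorProduct.induction_on with
      | zero => simp
      | add s s' h h' => simp only [TensorProduct.tmul_add, map_add, h, h', add_mul, mul_add]
      | tmul u v =>
        simp [braidedMul_of_single φ c m _ _ _ _ hb, h.antipode_mul_of_single m _ _ hb,
          phaseTwist_mul, mul_assoc]
    rw [key', hy, Algebra.algebraMap_eq_smul_one, map_smul, phaseTwist_one]
    simp
  rw [h.comul_gen_mul, key, h.antipode_right_gen, map_mul, map_mul, Algebra.smul_def,
    Algebra.commutes]

theorem isBraidedHopfAlgebra (h : HopfGenerators φ c gen δ Δ ε S) :
    IsBraidedHopfAlgebra Δ ε.toLinearMap S (phaseBraiding φ c c) where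
  braiding := isAlgebraBraiding_phaseBraiding φ h.spannedByHomogeneous h.spannedByHomogeneous
  braid_comul_left := braidsComulLeft_phaseBraiding φ h.spannedByHomogeneous
    h.spannedByHomogeneous Δ _ h.comul_twist h.counit_twist
  braid_comul_right := braidsComulRight_phaseBraiding φ h.spannedByHomogeneous Δ _
    h.comul_twist h.counit_twist
  yang_baxter := phaseBraiding_yang_baxter φ h.spannedByHomogeneous
  coassoc := h.coassoc
  counit_comul := h.counit_comul
  comul_counit := h.comul_counit
  comul_one := h.comul_one
  comul_mul := h.comul_mul
  counit_one := map_one ε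
  counit_mul := map_mul ε
  antipode_left := h.antipode_left
  antipode_right := h.antipode_right

end HopfGenerators

end Generators

/-! ### Verification on the generators of the two algebras. -/

section Instances

theorem SU.induction (q φ : ℝ) (P : SU q φ → Prop) (one : P 1)
    (add : ∀ x y, P x → P y → P (x + y)) (smul : ∀ (r : ℂ) x, P x → P (r • x))
    (gen_mul : ∀ x y, P y → P (SU.gen q φ x * y)) (y : SU q φ) : P y := by
  obtain ⟨z, rfl⟩ := RingQuot.mkAlgHom_surjective ℂ (SURel q φ) y
  -- Closure under left multiplication by an arbitrary word is stable under products of words,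
  -- whereas `P` itself is not.
  have key : ∀ y, P y → P (SU.mk q φ z * y) := by
    induction z using FreeAlgebra.induction with
    | grade0 r => intro y hy; rw [AlgHom.commutes, ← Algebra.smul_def]; exact smul r y hy
    | grade1 x => exact gen_mul x
    | mul a b ha hb => intro y hy; rw [map_mul, mul_assoc]; exact ha _ (hb y hy)
    | add a b ha hb => intro y hy; rw [map_add, add_mul]; exact add _ _ (ha y hy) (hb y hy)
  have h := key 1 one
  rwa [mul_one] at h

theorem U.induction (q φ : ℝ) (P : U q φ → Prop) (one : P 1)
    (add : ∀ x y, P x → P y → P (x + y)) (smul : ∀ (r : ℂ) x, P x → P (r • x))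
    (gen_mul : ∀ x y, P y → P (U.gen q φ x * y)) (y : U q φ) : P y := by
  obtain ⟨z, rfl⟩ := RingQuot.mkAlgHom_surjective ℂ (URel q φ) y
  have key : ∀ y, P y → P (U.mk q φ z * y) := by
    induction z using FreeAlgebra.induction with
    | grade0 r => intro y hy; rw [AlgHom.commutes, ← Algebra.smul_def]; exact smul r y hy
    | grade1 x => exact gen_mul x
    | mul a b ha hb => intro y hy; rw [map_mul, mul_assoc]; exact ha _ (hb y hy)
    | add a b ha hb => intro y hy; rw [map_add, add_mul]; exact add _ _ (ha y hy) (hb y hy)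
  have h := key 1 one
  rwa [mul_one] at h

theorem SU.counit_gen (q φ : ℝ) (x : SUGen) : SU.counit q φ (SU.gen q φ x) =
    match x with | .α => 1 | .αs => 1 | .γ => 0 | .γs => 0 := by
  cases x <;> exact SU.lift_gen q φ _ _ _

theorem U.counit_gen (q φ : ℝ) (x : UGen) : U.counit q φ (U.gen q φ x) =
    match x with | .e => 0 | .f => 0 | .k => 1 | .ks => 1 | .ki => 1 | .ksi => 1 := by
  cases x <;> exact U.lift_gen q φ _ _ _

theorem SU.antipode_gen_mul (q φ : ℝ) (hq : q ≠ 0) (x : SUGen) (y : SU q φ) :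
    SU.antipode q φ hq (SU.gen q φ x * y) =
      phaseTwist φ (SU.grading q φ) (SU.δ x) (SU.antipode q φ hq y) *
        SU.antipode q φ hq (SU.gen q φ x) := by
  have h : SU.antipode q φ hq (SU.gen q φ x * y) =
      SU.antipodeOp q φ x (SU.antipode q φ hq y) := by
    simp [SU.antipode, SU.antipodeHom, SU.lift_gen]
  rw [h, SU.antipode_gen]
  cases x <;> simp [SU.antipodeOp_α, SU.antipodeOp_αs, SU.antipodeOp_γ, SU.antipodeOp_γs,
    SU.antipodeGen, SU.δ, SU.μ, SU.ν, SU.twist_zero]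

theorem U.antipode_gen_mul (q φ : ℝ) (hq : q ≠ 0) (x : UGen) (y : U q φ) :
    U.antipode q φ hq (U.gen q φ x * y) =
      phaseTwist φ (U.grading q φ) (U.δ x) (U.antipode q φ hq y) *
        U.antipode q φ hq (U.gen q φ x) := by
  have h : U.antipode q φ hq (U.gen q φ x * y) = U.antipodeOp q φ x (U.antipode q φ hq y) := by
    simp [U.antipode, U.antipodeHom, U.lift_gen]
  rw [h, U.antipode_gen]
  cases x <;> simp [U.antipodeOp_e, U.antipodeOp_f, U.antipodeOp_k, U.antipodeOp_ks,
    U.antipodeOp_ki, U.antipodeOp_ksi, U.antipodeGen, U.δ, U.μ, U.ν, U.twist_zero]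

/-- The antipode laws on α and α* are the two relations with right-hand side 1, and on γ and γ* they
are the commutation rules between the α and γ generators. -/
theorem SU.hopfGenerators (q φ : ℝ) (hq : q ≠ 0) :
    HopfGenerators φ (SU.grading q φ) (SU.gen q φ) SU.δ (SU.comul q φ hq) (SU.counit q φ)
      (SU.antipode q φ hq) where
  grading_gen := SU.grading_gen q φ
  induction := SU.induction q φ
  comul_one := SU.comul_one q φ hq
  comul_gen_mul x y := by rw [SU.comul_gen]; exact SU.comul_gen_mul q φ hq x y
  comul_twist_gen k x := by
    rw [SU.comul_gen]
    cases x <;> simp [SU.comulGen, SU.α, SU.αs, SU.γ, SU.γs, SU.twist_gen, SU.δ, SU.μ, SU.ν,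
      TensorProduct.tmul_smul, ← TensorProduct.smul_tmul', smul_smul, ph_zero, ← ph_add,
      ph_mul_ph_neg]
  counit_gen x hx := by
    rw [SU.counit_gen]
    cases x <;> simp_all [SU.δ, SU.μ, SU.ν]
  antipode_one := by simp [SU.antipode]
  antipode_gen_mul := SU.antipode_gen_mul q φ hq
  antipode_twist_gen k x := by
    rw [SU.antipode_gen]
    cases x <;> simp [SU.antipodeGen, SU.α, SU.αs, SU.γ, SU.γs, SU.twist_gen, SU.δ, SU.μ, SU.ν,
      ph_zero, smul_smul, mul_comm]
  coassoc_gen x := by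
    have h1 := SU.comul_gen q φ hq .α
    have h2 := SU.comul_gen q φ hq .αs
    have h3 := SU.comul_gen q φ hq .γ
    have h4 := SU.comul_gen q φ hq .γs
    rw [SU.comul_gen]
    simp only [SU.comulGen, SU.α, SU.αs, SU.γ, SU.γs] at h1 h2 h3 h4
    cases x <;> simp only [SU.comulGen, SU.α, SU.αs, SU.γ, SU.γs, h1, h2, h3, h4, map_add,
      map_sub, map_smul, LinearMap.rTensor_tmul, LinearMap.lTensor_tmul, TensorProduct.assoc_tmul,
      TensorProduct.add_tmul, TensorProduct.sub_tmul, TensorProduct.tmul_add,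
      TensorProduct.tmul_sub, TensorProduct.tmul_smul, ← TensorProduct.smul_tmul'] <;> module
  counit_comul_gen x := by
    rw [SU.comul_gen]
    cases x <;> simp [SU.comulGen, SU.α, SU.αs, SU.γ, SU.γs, SU.counit_gen]
  comul_counit_gen x := by
    rw [SU.comul_gen]
    cases x <;> simp [SU.comulGen, SU.α, SU.αs, SU.γ, SU.γs, SU.counit_gen]
  antipode_left_gen x := by
    have hq' : (q : ℂ) ≠ 0 := by exact_mod_cast hq
    have hw := ph_ne_zero φ 4
    have h1 := SU.antipode_gen q φ hq .α
    have h2 := SU.antipode_gen q φ hq .αs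
    have h3 := SU.antipode_gen q φ hq .γ
    have h4 := SU.antipode_gen q φ hq .γs
    change SU.antipode q φ hq (SU.α q φ) = _ at h1
    change SU.antipode q φ hq (SU.αs q φ) = _ at h2
    change SU.antipode q φ hq (SU.γ q φ) = _ at h3
    change SU.antipode q φ hq (SU.γs q φ) = _ at h4
    rw [SU.comul_gen, SU.counit_gen]
    cases x <;>
    · simp only [SU.comulGen, map_add, map_sub, map_smul, LinearMap.rTensor_tmul, h1, h2, h3, h4,
        SU.antipodeGen, LinearMap.mul'_apply, smul_mul_assoc, SU.α_γ, SU.α_γs,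
        SU.αs_γ q φ hq, SU.αs_γs q φ hq, ← SU.γ_γs, eq_sub_of_add_eq (SU.α_αs q φ),
        eq_sub_of_add_eq (SU.αs_α q φ), ph_neg, map_one, map_zero]
      match_scalars <;> field_simp <;> ring
  antipode_right_gen x := by
    have hq' : (q : ℂ) ≠ 0 := by exact_mod_cast hq
    have hw := ph_ne_zero φ 4
    have h1 := SU.antipode_gen q φ hq .α
    have h2 := SU.antipode_gen q φ hq .αs
    have h3 := SU.antipode_gen q φ hq .γ
    have h4 := SU.antipode_gen q φ hq .γs
    change SU.antipode q φ hq (SU.α q φ) = _ at h1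
    change SU.antipode q φ hq (SU.αs q φ) = _ at h2
    change SU.antipode q φ hq (SU.γ q φ) = _ at h3
    change SU.antipode q φ hq (SU.γs q φ) = _ at h4
    rw [SU.comul_gen, SU.counit_gen]
    cases x <;>
    · simp only [SU.comulGen, map_add, map_sub, map_smul, LinearMap.lTensor_tmul, h1, h2, h3, h4,
        SU.antipodeGen, LinearMap.mul'_apply, mul_smul_comm, SU.α_γ, SU.α_γs,
        SU.αs_γ q φ hq, SU.αs_γs q φ hq, ← SU.γ_γs, eq_sub_of_add_eq (SU.α_αs q φ),
        eq_sub_of_add_eq (SU.αs_α q φ), ph_neg, map_one, map_zero]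
      match_scalars <;> field_simp <;> ring

/-- The antipode laws on e and f use only how these commute with the group-like generators; the
relation for ef - fe plays no role here beyond the well-definedness of Δ and S. -/
theorem U.hopfGenerators (q φ : ℝ) (hq : q ≠ 0) :
    HopfGenerators φ (U.grading q φ) (U.gen q φ) U.δ (U.comul q φ hq) (U.counit q φ)
      (U.antipode q φ hq) where
  grading_gen := U.grading_gen q φ
  induction := U.induction q φ
  comul_one := U.comul_one q φ hq
  comul_gen_mul x y := by rw [U.comul_gen]; exact U.comul_gen_mul q φ hq x y
  comul_twist_gen k x := by
    rw [U.comul_gen]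
    cases x <;> simp [U.comulGen, U.e, U.f, U.k, U.ks, U.ki, U.ksi, U.twist_gen, U.δ, U.μ, U.ν,
      TensorProduct.tmul_smul, ← TensorProduct.smul_tmul', smul_smul, ph_zero]
  counit_gen x hx := by
    rw [U.counit_gen]
    cases x <;> simp_all [U.δ, U.μ, U.ν]
  antipode_one := by simp [U.antipode]
  antipode_gen_mul := U.antipode_gen_mul q φ hq
  antipode_twist_gen k x := by
    rw [U.antipode_gen]
    cases x <;> simp [U.antipodeGen, U.e, U.f, U.k, U.ks, U.ki, U.ksi, U.twist_gen, U.δ, U.μ,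
      U.ν, ph_zero, smul_smul, mul_comm]
  coassoc_gen x := by
    have h1 := U.comul_gen q φ hq .e
    have h2 := U.comul_gen q φ hq .f
    have h3 := U.comul_gen q φ hq .k
    have h4 := U.comul_gen q φ hq .ks
    have h5 := U.comul_gen q φ hq .ki
    have h6 := U.comul_gen q φ hq .ksi
    rw [U.comul_gen]
    simp only [U.comulGen, U.e, U.f, U.k, U.ks, U.ki, U.ksi] at h1 h2 h3 h4 h5 h6
    cases x <;> simp [U.comulGen, U.e, U.f, U.k, U.ks, U.ki, U.ksi, h1, h2, h3, h4, h5, h6,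
      TensorProduct.add_tmul, TensorProduct.tmul_add, add_assoc]
  counit_comul_gen x := by
    rw [U.comul_gen]
    cases x <;> simp [U.comulGen, U.e, U.f, U.k, U.ks, U.ki, U.ksi, U.counit_gen]
  comul_counit_gen x := by
    rw [U.comul_gen]
    cases x <;> simp [U.comulGen, U.e, U.f, U.k, U.ks, U.ki, U.ksi, U.counit_gen]
  antipode_left_gen x := by
    have hq' : (q : ℂ) ≠ 0 := by exact_mod_cast hq
    have hw := ph_ne_zero φ 4
    have h1 := U.antipode_gen q φ hq .e
    have h2 := U.antipode_gen q φ hq .f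
    have h3 := U.antipode_gen q φ hq .k
    have h4 := U.antipode_gen q φ hq .ks
    have h5 := U.antipode_gen q φ hq .ki
    have h6 := U.antipode_gen q φ hq .ksi
    change U.antipode q φ hq (U.e q φ) = _ at h1
    change U.antipode q φ hq (U.f q φ) = _ at h2
    change U.antipode q φ hq (U.k q φ) = _ at h3
    change U.antipode q φ hq (U.ks q φ) = _ at h4
    change U.antipode q φ hq (U.ki q φ) = _ at h5
    change U.antipode q φ hq (U.ksi q φ) = _ at h6
    rw [U.comul_gen, U.counit_gen]
    cases x <;>
    · simp only [U.comulGen, map_add, map_smul, LinearMap.rTensor_tmul, h1, h2, h3, h4, h5, h6,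
        U.antipodeGen, LinearMap.mul'_apply, smul_mul_assoc, U.k_ki, U.ki_k, U.ks_ksi, U.ksi_ks,
        U.e_k, U.f_ks q φ hq, ph_neg, map_one, map_zero]
      try match_scalars <;> field_simp <;> ring
  antipode_right_gen x := by
    have hq' : (q : ℂ) ≠ 0 := by exact_mod_cast hq
    have hw := ph_ne_zero φ 4
    have h1 := U.antipode_gen q φ hq .e
    have h2 := U.antipode_gen q φ hq .f
    have h3 := U.antipode_gen q φ hq .k
    have h4 := U.antipode_gen q φ hq .ks
    have h5 := U.antipode_gen q φ hq .ki
    have h6 := U.antipode_gen q φ hq .ksi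
    change U.antipode q φ hq (U.e q φ) = _ at h1
    change U.antipode q φ hq (U.f q φ) = _ at h2
    change U.antipode q φ hq (U.k q φ) = _ at h3
    change U.antipode q φ hq (U.ks q φ) = _ at h4
    change U.antipode q φ hq (U.ki q φ) = _ at h5
    change U.antipode q φ hq (U.ksi q φ) = _ at h6
    rw [U.comul_gen, U.counit_gen]
    cases x <;>
    · simp only [U.comulGen, map_add, map_smul, LinearMap.lTensor_tmul, h1, h2, h3, h4, h5, h6,
        U.antipodeGen, LinearMap.mul'_apply, mul_smul_comm, U.k_ki, U.ki_k, U.ks_ksi, U.ksi_ks,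
        U.e_ki q φ hq, U.f_ksi q φ hq, ph_neg, map_one, map_zero]
      try match_scalars <;> field_simp <;> ring

end Instances

/-! ### The operators of the left action, built from the relations of A. -/

section LeftAction

/-- Rewriting all phases as powers of e^{2iφ}, and q as a square of √q, turns the coefficient checks
below into identities of rational functions in two nonzero quantities. -/
theorem ph_four (φ : ℝ) : ph φ 4 = ph φ 2 ^ 2 := by
  rw [show (4 : ℤ) = 2 + 2 by norm_num, ph_add]; ring

theorem ph_eight_eq_pow (φ : ℝ) : ph φ 8 = ph φ 2 ^ 4 := by
  rw [ph_eight, ph_four]; ring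

theorem ofReal_eq_sqrt_sq {q : ℝ} (hq : 0 < q) : (q : ℂ) = (Real.sqrt q : ℂ) ^ 2 := by
  exact_mod_cast (Real.sq_sqrt hq.le).symm

theorem ofReal_sqrt_ne_zero {q : ℝ} (hq : 0 < q) : (Real.sqrt q : ℂ) ≠ 0 := by
  exact_mod_cast (Real.sqrt_pos.2 hq).ne'

namespace SU

/-- The map `(x ▷ w)ₓ ↦ (x ▷ (y w))ₓ`, where `x` runs through the generators of
`U_{q,φ}(û(2))` and `y` is a generator of `SU_{q,φ}(2)`. -/
def leftActOp (q φ : ℝ) (y : SUGen) : Module.End ℂ (UGen → SU q φ) :=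
  LinearMap.pi fun
    -- Read off from Δe = e ⊗ k + k⁻¹ ⊗ e: in the second term e, of degree -2, passes y before
    -- acting on w, which gives the phase.
    | .e => LinearMap.mulLeft ℂ (leftActGen q φ .e y) ∘ₗ LinearMap.proj .k +
        ph φ (2 * (-2) * δ y) • LinearMap.mulLeft ℂ (leftActGen q φ .ki y) ∘ₗ LinearMap.proj .e
    | .f => LinearMap.mulLeft ℂ (leftActGen q φ .f y) ∘ₗ LinearMap.proj .ks +
        ph φ (2 * 2 * δ y) • LinearMap.mulLeft ℂ (leftActGen q φ .ksi y) ∘ₗ LinearMap.proj .f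
    | .k => LinearMap.mulLeft ℂ (leftActGen q φ .k y) ∘ₗ LinearMap.proj .k
    | .ks => LinearMap.mulLeft ℂ (leftActGen q φ .ks y) ∘ₗ LinearMap.proj .ks
    | .ki => LinearMap.mulLeft ℂ (leftActGen q φ .ki y) ∘ₗ LinearMap.proj .ki
    | .ksi => LinearMap.mulLeft ℂ (leftActGen q φ .ksi y) ∘ₗ LinearMap.proj .ksi

theorem leftActOp_e (q φ : ℝ) (y : SUGen) (w : UGen → SU q φ) :
    leftActOp q φ y w .e = leftActGen q φ .e y * w .k +
      ph φ (2 * (-2) * δ y) • (leftActGen q φ .ki y * w .e) := rfl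
theorem leftActOp_f (q φ : ℝ) (y : SUGen) (w : UGen → SU q φ) :
    leftActOp q φ y w .f = leftActGen q φ .f y * w .ks +
      ph φ (2 * 2 * δ y) • (leftActGen q φ .ksi y * w .f) := rfl
theorem leftActOp_k (q φ : ℝ) (y : SUGen) (w : UGen → SU q φ) :
    leftActOp q φ y w .k = leftActGen q φ .k y * w .k := rfl
theorem leftActOp_ks (q φ : ℝ) (y : SUGen) (w : UGen → SU q φ) :
    leftActOp q φ y w .ks = leftActGen q φ .ks y * w .ks := rfl
theorem leftActOp_ki (q φ : ℝ) (y : SUGen) (w : UGen → SU q φ) :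
    leftActOp q φ y w .ki = leftActGen q φ .ki y * w .ki := rfl
theorem leftActOp_ksi (q φ : ℝ) (y : SUGen) (w : UGen → SU q φ) :
    leftActOp q φ y w .ksi = leftActGen q φ .ksi y * w .ksi := rfl

/-- The homomorphism `y ↦ ((x ▷ w)ₓ ↦ (x ▷ (y w))ₓ)`. -/
def leftActHom (q φ : ℝ) (hq : 0 < q) : SU q φ →ₐ[ℂ] Module.End ℂ (UGen → SU q φ) :=
  lift q φ (leftActOp q φ) (by
    intro r s h
    have hw := ph_ne_zero φ 2
    have hs := ofReal_sqrt_ne_zero hq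
    refine LinearMap.ext fun w => funext fun x => ?_
    cases h <;> cases x <;>
    · simp only [map_mul, map_add, map_smul, map_one, FreeAlgebra.lift_ι_apply,
        Module.End.mul_apply, Module.End.one_apply, LinearMap.add_apply, LinearMap.smul_apply,
        Pi.add_apply, Pi.smul_apply, leftActOp_e, leftActOp_f, leftActOp_k, leftActOp_ks,
        leftActOp_ki, leftActOp_ksi, leftActGen, mul_add, smul_mul_assoc, mul_smul_comm,
        zero_mul, mul_zero, smul_zero, zero_add, add_zero, smul_add, smul_sub, mul_sub,
        rα_γ, rα_γs, rα_αs, rαs_α,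
        rγs_γ, rαs_γ q φ hq.ne', rαs_γs q φ hq.ne', δ, μ, ν, Int.reduceMul, Int.reduceNeg,
        Int.reduceAdd, Int.reduceSub, ph_neg, ph_eight_eq_pow, ph_four, ph_zero,
        ofReal_eq_sqrt_sq hq]
      try match_scalars <;> field_simp <;> ring)

/-- The operator `a ↦ x ▷ a`, for a generator `x` of `U_{q,φ}(û(2))`. -/
def actOp (q φ : ℝ) (hq : 0 < q) (x : UGen) : Module.End ℂ (SU q φ) :=
  -- The starting tuple (ε(x)1) is what x ▷ 1 has to be, so the operator attached to a sends it to
  -- the tuple of all x ▷ a.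
  LinearMap.proj x ∘ₗ LinearMap.applyₗ (fun x => algebraMap ℂ _ (U.counit q φ (U.gen q φ x))) ∘ₗ
    (leftActHom q φ hq).toLinearMap

theorem actOp_one (q φ : ℝ) (hq : 0 < q) (x : UGen) :
    actOp q φ hq x 1 = algebraMap ℂ _ (U.counit q φ (U.gen q φ x)) := by
  simp [actOp]

theorem actOp_gen_mul (q φ : ℝ) (hq : 0 < q) (x : UGen) (y : SUGen) (a : SU q φ) :
    actOp q φ hq x (gen q φ y * a) = leftActOp q φ y (fun x => actOp q φ hq x a) x := by
  have h : (fun x => actOp q φ hq x a) = leftActHom q φ hq a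
      (fun x => algebraMap ℂ _ (U.counit q φ (U.gen q φ x))) := rfl
  rw [h]
  simp [actOp, leftActHom, lift_gen]

end SU

end LeftAction

/-! ### The operators satisfy the relations of H. -/

section LeftActionHom

namespace SU

theorem gen_α (q φ : ℝ) : gen q φ .α = α q φ := rfl
theorem gen_αs (q φ : ℝ) : gen q φ .αs = αs q φ := rfl
theorem gen_γ (q φ : ℝ) : gen q φ .γ = γ q φ := rfl
theorem gen_γs (q φ : ℝ) : gen q φ .γs = γs q φ := rfl

variable (q φ : ℝ) (hq : 0 < q)

theorem actOp_α (x : UGen) (a : SU q φ) : actOp q φ hq x (α q φ * a) =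
    leftActOp q φ .α (fun x => actOp q φ hq x a) x := actOp_gen_mul q φ hq x .α a
theorem actOp_αs (x : UGen) (a : SU q φ) : actOp q φ hq x (αs q φ * a) =
    leftActOp q φ .αs (fun x => actOp q φ hq x a) x := actOp_gen_mul q φ hq x .αs a
theorem actOp_γ (x : UGen) (a : SU q φ) : actOp q φ hq x (γ q φ * a) =
    leftActOp q φ .γ (fun x => actOp q φ hq x a) x := actOp_gen_mul q φ hq x .γ a
theorem actOp_γs (x : UGen) (a : SU q φ) : actOp q φ hq x (γs q φ * a) =
    leftActOp q φ .γs (fun x => actOp q φ hq x a) x := actOp_gen_mul q φ hq x .γs a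

/-- Like the other operator relations below, this holds at 1 by the counit and survives left
multiplication by each generator of A, where only coefficients have to be compared. -/
theorem actOp_ki_k (a : SU q φ) : actOp q φ hq .ki (actOp q φ hq .k a) = a := by
  have hw := ph_ne_zero φ 2
  have hs := ofReal_sqrt_ne_zero hq
  refine induction q φ (fun a => actOp q φ hq .ki (actOp q φ hq .k a) = a)
    (by simp [actOp_one, U.counit_gen]) (fun x y hx hy => by simp only [map_add, hx, hy])
    (fun r x hx => by simp only [map_smul, hx]) (fun y a ih => ?_) a
  cases y <;>
  · simp only [gen_α, gen_αs, gen_γ, gen_γs, actOp_α, actOp_αs, actOp_γ, actOp_γs, leftActOp_k,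
      leftActOp_ki, leftActGen, map_smul, smul_mul_assoc, ih, smul_smul, ph_neg]
    match_scalars; field_simp

theorem actOp_k_ki (a : SU q φ) : actOp q φ hq .k (actOp q φ hq .ki a) = a := by
  have hw := ph_ne_zero φ 2
  have hs := ofReal_sqrt_ne_zero hq
  refine induction q φ (fun a => actOp q φ hq .k (actOp q φ hq .ki a) = a)
    (by simp [actOp_one, U.counit_gen]) (fun x y hx hy => by simp only [map_add, hx, hy])
    (fun r x hx => by simp only [map_smul, hx]) (fun y a ih => ?_) a
  cases y <;>
  · simp only [gen_α, gen_αs, gen_γ, gen_γs, actOp_α, actOp_αs, actOp_γ, actOp_γs, leftActOp_k,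
      leftActOp_ki, leftActGen, map_smul, smul_mul_assoc, ih, smul_smul, ph_neg]
    match_scalars; field_simp

theorem actOp_ksi_ks (a : SU q φ) : actOp q φ hq .ksi (actOp q φ hq .ks a) = a := by
  have hw := ph_ne_zero φ 2
  have hs := ofReal_sqrt_ne_zero hq
  refine induction q φ (fun a => actOp q φ hq .ksi (actOp q φ hq .ks a) = a)
    (by simp [actOp_one, U.counit_gen]) (fun x y hx hy => by simp only [map_add, hx, hy])
    (fun r x hx => by simp only [map_smul, hx]) (fun y a ih => ?_) a
  cases y <;>
  · simp only [gen_α, gen_αs, gen_γ, gen_γs, actOp_α, actOp_αs, actOp_γ, actOp_γs, leftActOp_ks,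
      leftActOp_ksi, leftActGen, map_smul, smul_mul_assoc, ih, smul_smul, ph_neg]
    match_scalars; field_simp

theorem actOp_ks_ksi (a : SU q φ) : actOp q φ hq .ks (actOp q φ hq .ksi a) = a := by
  have hw := ph_ne_zero φ 2
  have hs := ofReal_sqrt_ne_zero hq
  refine induction q φ (fun a => actOp q φ hq .ks (actOp q φ hq .ksi a) = a)
    (by simp [actOp_one, U.counit_gen]) (fun x y hx hy => by simp only [map_add, hx, hy])
    (fun r x hx => by simp only [map_smul, hx]) (fun y a ih => ?_) a
  cases y <;>
  · simp only [gen_α, gen_αs, gen_γ, gen_γs, actOp_α, actOp_αs, actOp_γ, actOp_γs, leftActOp_ks,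
      leftActOp_ksi, leftActGen, map_smul, smul_mul_assoc, ih, smul_smul, ph_neg]
    match_scalars; field_simp

theorem actOp_ks_k (a : SU q φ) :
    actOp q φ hq .ks (actOp q φ hq .k a) = actOp q φ hq .k (actOp q φ hq .ks a) := by
  refine induction q φ (fun a => actOp q φ hq .ks (actOp q φ hq .k a) =
      actOp q φ hq .k (actOp q φ hq .ks a))
    (by simp [actOp_one, U.counit_gen]) (fun x y hx hy => by simp only [map_add, hx, hy])
    (fun r x hx => by simp only [map_smul, hx]) (fun y a ih => ?_) a
  cases y <;>
  · simp only [gen_α, gen_αs, gen_γ, gen_γs, actOp_α, actOp_αs, actOp_γ, actOp_γs, leftActOp_ks,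
      leftActOp_k, leftActGen, map_smul, smul_mul_assoc, ih, smul_smul]
    match_scalars; ring

theorem actOp_e_k (a : SU q φ) : actOp q φ hq .e (actOp q φ hq .k a) =
    (q * ph φ (-4)) • actOp q φ hq .k (actOp q φ hq .e a) := by
  have hw := ph_ne_zero φ 2
  have hs := ofReal_sqrt_ne_zero hq
  refine induction q φ (fun a => actOp q φ hq .e (actOp q φ hq .k a) =
      (q * ph φ (-4)) • actOp q φ hq .k (actOp q φ hq .e a))
    (by simp [actOp_one, U.counit_gen]) (fun x y hx hy => by simp only [map_add, hx, hy, smul_add])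
    (fun r x hx => by simp only [map_smul, hx]; rw [smul_comm]) (fun y a ih => ?_) a
  cases y <;>
  · simp only [gen_α, gen_αs, gen_γ, gen_γs, actOp_α, actOp_αs, actOp_γ, actOp_γs, leftActOp_e,
      leftActOp_k, leftActGen, map_smul, map_add, smul_mul_assoc, mul_smul_comm, ih, smul_smul,
      smul_add, zero_mul, actOp_ki_k, actOp_k_ki, map_zero, smul_zero, zero_add, add_zero, δ, μ, ν,
      Int.reduceMul, Int.reduceNeg, Int.reduceSub, ph_neg, ph_eight_eq_pow, ph_four, ph_zero,
      ofReal_eq_sqrt_sq hq]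
    match_scalars <;> field_simp

theorem actOp_e_ks (a : SU q φ) : actOp q φ hq .e (actOp q φ hq .ks a) =
    (q * ph φ 4) • actOp q φ hq .ks (actOp q φ hq .e a) := by
  have hw := ph_ne_zero φ 2
  have hs := ofReal_sqrt_ne_zero hq
  refine induction q φ (fun a => actOp q φ hq .e (actOp q φ hq .ks a) =
      (q * ph φ 4) • actOp q φ hq .ks (actOp q φ hq .e a))
    (by simp [actOp_one, U.counit_gen]) (fun x y hx hy => by simp only [map_add, hx, hy, smul_add])
    (fun r x hx => by simp only [map_smul, hx]; rw [smul_comm]) (fun y a ih => ?_) a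
  cases y <;>
  · simp only [gen_α, gen_αs, gen_γ, gen_γs, actOp_α, actOp_αs, actOp_γ, actOp_γs, leftActOp_e,
      leftActOp_ks, leftActGen, map_smul, map_add, smul_mul_assoc, mul_smul_comm, ih, smul_smul,
      smul_add, zero_mul, actOp_ks_k, map_zero, smul_zero, zero_add, add_zero, δ, μ, ν,
      Int.reduceMul, Int.reduceNeg, Int.reduceSub, ph_neg, ph_eight_eq_pow, ph_four, ph_zero,
      ofReal_eq_sqrt_sq hq]
    match_scalars <;> field_simp

theorem actOp_k_f (a : SU q φ) : actOp q φ hq .k (actOp q φ hq .f a) =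
    (q * ph φ (-4)) • actOp q φ hq .f (actOp q φ hq .k a) := by
  have hw := ph_ne_zero φ 2
  have hs := ofReal_sqrt_ne_zero hq
  refine induction q φ (fun a => actOp q φ hq .k (actOp q φ hq .f a) =
      (q * ph φ (-4)) • actOp q φ hq .f (actOp q φ hq .k a))
    (by simp [actOp_one, U.counit_gen]) (fun x y hx hy => by simp only [map_add, hx, hy, smul_add])
    (fun r x hx => by simp only [map_smul, hx]; rw [smul_comm]) (fun y a ih => ?_) a
  cases y <;>
  · simp only [gen_α, gen_αs, gen_γ, gen_γs, actOp_α, actOp_αs, actOp_γ, actOp_γs, leftActOp_f,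
      leftActOp_k, leftActGen, map_smul, map_add, smul_mul_assoc, mul_smul_comm, ih, smul_smul,
      smul_add, zero_mul, actOp_ks_k, map_zero, smul_zero, zero_add, add_zero, δ, μ, ν,
      Int.reduceMul, Int.reduceNeg, Int.reduceSub, ph_neg, ph_eight_eq_pow, ph_four, ph_zero,
      ofReal_eq_sqrt_sq hq]
    match_scalars <;> field_simp

theorem actOp_ks_f (a : SU q φ) : actOp q φ hq .ks (actOp q φ hq .f a) =
    (q * ph φ 4) • actOp q φ hq .f (actOp q φ hq .ks a) := by
  have hw := ph_ne_zero φ 2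
  have hs := ofReal_sqrt_ne_zero hq
  refine induction q φ (fun a => actOp q φ hq .ks (actOp q φ hq .f a) =
      (q * ph φ 4) • actOp q φ hq .f (actOp q φ hq .ks a))
    (by simp [actOp_one, U.counit_gen]) (fun x y hx hy => by simp only [map_add, hx, hy, smul_add])
    (fun r x hx => by simp only [map_smul, hx]; rw [smul_comm]) (fun y a ih => ?_) a
  cases y <;>
  · simp only [gen_α, gen_αs, gen_γ, gen_γs, actOp_α, actOp_αs, actOp_γ, actOp_γs, leftActOp_f,
      leftActOp_ks, leftActGen, map_smul, map_add, smul_mul_assoc, mul_smul_comm, ih, smul_smul,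
      smul_add, zero_mul, actOp_ks_ksi, actOp_ksi_ks, map_zero, smul_zero, zero_add, add_zero, δ,
      μ, ν, Int.reduceMul, Int.reduceNeg, Int.reduceSub, ph_neg, ph_eight_eq_pow, ph_four, ph_zero,
      ofReal_eq_sqrt_sq hq]
    match_scalars <;> field_simp

/-- In e ▷ f ▷ (ya) - f ▷ e ▷ (ya) the terms where e and f hit different factors cancel after
commuting e past k* and k past f. The rest is the commutator on y and, by induction, the commutator
on a. -/
theorem actOp_e_f (hq1 : q < 1) (a : SU q φ) : actOp q φ hq .e (actOp q φ hq .f a) =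
    actOp q φ hq .f (actOp q φ hq .e a) + (1 / ((q : ℂ)⁻¹ - q)) •
      (actOp q φ hq .k (actOp q φ hq .ks a) - actOp q φ hq .ki (actOp q φ hq .ksi a)) := by
  have hw := ph_ne_zero φ 2
  have hs := ofReal_sqrt_ne_zero hq
  have hq' : (q : ℂ) ≠ 0 := by exact_mod_cast hq.ne'
  -- The denominator q⁻¹ - q equals (1 - q²)/q; this is where q < 1 is used.
  have hd : 1 - (Real.sqrt q : ℂ) ^ 4 ≠ 0 := by
    rw [show (Real.sqrt q : ℂ) ^ 4 = ((Real.sqrt q : ℂ) ^ 2) ^ 2 by ring, ← ofReal_eq_sqrt_sq hq]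
    have : (1 - q ^ 2 : ℝ) ≠ 0 := by nlinarith
    exact_mod_cast this
  have hc : 1 / ((q : ℂ)⁻¹ - q) = (Real.sqrt q : ℂ) ^ 2 / (1 - (Real.sqrt q : ℂ) ^ 4) := by
    rw [ofReal_eq_sqrt_sq hq]; field_simp
  rw [hc]
  refine induction q φ (fun a => actOp q φ hq .e (actOp q φ hq .f a) =
    actOp q φ hq .f (actOp q φ hq .e a) +
    ((Real.sqrt q : ℂ) ^ 2 / (1 - (Real.sqrt q : ℂ) ^ 4)) •
      (actOp q φ hq .k (actOp q φ hq .ks a) - actOp q φ hq .ki (actOp q φ hq .ksi a)))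
    (by simp [actOp_one, U.counit_gen])
    (fun x y hx hy => by simp only [map_add, hx, hy]; module)
    (fun r x hx => by simp only [map_smul, hx]; module) (fun y a ih => ?_) a
  cases y <;>
  · simp only [gen_α, gen_αs, gen_γ, gen_γs, actOp_α, actOp_αs, actOp_γ, actOp_γs, leftActOp_f,
      leftActOp_ks, leftActOp_k, leftActOp_ki, leftActOp_ksi, leftActOp_e, leftActGen, map_smul,
      map_add, smul_mul_assoc, mul_smul_comm, ih, smul_smul, actOp_e_ks, actOp_k_f,
      mul_add, mul_sub, smul_sub,
      smul_add, zero_mul, actOp_ks_ksi, actOp_ksi_ks, actOp_ks_k,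
      map_zero, smul_zero, zero_add, add_zero, δ,
      μ, ν, Int.reduceMul, Int.reduceNeg, Int.reduceSub, ph_neg, ph_eight_eq_pow, ph_four, ph_zero,
      ofReal_eq_sqrt_sq hq]
    match_scalars <;> field_simp <;> ring

end SU

/-- The left action of `U_{q,φ}(û(2))` on `SU_{q,φ}(2)`, as a homomorphism. -/
def actHom (q φ : ℝ) (hq : 0 < q) (hq1 : q < 1) : U q φ →ₐ[ℂ] Module.End ℂ (SU q φ) :=
  U.lift q φ (SU.actOp q φ hq) (by
    intro r s h
    refine LinearMap.ext fun a => ?_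
    cases h <;> simp only [map_mul, map_sub, map_smul, map_one, FreeAlgebra.lift_ι_apply,
      Module.End.mul_apply, Module.End.one_apply, LinearMap.smul_apply, LinearMap.sub_apply]
    · exact SU.actOp_k_ki q φ hq a
    · exact SU.actOp_ki_k q φ hq a
    · exact SU.actOp_ks_ksi q φ hq a
    · exact SU.actOp_ksi_ks q φ hq a
    · exact SU.actOp_e_k q φ hq a
    · exact SU.actOp_ks_f q φ hq a
    · exact SU.actOp_k_f q φ hq a
    · exact SU.actOp_e_ks q φ hq a
    · rw [SU.actOp_e_f q φ hq hq1, add_sub_cancel_left]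
    · exact (SU.actOp_ks_k q φ hq a).symm)

theorem actHom_gen (q φ : ℝ) (hq : 0 < q) (hq1 : q < 1) (x : UGen) :
    actHom q φ hq hq1 (U.gen q φ x) = SU.actOp q φ hq x := U.lift_gen q φ _ _ x

end LeftActionHom

/-! ### Degrees, the module algebra property and the left braided action. -/

section LeftActionProperties

theorem SU.spannedByHomogeneous (q φ : ℝ) (hq : 0 < q) : SpannedByHomogeneous (SU.grading q φ) :=
  (SU.hopfGenerators q φ hq.ne').spannedByHomogeneous

theorem U.spannedByHomogeneous (q φ : ℝ) (hq : 0 < q) : SpannedByHomogeneous (U.grading q φ) :=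
  (U.hopfGenerators q φ hq.ne').spannedByHomogeneous

variable (q φ : ℝ) (hq : 0 < q) (hq1 : q < 1)

theorem twist_leftActGen (k : ℤ) (x : UGen) (y : SUGen) :
    phaseTwist φ (SU.grading q φ) k (leftActGen q φ x y) =
      ph φ (2 * k * (U.δ x + SU.δ y)) • leftActGen q φ x y := by
  have h1 := SU.twist_gen q φ k .α
  have h2 := SU.twist_gen q φ k .αs
  have h3 := SU.twist_gen q φ k .γ
  have h4 := SU.twist_gen q φ k .γs
  change phaseTwist φ (SU.grading q φ) k (SU.α q φ) = _ • SU.α q φ at h1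
  change phaseTwist φ (SU.grading q φ) k (SU.αs q φ) = _ • SU.αs q φ at h2
  change phaseTwist φ (SU.grading q φ) k (SU.γ q φ) = _ • SU.γ q φ at h3
  change phaseTwist φ (SU.grading q φ) k (SU.γs q φ) = _ • SU.γs q φ at h4
  cases x <;> cases y <;> simp [leftActGen, h1, h2, h3, h4, U.δ, U.μ, U.ν, SU.δ, SU.μ, SU.ν,
    ph_zero, smul_smul, mul_comm]

theorem twist_algebraMap (k : ℤ) (r : ℂ) : phaseTwist φ (SU.grading q φ) k
    (algebraMap ℂ (SU q φ) r) = algebraMap ℂ (SU q φ) r := by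
  rw [Algebra.algebraMap_eq_smul_one, map_smul, phaseTwist_one]

/-- The operator x ▷ shifts degree by δ(x). All x are treated together in the induction because e ▷
(ya) and f ▷ (ya) involve the group-like operators on a. -/
theorem twist_actOp (k : ℤ) (x : UGen) (a : SU q φ) :
    phaseTwist φ (SU.grading q φ) k (SU.actOp q φ hq x a) =
      ph φ (2 * k * U.δ x) • SU.actOp q φ hq x (phaseTwist φ (SU.grading q φ) k a) := by
  refine SU.induction q φ (fun a => ∀ x, phaseTwist φ (SU.grading q φ) k (SU.actOp q φ hq x a) =
      ph φ (2 * k * U.δ x) • SU.actOp q φ hq x (phaseTwist φ (SU.grading q φ) k a)) ?_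
    (fun a b ha hb x => by simp only [map_add, smul_add, ha, hb])
    (fun r a ha x => by simp only [map_smul, ha]; rw [smul_comm]) (fun y a ih x => ?_) a x
  · intro x
    rw [phaseTwist_one, SU.actOp_one, twist_algebraMap, U.counit_gen]
    cases x <;> simp [U.δ, U.μ, U.ν, ph_zero]
  · rw [SU.actOp_gen_mul, SU.twist_gen_mul, map_smul, SU.actOp_gen_mul, smul_smul]
    cases x <;>
    · simp only [SU.leftActOp_e, SU.leftActOp_f, SU.leftActOp_k, SU.leftActOp_ks,
        SU.leftActOp_ki, SU.leftActOp_ksi, map_add, map_smul, phaseTwist_mul, ih,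
        twist_leftActGen, smul_mul_assoc, mul_smul_comm, smul_smul, smul_add, ← ph_add,
        U.δ, U.μ, U.ν]
      try congr 1
      all_goals ring_nf

theorem twist_actHom (k : ℤ) (h : U q φ) (a : SU q φ) :
    phaseTwist φ (SU.grading q φ) k (actHom q φ hq hq1 h a) =
      actHom q φ hq hq1 (phaseTwist φ (U.grading q φ) k h)
        (phaseTwist φ (SU.grading q φ) k a) := by
  refine U.induction q φ (fun h => ∀ a, phaseTwist φ (SU.grading q φ) k (actHom q φ hq hq1 h a) =
      actHom q φ hq hq1 (phaseTwist φ (U.grading q φ) k h)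
        (phaseTwist φ (SU.grading q φ) k a)) ?_
    (fun a b ha hb x => by simp only [map_add, LinearMap.add_apply, ha, hb])
    (fun r a ha x => by simp only [map_smul, LinearMap.smul_apply, ha])
    (fun y a ih x => ?_) h a
  · simp [phaseTwist_one]
  · rw [U.twist_gen_mul, map_mul, map_smul, map_mul, Module.End.mul_apply, actHom_gen,
      twist_actOp, ih]
    rfl

theorem actHom_one_right (h : U q φ) :
    actHom q φ hq hq1 h 1 = algebraMap ℂ (SU q φ) (U.counit q φ h) := by
  refine U.induction q φ (fun h => actHom q φ hq hq1 h 1 =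
      algebraMap ℂ (SU q φ) (U.counit q φ h)) (by simp)
    (fun a b ha hb => by simp only [map_add, LinearMap.add_apply, ha, hb])
    (fun r a ha => by simp only [map_smul, LinearMap.smul_apply, ha,
      Algebra.algebraMap_eq_smul_one, smul_smul, smul_eq_mul]) (fun x h ih => ?_) h
  rw [map_mul, Module.End.mul_apply, ih, Algebra.algebraMap_eq_smul_one, map_smul, actHom_gen,
    SU.actOp_one, map_mul, Algebra.algebraMap_eq_smul_one, Algebra.algebraMap_eq_smul_one,
    smul_smul, mul_comm]

theorem SU.actOp_gen (x : UGen) (y : SUGen) :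
    SU.actOp q φ hq x (SU.gen q φ y) = leftActGen q φ x y := by
  rw [← mul_one (SU.gen q φ y), SU.actOp_gen_mul]
  cases x <;> simp [SU.leftActOp_e, SU.leftActOp_f, SU.leftActOp_k, SU.leftActOp_ks,
        SU.leftActOp_ki, SU.leftActOp_ksi, SU.actOp_one, U.counit_gen]

/-- The left action as a map on the tensor product. -/
def act : U q φ ⊗[ℂ] SU q φ →ₗ[ℂ] SU q φ := TensorProduct.lift (actHom q φ hq hq1).toLinearMap

theorem act_tmul (h : U q φ) (a : SU q φ) :
    act q φ hq hq1 (h ⊗ₜ a) = actHom q φ hq hq1 h a := rfl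

theorem mutualBraiding_gen (x : UGen) (a : SU q φ) : mutualBraiding q φ (U.gen q φ x ⊗ₜ a) =
    phaseTwist φ (SU.grading q φ) (U.δ x) a ⊗ₜ U.gen q φ x :=
  phaseBraiding_of_single φ _ _ _ _ _ (U.grading_gen q φ x)

/-- For a generator a this is how the operators were defined, and associativity of A carries it to
words. The general formula is first unfolded for each x from Δx. -/
theorem SU.actOp_mul (x : UGen) (a b : SU q φ) :
    SU.actOp q φ hq x (a * b) = LinearMap.mul' ℂ (SU q φ) (TensorProduct.map (act q φ hq hq1)
      (act q φ hq hq1) (braidMid (mutualBraiding q φ) (U.comulGen q φ x ⊗ₜ (a ⊗ₜ b)))) := by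
  have h : ∀ x : UGen, SU.actOp q φ hq x (a * b) = match x with
      | .e => SU.actOp q φ hq .e a * SU.actOp q φ hq .k b + SU.actOp q φ hq .ki
          (phaseTwist φ (SU.grading q φ) (-2) a) * SU.actOp q φ hq .e b
      | .f => SU.actOp q φ hq .f a * SU.actOp q φ hq .ks b + SU.actOp q φ hq .ksi
          (phaseTwist φ (SU.grading q φ) 2 a) * SU.actOp q φ hq .f b
      | x => SU.actOp q φ hq x a * SU.actOp q φ hq x b := by
    refine SU.induction q φ (fun a => ∀ x : UGen, SU.actOp q φ hq x (a * b) = match x with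
      | .e => SU.actOp q φ hq .e a * SU.actOp q φ hq .k b + SU.actOp q φ hq .ki
          (phaseTwist φ (SU.grading q φ) (-2) a) * SU.actOp q φ hq .e b
      | .f => SU.actOp q φ hq .f a * SU.actOp q φ hq .ks b + SU.actOp q φ hq .ksi
          (phaseTwist φ (SU.grading q φ) 2 a) * SU.actOp q φ hq .f b
      | x => SU.actOp q φ hq x a * SU.actOp q φ hq x b) ?_ ?_ ?_ ?_ a
    · intro x
      cases x <;> simp [SU.actOp_one, U.counit_gen, phaseTwist_one]
    · intro a a' ha ha' x
      cases x <;> simp only [add_mul, map_add, ha, ha'] <;> abel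
    · intro r a ha x
      cases x <;> simp only [smul_mul_assoc, map_smul, ha, smul_add]
    · intro y a ih x
      cases x <;>
      simp only [mul_assoc, SU.actOp_gen_mul, SU.leftActOp_e, SU.leftActOp_f, SU.leftActOp_k,
        SU.leftActOp_ks, SU.leftActOp_ki, SU.leftActOp_ksi, ih, SU.twist_gen_mul, map_smul,
        add_mul, mul_add, smul_mul_assoc, smul_add, add_assoc]
  rw [h x]
  have h1 := fun a => mutualBraiding_gen q φ .e a
  have h2 := fun a => mutualBraiding_gen q φ .f a
  have h3 := fun a => mutualBraiding_gen q φ .k a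
  have h4 := fun a => mutualBraiding_gen q φ .ks a
  have h5 := fun a => mutualBraiding_gen q φ .ki a
  have h6 := fun a => mutualBraiding_gen q φ .ksi a
  cases x <;> simp [U.comulGen, U.e, U.f, U.k, U.ks, U.ki, U.ksi, TensorProduct.add_tmul, h1, h2,
    h3, h4, h5, h6, act_tmul, actHom_gen, U.δ, U.μ, U.ν, SU.twist_zero]

/-- The braided square of H acts on A ⊗ A. Exchanging the two group actions costs a twist of h' ▷ a,
which splits into twists of h' and of a since ▷ preserves degree; these are the phases of the
braided product. -/
theorem act_braidMid_braidedMul (z z' : U q φ ⊗[ℂ] U q φ) (s : SU q φ ⊗[ℂ] SU q φ) :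
    TensorProduct.map (act q φ hq hq1) (act q φ hq hq1) (braidMid (mutualBraiding q φ)
      (braidedMul (U.braiding q φ) (z ⊗ₜ z') ⊗ₜ s)) =
    TensorProduct.map (act q φ hq hq1) (act q φ hq hq1) (braidMid (mutualBraiding q φ)
      (z ⊗ₜ TensorProduct.map (act q φ hq hq1) (act q φ hq hq1) (braidMid (mutualBraiding q φ)
        (z' ⊗ₜ s)))) := by
  have hU := U.spannedByHomogeneous q φ hq
  have hS := SU.spannedByHomogeneous q φ hq
  refine hU.induction_tmul hU (by simp)
    (fun z w hz hw => by simp only [TensorProduct.add_tmul, map_add, hz, hw])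
    (fun l m h g hh hg => ?_) z
  refine hS.induction_tmul hS (by simp)
    (fun z w hz hw => by simp only [TensorProduct.tmul_add, map_add, hz, hw])
    (fun n p a b ha hb => ?_) s
  induction z' using TensorProduct.induction_on with
  | zero => simp
  | add z w hz hw => simp only [TensorProduct.tmul_add, TensorProduct.add_tmul, map_add, hz, hw]
  | tmul h' g' =>
    have e1 : ∀ (x : U q φ), mutualBraiding q φ (x ⊗ₜ a) =
        a ⊗ₜ phaseTwist φ (U.grading q φ) n x := fun x =>
      phaseBraiding_of_single_right φ hU n x a ha
    have e2 : ∀ (x : SU q φ), mutualBraiding q φ (g ⊗ₜ x) =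
        phaseTwist φ (SU.grading q φ) m x ⊗ₜ g := fun x => phaseBraiding_of_single φ _ _ m g x hg
    rw [U.braiding, braidedMul_of_single φ _ m _ _ _ _ hg]
    simp only [braidMid_tmul, e1, e2, TensorProduct.assoc_tmul, TensorProduct.assoc_symm_tmul,
      TensorProduct.map_tmul, act_tmul, twist_actHom, map_mul, Module.End.mul_apply,
      phaseTwist_mul, phaseTwist_of_single φ _ _ _ _ ha, phaseTwist_of_single φ _ _ _ _ hg,
      map_smul, LinearMap.smul_apply, TensorProduct.tmul_smul, ← TensorProduct.smul_tmul']
    ring_nf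

/-- The product rule says that multiplication A ⊗ A → A intertwines the actions. It holds for
generators of H and passes to products because Δ is multiplicative and the braided square acts. -/
theorem actHom_mul (h : U q φ) (a b : SU q φ) :
    actHom q φ hq hq1 h (a * b) = LinearMap.mul' ℂ (SU q φ) (TensorProduct.map (act q φ hq hq1)
      (act q φ hq hq1) (braidMid (mutualBraiding q φ) (U.comul q φ hq.ne' h ⊗ₜ (a ⊗ₜ b)))) := by
  -- General tensors are needed: acting with the right-hand factor of a product in H turns a ⊗ b
  -- into a sum of tensors.
  have key : ∀ s : SU q φ ⊗[ℂ] SU q φ, actHom q φ hq hq1 h (LinearMap.mul' ℂ (SU q φ) s) =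
      LinearMap.mul' ℂ (SU q φ) (TensorProduct.map (act q φ hq hq1)
      (act q φ hq hq1) (braidMid (mutualBraiding q φ) (U.comul q φ hq.ne' h ⊗ₜ s))) := by
    refine U.induction q φ (fun h => ∀ s : SU q φ ⊗[ℂ] SU q φ,
      actHom q φ hq hq1 h (LinearMap.mul' ℂ (SU q φ) s) =
      LinearMap.mul' ℂ (SU q φ) (TensorProduct.map (act q φ hq hq1)
      (act q φ hq hq1) (braidMid (mutualBraiding q φ) (U.comul q φ hq.ne' h ⊗ₜ s)))) ?_
      (fun x y hx hy s => by
        simp only [map_add, LinearMap.add_apply, TensorProduct.add_tmul, hx, hy])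
      (fun r x hx s => by
        simp only [map_smul, LinearMap.smul_apply, ← TensorProduct.smul_tmul', hx])
      (fun x h ih s => ?_) h
    · intro s
      induction s using TensorProduct.induction_on with
      | zero => simp
      | add s t hs ht => simp only [map_add, TensorProduct.tmul_add, hs, ht]
      | tmul a b =>
        have e1 := (isAlgebraBraiding_phaseBraiding φ (U.spannedByHomogeneous q φ hq)
          (SU.spannedByHomogeneous q φ hq)).one_left a
        change mutualBraiding q φ (1 ⊗ₜ a) = _ at e1
        simp [U.comul_one, e1, act_tmul]
    · rw [map_mul, Module.End.mul_apply, ih, U.comul_gen_mul, act_braidMid_braidedMul, actHom_gen]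
      generalize TensorProduct.map (act q φ hq hq1) (act q φ hq hq1)
        (braidMid (mutualBraiding q φ) (U.comul q φ hq.ne' h ⊗ₜ s)) = t
      induction t using TensorProduct.induction_on with
      | zero => simp
      | add s t hs ht => simp only [map_add, TensorProduct.tmul_add, hs, ht]
      | tmul a b => rw [LinearMap.mul'_apply, SU.actOp_mul q φ hq hq1]
  exact key (a ⊗ₜ b)

theorem isLeftBraidedAction_act : IsLeftBraidedAction (U.comul q φ hq.ne')
    (U.counit q φ).toLinearMap (U.braiding q φ) (mutualBraiding q φ) (act q φ hq hq1) where
  braiding := isAlgebraBraiding_phaseBraiding φ (U.spannedByHomogeneous q φ hq)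
    (SU.spannedByHomogeneous q φ hq)
  braid_comul := braidsComulLeft_phaseBraiding φ (U.spannedByHomogeneous q φ hq)
    (SU.spannedByHomogeneous q φ hq) _ _ (U.hopfGenerators q φ hq.ne').comul_twist
    (U.hopfGenerators q φ hq.ne').counit_twist
  act_mul := actHom_mul q φ hq hq1
  mul_act h g a := by simp [act_tmul]
  braid_act h g a := by
    refine (U.spannedByHomogeneous q φ hq).induction (by simp)
      (fun x y hx hy => by simp only [TensorProduct.add_tmul, map_add, hx, hy])
      (fun n h hh => ?_) h
    simp [mutualBraiding, U.braiding, phaseBraiding_of_single φ _ _ n h _ hh, act_tmul,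
      twist_actHom]
  one_act a := by simp [act_tmul]
  act_one := actHom_one_right q φ hq hq1

end LeftActionProperties

/-! ### Covariance of the coproduct and the pairing it produces. -/

section Covariance

variable (q φ : ℝ) (hq : 0 < q) (hq1 : q < 1)

theorem SU.comul_mul_eq (a b : SU q φ) :
    SU.comul q φ hq.ne' (a * b) = SU.comulHom q φ hq.ne' a (SU.comul q φ hq.ne' b) := by
  simp [SU.comul]

theorem SU.comulHom_α (t : SU q φ ⊗[ℂ] SU q φ) :
    SU.comulHom q φ hq.ne' (SU.α q φ) t = SU.comulOp q φ .α t := by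
  rw [SU.comulHom, SU.α, SU.lift_gen]
theorem SU.comulHom_αs (t : SU q φ ⊗[ℂ] SU q φ) :
    SU.comulHom q φ hq.ne' (SU.αs q φ) t = SU.comulOp q φ .αs t := by
  rw [SU.comulHom, SU.αs, SU.lift_gen]
theorem SU.comulHom_γ (t : SU q φ ⊗[ℂ] SU q φ) :
    SU.comulHom q φ hq.ne' (SU.γ q φ) t = SU.comulOp q φ .γ t := by
  rw [SU.comulHom, SU.γ, SU.lift_gen]
theorem SU.comulHom_γs (t : SU q φ ⊗[ℂ] SU q φ) :
    SU.comulHom q φ hq.ne' (SU.γs q φ) t = SU.comulOp q φ .γs t := by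
  rw [SU.comulHom, SU.γs, SU.lift_gen]

/-- The left action touches only the second leg of Δa; the first leg merely receives the phase of x
moving past it. -/
theorem SU.comul_actOp (x : UGen) (a : SU q φ) :
    SU.comul q φ hq.ne' (SU.actOp q φ hq x a) = TensorProduct.map
      (phaseTwist φ (SU.grading q φ) (U.δ x)) (SU.actOp q φ hq x) (SU.comul q φ hq.ne' a) := by
  have hw := ph_ne_zero φ 2
  have hs := ofReal_sqrt_ne_zero hq
  refine SU.induction q φ (fun a => ∀ x : UGen, SU.comul q φ hq.ne' (SU.actOp q φ hq x a) =
      TensorProduct.map (phaseTwist φ (SU.grading q φ) (U.δ x)) (SU.actOp q φ hq x)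
        (SU.comul q φ hq.ne' a)) ?_ (fun a b ha hb x => by simp only [map_add, ha, hb])
    (fun r a ha x => by simp only [map_smul, ha]) (fun y a ih x => ?_) a x
  · intro x
    simp [SU.comul_one, SU.actOp_one, phaseTwist_one, Algebra.algebraMap_eq_smul_one]
  · cases x <;>
    · rw [SU.actOp_gen_mul]
      simp only [SU.leftActOp_e, SU.leftActOp_f, SU.leftActOp_k, SU.leftActOp_ks,
        SU.leftActOp_ki, SU.leftActOp_ksi, map_add, map_smul, SU.comul_mul_eq q φ hq, ih]
      -- After the induction hypothesis both sides are linear in Δa, and the identity holds on every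
      -- u ⊗ v, so nothing further about a is needed.
      generalize SU.comul q φ hq.ne' a = t
      induction t using TensorProduct.induction_on with
      | zero => simp only [map_zero, smul_zero, add_zero]
      | add s t hs ht => simp only [map_add, ← hs, ← ht, smul_add]; try abel
      | tmul u v =>
        cases y <;>
        · simp only [SU.gen_α, SU.gen_αs, SU.gen_γ, SU.gen_γs, leftActGen, map_smul,
            LinearMap.smul_apply, map_zero, LinearMap.zero_apply, SU.comulHom_α q φ hq,
            SU.comulHom_αs q φ hq, SU.comulHom_γ q φ hq, SU.comulHom_γs q φ hq, SU.comulOp_α, SU.comulOp_αs, SU.comulOp_γ,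
            SU.comulOp_γs, TensorProduct.map_tmul, map_add, map_sub, SU.twist_α, SU.twist_αs,
            SU.twist_γ, SU.twist_γs, SU.twist_twist, SU.actOp_α, SU.actOp_αs, SU.actOp_γ,
            SU.actOp_γs, SU.leftActOp_e, SU.leftActOp_f, SU.leftActOp_k, SU.leftActOp_ks,
            SU.leftActOp_ki, SU.leftActOp_ksi, smul_mul_assoc, mul_smul_comm, zero_mul,
            TensorProduct.tmul_smul, ← TensorProduct.smul_tmul', TensorProduct.tmul_add,
            TensorProduct.tmul_zero, smul_zero, zero_add, add_zero, sub_zero, zero_sub,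
            U.δ, U.μ, U.ν, SU.δ, SU.μ, SU.ν, Int.reduceMul, Int.reduceNeg,
            Int.reduceAdd, Int.reduceSub, SU.twist_zero, ph_neg, ph_eight_eq_pow, ph_four, ph_zero,
            ofReal_eq_sqrt_sq hq]
          match_scalars <;> field_simp

/-- Composing covariance for generators gives it for words: twists of the first leg accumulate
exactly as Ξ prescribes for a product in H. -/
theorem comul_actHom (h : U q φ) (a : SU q φ) :
    SU.comul q φ hq.ne' (actHom q φ hq hq1 h a) = (act q φ hq hq1).lTensor (SU q φ)
      (braidFst (mutualBraiding q φ) (h ⊗ₜ SU.comul q φ hq.ne' a)) := by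
  refine U.induction q φ (fun h => ∀ a, SU.comul q φ hq.ne' (actHom q φ hq hq1 h a) =
      (act q φ hq hq1).lTensor (SU q φ)
      (braidFst (mutualBraiding q φ) (h ⊗ₜ SU.comul q φ hq.ne' a))) ?_
    (fun x y hx hy a => by
      simp only [map_add, LinearMap.add_apply, TensorProduct.add_tmul, hx, hy])
    (fun r x hx a => by
        simp only [map_smul, LinearMap.smul_apply, ← TensorProduct.smul_tmul', hx])
    (fun x h ih a => ?_) h a
  · intro a
    rw [map_one, Module.End.one_apply]
    generalize SU.comul q φ hq.ne' a = t
    induction t using TensorProduct.induction_on with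
    | zero => simp
    | add s t hs ht => simp only [TensorProduct.tmul_add, map_add, ← hs, ← ht]
    | tmul a b =>
      have e1 := (isAlgebraBraiding_phaseBraiding φ (U.spannedByHomogeneous q φ hq)
        (SU.spannedByHomogeneous q φ hq)).one_left a
      change mutualBraiding q φ (1 ⊗ₜ a) = _ at e1
      simp [e1, act_tmul]
  · rw [map_mul, Module.End.mul_apply, actHom_gen, SU.comul_actOp, ih]
    generalize SU.comul q φ hq.ne' a = t
    refine (SU.spannedByHomogeneous q φ hq).induction_tmul (SU.spannedByHomogeneous q φ hq) (by simp)
      (fun s t hs ht => by simp only [TensorProduct.tmul_add, map_add, ← hs, ← ht])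
      (fun m n a b ha hb => ?_) t
    have e1 : ∀ (x : U q φ), mutualBraiding q φ (x ⊗ₜ a) =
        a ⊗ₜ phaseTwist φ (U.grading q φ) m x := fun x =>
      phaseBraiding_of_single_right φ (U.spannedByHomogeneous q φ hq) m x a ha
    simp [e1, act_tmul, U.twist_gen_mul, actHom_gen, phaseTwist_of_single φ _ _ _ _ ha,
      TensorProduct.tmul_smul, ← TensorProduct.smul_tmul', mul_right_comm]

/-- The pairing of `U_{q,φ}(û(2))` and `SU_{q,φ}(2)`. -/
def pairing : U q φ ⊗[ℂ] SU q φ →ₗ[ℂ] ℂ := (SU.counit q φ).toLinearMap ∘ₗ act q φ hq hq1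

theorem pairing_tmul (h : U q φ) (a : SU q φ) :
    pairing q φ hq hq1 (h ⊗ₜ a) = SU.counit q φ (actHom q φ hq hq1 h a) := rfl

/-- Apply id ⊗ ε to covariance: the left side becomes h ▷ a by the counit law, and ε ∘ ▷ is the
pairing by definition. -/
theorem leftAct_pairing : leftAct (SU.comul q φ hq.ne') (mutualBraiding q φ)
    (pairing q φ hq hq1) = act q φ hq hq1 := by
  refine TensorProduct.ext' fun h a => ?_
  have h1 := (SU.hopfGenerators q φ hq.ne').comul_counit (actHom q φ hq hq1 h a)
  rw [comul_actHom, ← LinearMap.comp_apply, ← LinearMap.lTensor_comp] at h1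
  have h2 := congrArg (TensorProduct.rid ℂ (SU q φ)) h1
  rw [TensorProduct.rid_tmul, one_smul] at h2
  exact h2

theorem pairing_gen (x : UGen) (y : SUGen) :
    pairing q φ hq hq1 (U.gen q φ x ⊗ₜ SU.gen q φ y) = pairingGen q φ x y := by
  rw [pairing_tmul, actHom_gen, SU.actOp_gen]
  cases x <;> cases y <;>
    simp [leftActGen, pairingGen, SU.α, SU.αs, SU.γ, SU.γs, SU.counit_gen]

/-- Both ingredients of ε(h ▷ a) respect degree, so a simultaneous twist is invisible. This replaces
any statement about which degrees pair nontrivially. -/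
theorem pairing_twist (k : ℤ) (h : U q φ) (a : SU q φ) :
    pairing q φ hq hq1 (phaseTwist φ (U.grading q φ) k h ⊗ₜ
      phaseTwist φ (SU.grading q φ) k a) = pairing q φ hq hq1 (h ⊗ₜ a) := by
  rw [pairing_tmul, ← twist_actHom, (SU.hopfGenerators q φ hq.ne').counit_twist, pairing_tmul]

/-- Since ▷ is an action, ⟨hg, a⟩ = ⟨h, g ▷ a⟩; expanding g ▷ a through the pairing gives the
formula. -/
theorem pairing_mul_left (h g : U q φ) (a : SU q φ) :
    pairing q φ hq hq1 ((h * g) ⊗ₜ a) = LinearMap.mul' ℂ ℂ (TensorProduct.map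
      (pairing q φ hq hq1) (pairing q φ hq hq1)
      (braidMid (mutualBraiding q φ) ((h ⊗ₜ g) ⊗ₜ SU.comul q φ hq.ne' a))) := by
  have e := congrArg (fun F => F (g ⊗ₜ a)) (leftAct_pairing q φ hq hq1)
  simp only [act_tmul, leftAct, LinearMap.comp_apply, LinearMap.lTensor_tmul] at e
  rw [pairing_tmul, map_mul, Module.End.mul_apply, ← pairing_tmul, ← e]
  generalize SU.comul q φ hq.ne' a = t
  refine (SU.spannedByHomogeneous q φ hq).induction_tmul (SU.spannedByHomogeneous q φ hq) (by simp)
    (fun s t hs ht => by simp only [TensorProduct.tmul_add, map_add, ← hs, ← ht])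
    (fun m n a b ha hb => ?_) t
  have e1 : ∀ (x : U q φ), mutualBraiding q φ (x ⊗ₜ a) =
      a ⊗ₜ phaseTwist φ (U.grading q φ) m x := fun x =>
    phaseBraiding_of_single_right φ (U.spannedByHomogeneous q φ hq) m x a ha
  simp [e1, mul_comm]

/-- Apply the multiplicative functional ε to the module algebra property. -/
theorem pairing_mul_right (h : U q φ) (a b : SU q φ) :
    pairing q φ hq hq1 (h ⊗ₜ (a * b)) = LinearMap.mul' ℂ ℂ (TensorProduct.map
      (pairing q φ hq hq1) (pairing q φ hq hq1)
      (braidMid (mutualBraiding q φ) (U.comul q φ hq.ne' h ⊗ₜ (a ⊗ₜ b)))) := by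
  rw [pairing_tmul, actHom_mul]
  generalize braidMid (mutualBraiding q φ) (U.comul q φ hq.ne' h ⊗ₜ (a ⊗ₜ b)) = t
  induction t using TensorProduct.induction_on with
  | zero => simp
  | add s t hs ht => simp only [map_add, hs, ht]
  | tmul x y => simp [pairing]

/-- The homogeneous element that passes through twists both arguments of the pairing by the same
integer, and such a twist is invisible. -/
theorem pairingIsBraidInvariant_pairing : PairingIsBraidInvariant (U.braiding q φ)
    (SU.braiding q φ) (mutualBraiding q φ) (pairing q φ hq hq1) where
  right h a b := by
    refine (SU.spannedByHomogeneous q φ hq).induction (by simp)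
      (fun x y hx hy => by simp only [TensorProduct.tmul_add, map_add, hx, hy,
        TensorProduct.add_tmul]) (fun n b hb => ?_) b
    simp [mutualBraiding, SU.braiding, pairing_twist,
      phaseBraiding_of_single_right φ (U.spannedByHomogeneous q φ hq) n _ b hb,
      phaseBraiding_of_single_right φ (SU.spannedByHomogeneous q φ hq) n _ b hb]
  left g h a := by
    refine (U.spannedByHomogeneous q φ hq).induction (by simp)
      (fun x y hx hy => by simp only [TensorProduct.tmul_add, map_add, hx, hy,
        TensorProduct.add_tmul]) (fun n g hg => ?_) g
    simp [mutualBraiding, U.braiding, pairing_twist, phaseBraiding_of_single φ _ _ n g _ hg]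

end Covariance

/-! ### Uniqueness of the pairing and its compatibility with the antipodes. -/

section Pairing

variable (q φ : ℝ) (hq : 0 < q) (hq1 : q < 1)

theorem mutualBraiding_U_gen (a : SU q φ) :
    mutualBraiding q φ (U.e q φ ⊗ₜ a) = phaseTwist φ (SU.grading q φ) (-2) a ⊗ₜ U.e q φ ∧
    mutualBraiding q φ (U.f q φ ⊗ₜ a) = phaseTwist φ (SU.grading q φ) 2 a ⊗ₜ U.f q φ ∧
    mutualBraiding q φ (U.k q φ ⊗ₜ a) = a ⊗ₜ U.k q φ ∧
    mutualBraiding q φ (U.ks q φ ⊗ₜ a) = a ⊗ₜ U.ks q φ ∧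
    mutualBraiding q φ (U.ki q φ ⊗ₜ a) = a ⊗ₜ U.ki q φ ∧
    mutualBraiding q φ (U.ksi q φ ⊗ₜ a) = a ⊗ₜ U.ksi q φ := by
  refine ⟨?_, ?_, ?_, ?_, ?_, ?_⟩ <;>
    simp [U.e, U.f, U.k, U.ks, U.ki, U.ksi, mutualBraiding_gen, U.δ, U.μ, U.ν, SU.twist_zero]

/-- The value `⟨x, a b⟩` for a generator `x`, in terms of the functionals `⟨y, ·⟩` for
generators `y`. -/
def pairingGenMul (F : UGen → SU q φ →ₗ[ℂ] ℂ) (a b : SU q φ) : UGen → ℂ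
  | .e => F .e a * F .k b + F .ki (phaseTwist φ (SU.grading q φ) (-2) a) * F .e b
  | .f => F .f a * F .ks b + F .ksi (phaseTwist φ (SU.grading q φ) 2 a) * F .f b
  | .k => F .k a * F .k b
  | .ks => F .ks a * F .ks b
  | .ki => F .ki a * F .ki b
  | .ksi => F .ksi a * F .ksi b

theorem pairing_comulGen (p : U q φ ⊗[ℂ] SU q φ →ₗ[ℂ] ℂ) (x : UGen) (a b : SU q φ) :
    LinearMap.mul' ℂ ℂ (TensorProduct.map p p
      (braidMid (mutualBraiding q φ) (U.comulGen q φ x ⊗ₜ (a ⊗ₜ b)))) =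
    pairingGenMul q φ (fun x => p ∘ₗ TensorProduct.mk ℂ _ _ (U.gen q φ x)) a b x := by
  obtain ⟨h1, h2, h3, h4, h5, h6⟩ := mutualBraiding_U_gen q φ a
  cases x <;>
  simp only [U.comulGen, TensorProduct.add_tmul, map_add, braidMid_tmul, h1, h2, h3, h4, h5, h6,
    TensorProduct.assoc_tmul, TensorProduct.assoc_symm_tmul, TensorProduct.map_tmul,
    LinearMap.mul'_apply] <;> rfl

/-- The product rule in A determines ⟨x, ·⟩ for every generator x of H from its values on
generators; the product rule in H then determines everything. -/
theorem isBraidedPairing_unique (p p' : U q φ ⊗[ℂ] SU q φ →ₗ[ℂ] ℂ)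
    (h : IsBraidedPairing (U.comul q φ hq.ne') (U.counit q φ).toLinearMap (U.antipode q φ hq.ne')
        (SU.comul q φ hq.ne') (SU.counit q φ).toLinearMap (SU.antipode q φ hq.ne')
        (mutualBraiding q φ) p)
    (h' : IsBraidedPairing (U.comul q φ hq.ne') (U.counit q φ).toLinearMap
        (U.antipode q φ hq.ne') (SU.comul q φ hq.ne') (SU.counit q φ).toLinearMap
        (SU.antipode q φ hq.ne') (mutualBraiding q φ) p')
    (hg : ∀ x y, p' (U.gen q φ x ⊗ₜ SU.gen q φ y) = p (U.gen q φ x ⊗ₜ SU.gen q φ y)) :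
    p' = p := by
  have hgen : ∀ (a : SU q φ) (x : UGen), p' (U.gen q φ x ⊗ₜ a) = p (U.gen q φ x ⊗ₜ a) := by
    intro a
    refine SU.induction q φ (fun a => ∀ x : UGen,
      p' (U.gen q φ x ⊗ₜ a) = p (U.gen q φ x ⊗ₜ a)) ?_
      (fun a b ha hb x => by simp only [TensorProduct.tmul_add, map_add, ha, hb])
      (fun r a ha x => by simp only [TensorProduct.tmul_smul, map_smul, ha])
      (fun y a ih x => ?_) a
    · intro x; rw [h.pair_one, h'.pair_one]
    · rw [h.pair_mul, h'.pair_mul, U.comul_gen, pairing_comulGen, pairing_comulGen]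
      cases x <;> simp [pairingGenMul, ih, hg, SU.twist_gen]
  -- The rule for ⟨xg, a⟩ twists g by the degree of the first leg of Δa, so the induction has to
  -- carry all twists of g.
  have hall : ∀ (g : U q φ) (n : ℤ) (a : SU q φ), p' (phaseTwist φ (U.grading q φ) n g ⊗ₜ a) =
      p (phaseTwist φ (U.grading q φ) n g ⊗ₜ a) := by
    intro g
    refine U.induction q φ (fun g => ∀ (n : ℤ) (a : SU q φ),
      p' (phaseTwist φ (U.grading q φ) n g ⊗ₜ a) = p (phaseTwist φ (U.grading q φ) n g ⊗ₜ a)) ?_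
      (fun g g' hg hg' n a => by simp only [TensorProduct.add_tmul, map_add, hg, hg'])
      (fun r g hg n a => by simp only [← TensorProduct.smul_tmul', map_smul, hg])
      (fun x g ih n a => ?_) g
    · intro n a; rw [phaseTwist_one, h.one_pair, h'.one_pair]
    · rw [U.twist_gen_mul, ← TensorProduct.smul_tmul', map_smul, map_smul, h.mul_pair,
        h'.mul_pair]
      congr 2
      refine (SU.spannedByHomogeneous q φ hq).induction_tmul (SU.spannedByHomogeneous q φ hq)
        (P := fun t => TensorProduct.map p' p' (braidMid (mutualBraiding q φ)
          ((U.gen q φ x ⊗ₜ phaseTwist φ (U.grading q φ) n g) ⊗ₜ t)) = TensorProduct.map p p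
          (braidMid (mutualBraiding q φ)
          ((U.gen q φ x ⊗ₜ phaseTwist φ (U.grading q φ) n g) ⊗ₜ t))) (by simp)
        (fun s t hs ht => by simp only [TensorProduct.tmul_add, map_add, hs, ht])
        (fun k l u v hu hv => ?_) _
      have e1 := phaseBraiding_of_single_right φ (U.spannedByHomogeneous q φ hq) k
        (phaseTwist φ (U.grading q φ) n g) u hu
      change mutualBraiding q φ _ = _ at e1
      simp [e1, hgen, U.twist_twist, ih]
  refine TensorProduct.ext' fun g a => ?_
  simpa [U.twist_zero] using hall g 0 a

/-- The map (S ⊗ S)Ψ reverses braided products. This is checked for a single simple tensor c ⊗ d;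
only its total degree governs the twist of the other factor, which is why y enters just through its
degree. -/
theorem SU.comul_antipode_gen_mul (c d y : SUGen) (hy : SU.δ c + SU.δ d = SU.δ y)
    (t : SU q φ ⊗[ℂ] SU q φ) :
    TensorProduct.map (SU.antipode q φ hq.ne') (SU.antipode q φ hq.ne') (SU.braiding q φ
      (braidedMul (SU.braiding q φ) ((SU.gen q φ c ⊗ₜ SU.gen q φ d) ⊗ₜ t))) =
    braidedMul (SU.braiding q φ) (TensorProduct.map (phaseTwist φ (SU.grading q φ) (SU.δ y))
      (phaseTwist φ (SU.grading q φ) (SU.δ y)) (TensorProduct.map (SU.antipode q φ hq.ne')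
        (SU.antipode q φ hq.ne') (SU.braiding q φ t)) ⊗ₜ
      TensorProduct.map (SU.antipode q φ hq.ne') (SU.antipode q φ hq.ne')
        (SU.braiding q φ (SU.gen q φ c ⊗ₜ SU.gen q φ d))) := by
  have hS := SU.spannedByHomogeneous q φ hq
  have hH := SU.hopfGenerators q φ hq.ne'
  refine hS.induction_tmul hS (by simp)
    (fun s t hs ht => by
      simp only [TensorProduct.tmul_add, TensorProduct.add_tmul, map_add, hs, ht])
    (fun m n u v hu hv => ?_) t
  have hcu : SU.grading q φ (SU.gen q φ c * u) =
      AddMonoidAlgebra.single (SU.δ c + m) (SU.gen q φ c * u) := by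
    rw [map_mul, hu, SU.grading_gen, AddMonoidAlgebra.single_mul_single]
  have hdv : SU.grading q φ (SU.gen q φ d * v) =
      AddMonoidAlgebra.single (SU.δ d + n) (SU.gen q φ d * v) := by
    rw [map_mul, hv, SU.grading_gen, AddMonoidAlgebra.single_mul_single]
  have hTS : ∀ (k l : ℤ) (w : SU q φ), SU.grading q φ w = AddMonoidAlgebra.single l w →
      phaseTwist φ (SU.grading q φ) k (SU.antipode q φ hq.ne' w) =
        ph φ (2 * k * l) • SU.antipode q φ hq.ne' w := by
    intro k l w hw
    rw [← hH.antipode_twist, phaseTwist_of_single φ _ _ _ _ hw, map_smul]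
  have hSd : SU.grading q φ (SU.antipode q φ hq.ne' (SU.gen q φ d)) =
      AddMonoidAlgebra.single (SU.δ d) (SU.antipode q φ hq.ne' (SU.gen q φ d)) := by
    rw [SU.antipode_gen]
    cases d <;> simp only [SU.antipodeGen, SU.α, SU.αs, SU.γ, SU.γs, map_smul, SU.grading_gen,
      AddMonoidAlgebra.smul_single] <;> rfl
  rw [SU.braiding, phaseBraiding_homogeneous φ _ _ _ _ _ _ hu hv,
    phaseBraiding_homogeneous φ _ _ _ _ _ _ (SU.grading_gen q φ c) (SU.grading_gen q φ d),
    braidedMul_tmul φ hS m _ _ _ _ hu, phaseTwist_of_single φ _ _ _ _ (SU.grading_gen q φ d),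
    smul_mul_assoc, TensorProduct.tmul_smul, map_smul,
    phaseBraiding_homogeneous φ _ _ _ _ _ _ hcu hdv]
  simp only [map_smul, TensorProduct.map_tmul, ← TensorProduct.smul_tmul',
    TensorProduct.tmul_smul, hTS _ _ _ hu, hTS _ _ _ hv, braidedMul_tmul φ hS _ _ _ _ _ hSd,
    hH.antipode_gen_mul, smul_smul, smul_mul_assoc, ← ph_add, ← hy]
  ring_nf

/-- Both sides reverse products up to the same twist, so the identity follows from its validity on
generators. -/
theorem SU.comul_antipode (a : SU q φ) :
    SU.comul q φ hq.ne' (SU.antipode q φ hq.ne' a) =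
      TensorProduct.map (SU.antipode q φ hq.ne') (SU.antipode q φ hq.ne')
        (SU.braiding q φ (SU.comul q φ hq.ne' a)) := by
  have hH := SU.hopfGenerators q φ hq.ne'
  refine SU.induction q φ (fun a => SU.comul q φ hq.ne' (SU.antipode q φ hq.ne' a) =
      TensorProduct.map (SU.antipode q φ hq.ne') (SU.antipode q φ hq.ne')
        (SU.braiding q φ (SU.comul q φ hq.ne' a))) ?_
    (fun a b ha hb => by simp only [map_add, ha, hb])
    (fun r a ha => by simp only [map_smul, ha]) (fun y a ih => ?_) a
  · have e := (isAlgebraBraiding_phaseBraiding φ (SU.spannedByHomogeneous q φ hq)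
      (SU.spannedByHomogeneous q φ hq)).one_left 1
    rw [hH.antipode_one, hH.comul_one, SU.braiding, e, TensorProduct.map_tmul, hH.antipode_one]
  · have hgen : SU.comul q φ hq.ne' (SU.antipode q φ hq.ne' (SU.gen q φ y)) =
        TensorProduct.map (SU.antipode q φ hq.ne') (SU.antipode q φ hq.ne')
          (SU.braiding q φ (SU.comulGen q φ y)) := by
      have hq' : (q : ℂ) ≠ 0 := by exact_mod_cast hq.ne'
      have hw := ph_ne_zero φ 4
      have c1 := SU.comul_gen q φ hq.ne' .α
      have c2 := SU.comul_gen q φ hq.ne' .αs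
      have c3 := SU.comul_gen q φ hq.ne' .γ
      have c4 := SU.comul_gen q φ hq.ne' .γs
      have s1 := SU.antipode_gen q φ hq.ne' .α
      have s2 := SU.antipode_gen q φ hq.ne' .αs
      have s3 := SU.antipode_gen q φ hq.ne' .γ
      have s4 := SU.antipode_gen q φ hq.ne' .γs
      rw [SU.antipode_gen]
      simp only [SU.antipodeGen, SU.comulGen, SU.α, SU.αs, SU.γ, SU.γs] at c1 c2 c3 c4 s1 s2 s3 s4
      cases y <;>
      · simp only [SU.antipodeGen, SU.comulGen, SU.α, SU.αs, SU.γ, SU.γs, map_add, map_sub,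
          map_smul, SU.braiding_gen, SU.twist_gen, TensorProduct.map_tmul, c1, c2, c3, c4, s1, s2,
          s3, s4, TensorProduct.tmul_smul, ← TensorProduct.smul_tmul', SU.δ, SU.μ, SU.ν,
          Int.reduceMul, Int.reduceNeg, Int.reduceSub, ph_neg, ph_eight, ph_zero]
        match_scalars <;> field_simp
    rw [hH.antipode_gen_mul, hH.comul_mul, hH.comul_twist, ih, hgen, SU.comul_gen_mul]
    -- These eight instances are the summands of Δ on the four generators, two for each, all having
    -- the degree of the generator they come from.
    have k1 := SU.comul_antipode_gen_mul q φ hq .α .α .α (by decide)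
      (SU.comul q φ hq.ne' a)
    have k2 := SU.comul_antipode_gen_mul q φ hq .γs .γ .α (by decide)
      (SU.comul q φ hq.ne' a)
    have k3 := SU.comul_antipode_gen_mul q φ hq .αs .αs .αs (by decide)
      (SU.comul q φ hq.ne' a)
    have k4 := SU.comul_antipode_gen_mul q φ hq .γ .γs .αs (by decide)
      (SU.comul q φ hq.ne' a)
    have k5 := SU.comul_antipode_gen_mul q φ hq .γ .α .γ (by decide)
      (SU.comul q φ hq.ne' a)
    have k6 := SU.comul_antipode_gen_mul q φ hq .αs .γ .γ (by decide)
      (SU.comul q φ hq.ne' a)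
    have k7 := SU.comul_antipode_gen_mul q φ hq .γs .αs .γs (by decide)
      (SU.comul q φ hq.ne' a)
    have k8 := SU.comul_antipode_gen_mul q φ hq .α .γs .γs (by decide)
      (SU.comul q φ hq.ne' a)
    change braidedMul (SU.braiding q φ) _ = _
    cases y <;> simp only [SU.comulGen, SU.α, SU.αs, SU.γ, SU.γs, map_add, map_sub, map_smul,
      TensorProduct.add_tmul, TensorProduct.sub_tmul, ← TensorProduct.smul_tmul',
      TensorProduct.tmul_add, TensorProduct.tmul_sub, TensorProduct.tmul_smul,
      k1, k2, k3, k4, k5, k6, k7, k8]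

theorem pairing_gen_mul (x : UGen) (a b : SU q φ) :
    pairing q φ hq hq1 (U.gen q φ x ⊗ₜ (a * b)) = pairingGenMul q φ
      (fun x => pairing q φ hq hq1 ∘ₗ TensorProduct.mk ℂ _ _ (U.gen q φ x)) a b x := by
  rw [pairing_mul_right, U.comul_gen, pairing_comulGen]

/-- By invariance under simultaneous twists, a twist of a alone costs the inverse of the phase that
x would acquire. -/
theorem pairing_gen_twist (k : ℤ) (x : UGen) (a : SU q φ) :
    pairing q φ hq hq1 (U.gen q φ x ⊗ₜ phaseTwist φ (SU.grading q φ) k a) =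
      ph φ (-(2 * k * U.δ x)) * pairing q φ hq hq1 (U.gen q φ x ⊗ₜ a) := by
  rw [← pairing_twist q φ hq hq1 k _ a, U.twist_gen, ← TensorProduct.smul_tmul', map_smul,
    smul_eq_mul, ← mul_assoc, mul_comm (ph φ _), ph_mul_ph_neg, one_mul]

/-- S(x) is again a multiple of a generator, so both sides obey an explicit product rule in a.
Induction on a for all x at once leaves one scalar identity per pair of generators. -/
theorem pairing_antipode_gen (x : UGen) (a : SU q φ) :
    pairing q φ hq hq1 (U.antipode q φ hq.ne' (U.gen q φ x) ⊗ₜ a) =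
      pairing q φ hq hq1 (U.gen q φ x ⊗ₜ SU.antipode q φ hq.ne' a) := by
  have hq' : (q : ℂ) ≠ 0 := by exact_mod_cast hq.ne'
  have hw := ph_ne_zero φ 2
  have hs := ofReal_sqrt_ne_zero hq
  have hH := SU.hopfGenerators q φ hq.ne'
  refine SU.induction q φ (fun a => ∀ x,
    pairing q φ hq hq1 (U.antipode q φ hq.ne' (U.gen q φ x) ⊗ₜ a) =
      pairing q φ hq hq1 (U.gen q φ x ⊗ₜ SU.antipode q φ hq.ne' a)) ?_
    (fun a b ha hb x => by simp only [map_add, TensorProduct.tmul_add, ha, hb])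
    (fun r a ha x => by simp only [map_smul, TensorProduct.tmul_smul, ha])
    (fun y a ih x => ?_) a x
  · intro x
    rw [hH.antipode_one, U.antipode_gen, pairing_tmul, actHom_one_right, pairing_tmul,
      actHom_one_right]
    cases x <;> simp [U.antipodeGen, U.e, U.f, U.k, U.ks, U.ki, U.ksi, U.counit_gen]
  · rw [hH.antipode_gen_mul, pairing_gen_mul, U.antipode_gen]
    have i1 := (ih .e).symm
    have i2 := (ih .f).symm
    have i3 := (ih .k).symm
    have i4 := (ih .ks).symm
    have i5 := (ih .ki).symm
    have i6 := (ih .ksi).symm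
    simp only [U.antipode_gen, U.antipodeGen, U.e, U.f, U.k, U.ks, U.ki, U.ksi,
      ← TensorProduct.smul_tmul', map_smul] at i1 i2 i3 i4 i5 i6
    cases x <;> cases y <;>
    · simp only [U.antipodeGen, U.e, U.f, U.k, U.ks, U.ki, U.ksi, ← TensorProduct.smul_tmul',
        map_smul, pairing_gen_mul, pairingGenMul, LinearMap.comp_apply, TensorProduct.mk_apply,
        pairing_gen_twist, i1, i2, i3, i4, i5, i6, SU.antipode_gen, SU.antipodeGen, SU.α, SU.αs,
        SU.γ, SU.γs, pairing_gen, pairingGen, TensorProduct.tmul_smul, smul_eq_mul, U.δ, U.μ, U.ν,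
        SU.δ, SU.μ, SU.ν, Int.reduceMul, Int.reduceNeg, Int.reduceSub, mul_zero, zero_mul,
        add_zero, zero_add, ph_neg, ph_eight_eq_pow, ph_four, ph_zero, inv_one, one_mul, mul_one,
        ofReal_eq_sqrt_sq hq]
      try field_simp

/-- S reverses products in H and coproducts in A, each up to a braiding; under the pairing the two
reversals correspond. -/
theorem pairing_antipode (h : U q φ) (a : SU q φ) :
    pairing q φ hq hq1 (U.antipode q φ hq.ne' h ⊗ₜ a) =
      pairing q φ hq hq1 (h ⊗ₜ SU.antipode q φ hq.ne' a) := by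
  have hS := SU.hopfGenerators q φ hq.ne'
  have hU := U.hopfGenerators q φ hq.ne'
  refine U.induction q φ (fun h => ∀ a, pairing q φ hq hq1 (U.antipode q φ hq.ne' h ⊗ₜ a) =
      pairing q φ hq hq1 (h ⊗ₜ SU.antipode q φ hq.ne' a)) ?_
    (fun a b ha hb x => by simp only [map_add, TensorProduct.add_tmul, ha, hb])
    (fun r a ha x => by simp only [map_smul, ← TensorProduct.smul_tmul', ha])
    (fun x h ih a => ?_) h a
  · intro a
    rw [hU.antipode_one, pairing_tmul, pairing_tmul, map_one, Module.End.one_apply,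
      Module.End.one_apply]
    -- For h = 1 the claim is ε ∘ S = ε on A.
    refine SU.induction q φ (fun a => SU.counit q φ a =
      SU.counit q φ (SU.antipode q φ hq.ne' a)) (by rw [hS.antipode_one])
      (fun a b ha hb => by simp only [map_add, ha, hb])
      (fun r a ha => by simp only [map_smul, ha]) (fun y a ih => ?_) a
    rw [hS.antipode_gen_mul, map_mul, map_mul, hS.counit_twist, ← ih, SU.antipode_gen, mul_comm]
    cases y <;> simp [SU.antipodeGen, SU.α, SU.αs, SU.γ, SU.γs, SU.counit_gen]
  · rw [hU.antipode_gen_mul, pairing_mul_left, pairing_mul_left, SU.comul_antipode q φ hq]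
    generalize SU.comul q φ hq.ne' a = t
    refine hS.spannedByHomogeneous.induction_tmul hS.spannedByHomogeneous (by simp)
      (fun s t hs ht => by simp only [TensorProduct.tmul_add, map_add, hs, ht])
      (fun m n u v hu hv => ?_) t
    have hu' : phaseTwist φ (SU.grading q φ) (U.δ x) u = ph φ (2 * m * U.δ x) • u := by
      rw [phaseTwist_of_single φ _ _ _ _ hu, mul_right_comm]
    have e1 := phaseBraiding_of_single_right φ hU.spannedByHomogeneous m
      (U.antipode q φ hq.ne' (U.gen q φ x)) u hu
    change mutualBraiding q φ _ = _ at e1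
    have key : ∀ w : SU q φ, SU.grading q φ w = AddMonoidAlgebra.single n w →
        mutualBraiding q φ (h ⊗ₜ SU.antipode q φ hq.ne' w) =
          SU.antipode q φ hq.ne' w ⊗ₜ phaseTwist φ (U.grading q φ) n h := by
      intro w hw
      refine hU.spannedByHomogeneous.induction (by simp)
        (fun x y hx hy => by
          simp only [TensorProduct.add_tmul, TensorProduct.tmul_add, map_add, hx, hy])
        (fun l h hh => ?_) h
      rw [mutualBraiding, phaseBraiding_of_single φ _ _ _ _ _ hh, ← hS.antipode_twist,
        phaseTwist_of_single φ _ _ _ _ hw, phaseTwist_of_single φ _ _ _ _ hh, map_smul,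
        TensorProduct.tmul_smul, TensorProduct.smul_tmul', mul_right_comm]
    -- The two invariances absorb all phases: one side becomes ⟨Sh, u⟩⟨Sx, v⟩ and the other ⟨h,
    -- Su⟩⟨x, Sv⟩.
    have e2 := pairing_twist q φ hq hq1 (U.δ x) (U.antipode q φ hq.ne' h) u
    rw [hu', TensorProduct.tmul_smul, map_smul] at e2
    have e3 := pairing_twist q φ hq hq1 n h (SU.antipode q φ hq.ne' u)
    rw [← hS.antipode_twist, phaseTwist_of_single φ _ _ _ _ hu, map_smul,
      TensorProduct.tmul_smul, map_smul] at e3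
    rw [SU.braiding, phaseBraiding_homogeneous φ _ _ _ _ _ _ hu hv]
    simp only [map_smul, TensorProduct.map_tmul, TensorProduct.tmul_smul, braidMid_tmul, e1,
      key v hv, TensorProduct.assoc_tmul, TensorProduct.assoc_symm_tmul, LinearMap.mul'_apply,
      hU.antipode_twist_gen, pairing_antipode_gen, smul_eq_mul, ← TensorProduct.smul_tmul',
      hv] at e2 e3 ⊢
    rw [mul_right_comm 2 m n, mul_left_comm (ph φ (2 * n * m)), e3, ← ih, ← e2]
    ring

end Pairing

/-! ### The right braided action. -/

section RightAction

variable (q φ : ℝ) (hq : 0 < q) (hq1 : q < 1)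

/-- The map `u ⊗ v ⊗ h ↦ (⟨·,·⟩ ⊗ id)(u ⊗ Ξ'(v ⊗ h))`. -/
def rightContract : (SU q φ ⊗[ℂ] SU q φ) ⊗[ℂ] U q φ →ₗ[ℂ] SU q φ :=
  (TensorProduct.lid ℂ (SU q φ)).toLinearMap ∘ₗ
    (pairing q φ hq hq1 ∘ₗ (TensorProduct.comm ℂ (SU q φ) (U q φ)).toLinearMap).rTensor (SU q φ) ∘ₗ
      braidSnd (mutualBraidingRev q φ)

theorem rightAct_tmul (a : SU q φ) (h : U q φ) :
    rightAct (SU.comul q φ hq.ne') (mutualBraidingRev q φ) (pairing q φ hq hq1) (a ⊗ₜ h) =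
      rightContract q φ hq hq1 (SU.comul q φ hq.ne' a ⊗ₜ h) := rfl

theorem rightContract_of_single (n : ℤ) (u v : SU q φ) (h : U q φ)
    (hv : SU.grading q φ v = AddMonoidAlgebra.single n v) :
    rightContract q φ hq hq1 ((u ⊗ₜ v) ⊗ₜ h) =
      pairing q φ hq hq1 (phaseTwist φ (U.grading q φ) n h ⊗ₜ u) • v := by
  simp [rightContract, mutualBraidingRev, phaseBraiding_of_single φ _ _ n v h hv]

theorem rightContract_of_single_right (m : ℤ) (u v : SU q φ) (h : U q φ)
    (hh : U.grading q φ h = AddMonoidAlgebra.single m h) :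
    rightContract q φ hq hq1 ((u ⊗ₜ v) ⊗ₜ h) =
      pairing q φ hq hq1 (h ⊗ₜ u) • phaseTwist φ (SU.grading q φ) m v := by
  simp [rightContract, mutualBraidingRev,
    phaseBraiding_of_single_right φ (SU.spannedByHomogeneous q φ hq) m v h hh]

/-- The scalar extracted by the contraction is unchanged by twisting both arguments, and the
surviving leg carries the twist. -/
theorem twist_rightContract (k : ℤ) (s : SU q φ ⊗[ℂ] SU q φ) (h : U q φ) :
    phaseTwist φ (SU.grading q φ) k (rightContract q φ hq hq1 (s ⊗ₜ h)) =
      rightContract q φ hq hq1 (TensorProduct.map (phaseTwist φ (SU.grading q φ) k)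
        (phaseTwist φ (SU.grading q φ) k) s ⊗ₜ phaseTwist φ (U.grading q φ) k h) := by
  refine (U.spannedByHomogeneous q φ hq).induction (by simp)
    (fun x y hx hy => by simp only [TensorProduct.tmul_add, map_add, hx, hy])
    (fun m h hh => ?_) h
  induction s using TensorProduct.induction_on with
  | zero => simp
  | add s t hs ht => simp only [TensorProduct.add_tmul, map_add, hs, ht]
  | tmul u v =>
    rw [TensorProduct.map_tmul, rightContract_of_single_right q φ hq hq1 m _ _ _ hh,
      rightContract_of_single_right q φ hq hq1 m _ _ _ (phaseTwist_homogeneous φ k m h hh),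
      pairing_twist, map_smul, (SU.spannedByHomogeneous q φ hq).twist_comm]

theorem twist_rightAct (k : ℤ) (a : SU q φ) (h : U q φ) :
    phaseTwist φ (SU.grading q φ) k (rightAct (SU.comul q φ hq.ne') (mutualBraidingRev q φ)
      (pairing q φ hq hq1) (a ⊗ₜ h)) =
    rightAct (SU.comul q φ hq.ne') (mutualBraidingRev q φ) (pairing q φ hq hq1)
      (phaseTwist φ (SU.grading q φ) k a ⊗ₜ phaseTwist φ (U.grading q φ) k h) := by
  rw [rightAct_tmul, rightAct_tmul, twist_rightContract,
    (SU.hopfGenerators q φ hq.ne').comul_twist]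

/-- Either ⟨h, a⟩ vanishes or the two phases cancel. Such factors may thus be inserted or removed
next to a pairing, even for φ at which different degrees have equal phases. -/
theorem ph_mul_pairing (k m n : ℤ) (h : U q φ) (a : SU q φ)
    (hh : U.grading q φ h = AddMonoidAlgebra.single m h)
    (ha : SU.grading q φ a = AddMonoidAlgebra.single n a) :
    ph φ (2 * k * m) * ph φ (2 * k * n) * pairing q φ hq hq1 (h ⊗ₜ a) =
      pairing q φ hq hq1 (h ⊗ₜ a) := by
  conv_rhs => rw [← pairing_twist q φ hq hq1 k h a]
  rw [phaseTwist_of_single φ _ _ _ _ hh, phaseTwist_of_single φ _ _ _ _ ha,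
    TensorProduct.tmul_smul, ← TensorProduct.smul_tmul', map_smul, map_smul, smul_eq_mul,
    smul_eq_mul]
  ring

/-- Acting by hg and acting by h and then g both evaluate one functional `G` on the iterated
coproduct of a, in its two bracketings; coassociativity identifies them. -/
theorem rightAct_mul (a : SU q φ) (h g : U q φ) :
    rightAct (SU.comul q φ hq.ne') (mutualBraidingRev q φ) (pairing q φ hq hq1) (a ⊗ₜ (h * g)) =
    rightAct (SU.comul q φ hq.ne') (mutualBraidingRev q φ) (pairing q φ hq hq1)
      (rightAct (SU.comul q φ hq.ne') (mutualBraidingRev q φ) (pairing q φ hq hq1) (a ⊗ₜ h) ⊗ₜ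
        g) := by
  have hS := SU.hopfGenerators q φ hq.ne'
  have hU := U.spannedByHomogeneous q φ hq
  refine hU.induction (by simp)
    (fun x y hx hy => by
      simp only [TensorProduct.tmul_add, TensorProduct.add_tmul, add_mul, map_add, hx, hy])
    (fun m h hh => ?_) h
  refine hU.induction (by simp)
    (fun x y hx hy => by
      simp only [TensorProduct.tmul_add, mul_add, map_add, hx, hy])
    (fun n g hg => ?_) g
  have hhg : U.grading q φ (h * g) = AddMonoidAlgebra.single (m + n) (h * g) := by
    rw [map_mul, hh, hg, AddMonoidAlgebra.single_mul_single]
  let T : ℤ → SU q φ →ₗ[ℂ] SU q φ := phaseTwist φ (SU.grading q φ)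
  -- h consumes the first leg and passes the other two, giving T_m on both; g then consumes the
  -- second leg and passes the third, adding T_n.
  let G : SU q φ ⊗[ℂ] (SU q φ ⊗[ℂ] SU q φ) →ₗ[ℂ] SU q φ :=
    (TensorProduct.lid ℂ (SU q φ)).toLinearMap ∘ₗ
      TensorProduct.map (pairing q φ hq hq1 ∘ₗ TensorProduct.mk ℂ _ _ h)
        ((TensorProduct.lid ℂ (SU q φ)).toLinearMap ∘ₗ TensorProduct.map
          (pairing q φ hq hq1 ∘ₗ TensorProduct.mk ℂ _ _ g ∘ₗ T m) (T (m + n)))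
  have hG : ∀ u v w, G (u ⊗ₜ (v ⊗ₜ w)) = pairing q φ hq hq1 (h ⊗ₜ u) •
      pairing q φ hq hq1 (g ⊗ₜ T m v) • T (m + n) w := fun u v w => rfl
  have hR : ∀ s, rightContract q φ hq hq1 (SU.comul q φ hq.ne' (rightContract q φ hq hq1
      (s ⊗ₜ h)) ⊗ₜ g) = G ((SU.comul q φ hq.ne').lTensor (SU q φ) s) := by
    intro s
    induction s using TensorProduct.induction_on with
    | zero => simp
    | add s t hs ht => simp only [TensorProduct.add_tmul, map_add, hs, ht]
    | tmul u v =>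
      rw [rightContract_of_single_right q φ hq hq1 m _ _ _ hh, map_smul, hS.comul_twist,
        LinearMap.lTensor_tmul, ← TensorProduct.smul_tmul', map_smul]
      induction SU.comul q φ hq.ne' v using TensorProduct.induction_on with
      | zero => simp
      | add s t hs ht =>
        simp only [TensorProduct.add_tmul, TensorProduct.tmul_add, map_add, smul_add, hs, ht]
      | tmul v w =>
        rw [TensorProduct.map_tmul, rightContract_of_single_right q φ hq hq1 n _ _ _ hg, hG,
          hS.spannedByHomogeneous.twist_twist, add_comm n m]
  have hL : ∀ s, rightContract q φ hq hq1 (s ⊗ₜ (h * g)) =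
      G (TensorProduct.assoc ℂ _ _ _ ((SU.comul q φ hq.ne').rTensor (SU q φ) s)) := by
    intro s
    induction s using TensorProduct.induction_on with
    | zero => simp
    | add s t hs ht => simp only [TensorProduct.add_tmul, map_add, hs, ht]
    | tmul u v =>
      rw [rightContract_of_single_right q φ hq hq1 _ _ _ _ hhg, LinearMap.rTensor_tmul,
        pairing_mul_left]
      refine hS.spannedByHomogeneous.induction_tmul hS.spannedByHomogeneous (P := fun t =>
        LinearMap.mul' ℂ ℂ (TensorProduct.map (pairing q φ hq hq1) (pairing q φ hq hq1)
          (braidMid (mutualBraiding q φ) ((h ⊗ₜ g) ⊗ₜ t))) •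
          phaseTwist φ (SU.grading q φ) (m + n) v = G (TensorProduct.assoc ℂ _ _ _ (t ⊗ₜ v)))
        (by simp) (fun s t hs ht => by
          simp only [TensorProduct.add_tmul, TensorProduct.tmul_add, map_add, add_smul, hs, ht])
        (fun k l x y hx hy => ?_) _
      have e1 := phaseBraiding_of_single_right φ hU k g x hx
      change mutualBraiding q φ _ = _ at e1
      -- In ⟨hg, u⟩ the phase comes from g passing x, in `G` from h passing y; a nonzero ⟨h, x⟩
      -- forces their cancellation to match.
      have e2 := ph_mul_pairing q φ hq hq1 n m k h x hh hx
      have e3 := pairing_twist q φ hq hq1 m g y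
      simp only [braidMid_tmul, e1, TensorProduct.assoc_tmul, TensorProduct.assoc_symm_tmul,
        TensorProduct.map_tmul, LinearMap.mul'_apply, hG, smul_smul]
      rw [phaseTwist_of_single φ _ _ _ _ hg] at e3 ⊢
      simp only [← TensorProduct.smul_tmul', map_smul, smul_eq_mul] at e3 ⊢
      rw [← e3, ← e2]
      congr 1
      rw [mul_right_comm 2 m n, mul_right_comm 2 k n]
      linear_combination (ph φ (2 * n * k) * ph φ (2 * n * m) *
        pairing q φ hq hq1 (g ⊗ₜ phaseTwist φ (SU.grading q φ) m y)) * e2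
  rw [rightAct_tmul, rightAct_tmul, rightAct_tmul, hR, hL, hS.coassoc]

/-- The braiding `SU ⊗ SU` past `U`. -/
def braidPairRev : (SU q φ ⊗[ℂ] SU q φ) ⊗[ℂ] U q φ →ₗ[ℂ] U q φ ⊗[ℂ] (SU q φ ⊗[ℂ] SU q φ) :=
  braidFst (mutualBraidingRev q φ) ∘ₗ (mutualBraidingRev q φ).lTensor (SU q φ) ∘ₗ
    (TensorProduct.assoc ℂ (SU q φ) (SU q φ) (U q φ)).toLinearMap

theorem braidPairRev_of_single_right (hq : 0 < q) (m : ℤ) (s : SU q φ ⊗[ℂ] SU q φ) (h : U q φ)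
    (hh : U.grading q φ h = AddMonoidAlgebra.single m h) :
    braidPairRev q φ (s ⊗ₜ h) = h ⊗ₜ TensorProduct.map (phaseTwist φ (SU.grading q φ) m)
      (phaseTwist φ (SU.grading q φ) m) s := by
  have hS := SU.spannedByHomogeneous q φ hq
  induction s using TensorProduct.induction_on with
  | zero => simp
  | add s t hs ht => simp only [TensorProduct.add_tmul, TensorProduct.tmul_add, map_add, hs, ht]
  | tmul u v =>
    simp [braidPairRev, mutualBraidingRev, phaseBraiding_of_single_right φ hS m _ h hh]

/-- The product rule for ◁, stated for arbitrary tensors in place of Δa and Δb. The tensors can then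
be split into homogeneous pieces, where only scalars are compared. -/
theorem rightContract_braidedMul (s t : SU q φ ⊗[ℂ] SU q φ) (h : U q φ) :
    rightContract q φ hq hq1 (braidedMul (SU.braiding q φ) (s ⊗ₜ t) ⊗ₜ h) =
      LinearMap.mul' ℂ (SU q φ) (TensorProduct.map (rightContract q φ hq hq1)
        (rightContract q φ hq hq1)
        (braidMid (braidPairRev q φ) ((s ⊗ₜ t) ⊗ₜ U.comul q φ hq.ne' h))) := by
  have hS := SU.hopfGenerators q φ hq.ne'
  have hU := U.hopfGenerators q φ hq.ne'
  have hS' := hS.spannedByHomogeneous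
  have hU' := hU.spannedByHomogeneous
  refine hS'.induction_tmul hS' (by simp)
    (fun s s' hs hs' => by simp only [TensorProduct.add_tmul, map_add, hs, hs'])
    (fun i j a₁ a₂ ha₁ ha₂ => ?_) s
  refine hS'.induction_tmul hS' (by simp)
    (fun s s' hs hs' => by
      simp only [TensorProduct.tmul_add, TensorProduct.add_tmul, map_add, hs, hs'])
    (fun k l b₁ b₂ hb₁ hb₂ => ?_) t
  have hab : SU.grading q φ (a₂ * b₂) = AddMonoidAlgebra.single (j + l) (a₂ * b₂) := by
    rw [map_mul, ha₂, hb₂, AddMonoidAlgebra.single_mul_single]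
  rw [SU.braiding, braidedMul_tmul φ hS' k _ _ _ _ hb₁, phaseTwist_of_single φ _ _ _ _ ha₂,
    smul_mul_assoc, TensorProduct.tmul_smul, ← TensorProduct.smul_tmul', map_smul,
    rightContract_of_single q φ hq hq1 _ _ _ _ hab, pairing_mul_right, hU.comul_twist]
  refine hU'.induction_tmul hU' (P := fun z => ph φ (2 * k * j) •
    LinearMap.mul' ℂ ℂ (TensorProduct.map (pairing q φ hq hq1) (pairing q φ hq hq1)
      (braidMid (mutualBraiding q φ) (TensorProduct.map (phaseTwist φ (U.grading q φ) (j + l))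
        (phaseTwist φ (U.grading q φ) (j + l)) z ⊗ₜ (a₁ ⊗ₜ b₁)))) • (a₂ * b₂) =
      LinearMap.mul' ℂ (SU q φ) (TensorProduct.map (rightContract q φ hq hq1)
        (rightContract q φ hq hq1)
        (braidMid (braidPairRev q φ) (((a₁ ⊗ₜ a₂) ⊗ₜ (b₁ ⊗ₜ b₂)) ⊗ₜ z)))) (by simp)
    (fun s s' hs hs' => by
      simp only [TensorProduct.tmul_add, TensorProduct.add_tmul, map_add, add_smul, smul_add,
        hs, hs'])
    (fun m n h₁ h₂ hh₁ hh₂ => ?_) _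
  have e1 := phaseBraiding_homogeneous φ _ _ n i h₂ a₁ hh₂ ha₁
  change mutualBraiding q φ _ = _ at e1
  simp only [TensorProduct.map_tmul, phaseTwist_of_single φ _ _ _ _ hh₁,
    phaseTwist_of_single φ _ _ _ _ hh₂, TensorProduct.tmul_smul, ← TensorProduct.smul_tmul',
    map_smul, braidMid_tmul, e1, braidPairRev_of_single_right q φ hq m _ _ hh₁,
    TensorProduct.assoc_tmul, TensorProduct.assoc_symm_tmul, LinearMap.mul'_apply,
    rightContract_of_single_right q φ hq hq1 m _ _ _ hh₁,
    rightContract_of_single_right q φ hq hq1 n _ _ _ hh₂,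
    phaseTwist_of_single φ _ _ _ _ ha₂, phaseTwist_of_single φ _ _ _ _ hb₁,
    phaseTwist_of_single φ _ _ _ _ hb₂, smul_mul_assoc, mul_smul_comm, smul_smul, smul_eq_mul]
  congr 1
  -- The three relations concern h₁ with a₁ and h₂ with b₁, the pairings present on both sides; each
  -- trades a phase in the degree of an algebra leg for one in the degree of h₁ or h₂.
  have e2 := ph_mul_pairing q φ hq hq1 n m i h₁ a₁ hh₁ ha₁
  have e3 := ph_mul_pairing q φ hq hq1 j n k h₂ b₁ hh₂ hb₁
  have e4 := ph_mul_pairing q φ hq hq1 m n k h₂ b₁ hh₂ hb₁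
  rw [mul_right_comm 2 n m] at e2
  rw [mul_right_comm 2 j k] at e3
  rw [show 2 * (j + l) * n = 2 * j * n + 2 * n * l by ring,
    show 2 * (j + l) * m = 2 * m * j + 2 * m * l by ring, ph_add, ph_add]
  -- Next to the pairings, a phase on each side equals the inverse of e^{2iφmn}; multiplying through
  -- by this nonzero number makes both removable.
  refine mul_left_cancel₀ (ph_ne_zero φ (2 * m * n)) ?_
  linear_combination (ph φ (2 * m * j) * ph φ (2 * m * l) * ph φ (2 * n * l)) *
    (ph φ (2 * m * n) * ph φ (2 * n * i) * pairing q φ hq hq1 (h₁ ⊗ₜ a₁) * e3 +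
      pairing q φ hq hq1 (h₂ ⊗ₜ b₁) * e2 - pairing q φ hq hq1 (h₁ ⊗ₜ a₁) * e4)

theorem isRightBraidedAction_rightAct : IsRightBraidedAction (U.comul q φ hq.ne')
    (U.counit q φ).toLinearMap (U.braiding q φ) (mutualBraidingRev q φ)
    (rightAct (SU.comul q φ hq.ne') (mutualBraidingRev q φ) (pairing q φ hq hq1)) where
  braiding := isAlgebraBraiding_phaseBraiding φ (SU.spannedByHomogeneous q φ hq)
    (U.spannedByHomogeneous q φ hq)
  braid_comul := braidsComulRight_phaseBraiding φ (SU.spannedByHomogeneous q φ hq) _ _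
    (U.hopfGenerators q φ hq.ne').comul_twist (U.hopfGenerators q φ hq.ne').counit_twist
  mul_act a b h := by
    have hS := SU.hopfGenerators q φ hq.ne'
    rw [rightAct_tmul, hS.comul_mul]
    refine (rightContract_braidedMul q φ hq hq1 _ _ h).trans ?_
    -- It remains to see that contracting after moving h past both legs of Δb equals acting on the
    -- twisted b, which holds because Δ commutes with twists.
    congr 1
    refine (U.spannedByHomogeneous q φ hq).induction_tmul (U.spannedByHomogeneous q φ hq)
      (P := fun z => TensorProduct.map (rightContract q φ hq hq1) (rightContract q φ hq hq1)
        (braidMid (braidPairRev q φ) ((SU.comul q φ hq.ne' a ⊗ₜ SU.comul q φ hq.ne' b) ⊗ₜ z)) =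
        TensorProduct.map (rightAct (SU.comul q φ hq.ne') (mutualBraidingRev q φ)
          (pairing q φ hq hq1)) (rightAct (SU.comul q φ hq.ne') (mutualBraidingRev q φ)
          (pairing q φ hq hq1)) (braidMid (mutualBraidingRev q φ) ((a ⊗ₜ b) ⊗ₜ z))) (by simp)
      (fun s t hs ht => by simp only [TensorProduct.tmul_add, map_add, hs, ht])
      (fun m n h g hh hg => ?_) _
    have e1 := phaseBraiding_of_single_right φ hS.spannedByHomogeneous m b h hh
    change mutualBraidingRev q φ _ = _ at e1
    simp only [braidMid_tmul, e1, braidPairRev_of_single_right q φ hq m _ _ hh,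
      TensorProduct.assoc_tmul, TensorProduct.assoc_symm_tmul, TensorProduct.map_tmul,
      rightAct_tmul, hS.comul_twist]
  act_mul := rightAct_mul q φ hq hq1
  braid_act a h g := by
    have hS := SU.spannedByHomogeneous q φ hq
    have hU := U.spannedByHomogeneous q φ hq
    refine hU.induction (by simp)
      (fun x y hx hy => by simp only [TensorProduct.tmul_add, map_add, hx, hy])
      (fun n g hg => ?_) g
    have e1 : ∀ b, mutualBraidingRev q φ (b ⊗ₜ g) = g ⊗ₜ phaseTwist φ (SU.grading q φ) n b :=
      fun b => phaseBraiding_of_single_right φ hS n b g hg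
    rw [e1, twist_rightAct, U.braiding, phaseBraiding_of_single_right φ hU n h g hg,
      braidFst_tmul, e1, TensorProduct.assoc_tmul, LinearMap.lTensor_tmul]
  act_one a := by
    have hS := SU.hopfGenerators q φ hq.ne'
    rw [rightAct_tmul]
    have h1 : ∀ s : SU q φ ⊗[ℂ] SU q φ, rightContract q φ hq hq1 (s ⊗ₜ 1) =
        TensorProduct.lid ℂ (SU q φ) ((SU.counit q φ).toLinearMap.rTensor (SU q φ) s) := by
      intro s
      induction s using TensorProduct.induction_on with
      | zero => simp
      | add s t hs ht => simp only [TensorProduct.add_tmul, map_add, hs, ht]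
      | tmul u v =>
        rw [rightContract_of_single_right q φ hq hq1 0 _ _ _
          (by rw [map_one, AddMonoidAlgebra.one_def]), SU.twist_zero, pairing_tmul]
        simp
    rw [h1, hS.counit_comul, TensorProduct.lid_tmul, one_smul]
  one_act h := by
    rw [rightAct_tmul, SU.comul_one, rightContract_of_single q φ hq hq1 0 _ _ _
      (by rw [map_one, AddMonoidAlgebra.one_def]), U.twist_zero, pairing_tmul, actHom_one_right]
    simp [Algebra.algebraMap_eq_smul_one]

theorem rightAct_gen (y : SUGen) (x : UGen) :
    rightAct (SU.comul q φ hq.ne') (mutualBraidingRev q φ) (pairing q φ hq hq1)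
      (SU.gen q φ y ⊗ₜ U.gen q φ x) = rightActGen q φ y x := by
  have hw := ph_ne_zero φ 4
  rw [rightAct_tmul, SU.comul_gen]
  have h1 := fun u v => rightContract_of_single_right q φ hq hq1 _ u v _ (U.grading_gen q φ x)
  cases x <;> cases y <;>
  simp [SU.comulGen, SU.α, SU.αs, SU.γ, SU.γs, h1, TensorProduct.add_tmul,
    TensorProduct.sub_tmul, ← TensorProduct.smul_tmul', pairing_gen, pairingGen, rightActGen,
    SU.twist_gen, U.δ, U.μ, U.ν, SU.δ, SU.μ, SU.ν, ph_neg, ph_zero, ph_eight, smul_smul]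
  -- The value α ◁ e: the coefficient in Δα, the value ⟨e, γ*⟩ and the phase of e passing γ multiply
  -- to 1.
  · have hq' : (q : ℂ) ≠ 0 := Complex.ofReal_ne_zero.2 hq.ne'
    rw [show (q : ℂ) * (ph φ 4)⁻¹ * ((q : ℂ)⁻¹ * (ph φ 4)⁻¹ * ph φ 4 ^ 2) = 1 by field_simp,
      one_smul]
  · congr 1
    field_simp

end RightAction

/-! ### Assembly of the pairing axioms and the main theorem. -/

theorem isBraidedPairing_pairing (q φ : ℝ) (hq : 0 < q) (hq1 : q < 1) :
    IsBraidedPairing (U.comul q φ hq.ne') (U.counit q φ).toLinearMap (U.antipode q φ hq.ne')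
      (SU.comul q φ hq.ne') (SU.counit q φ).toLinearMap (SU.antipode q φ hq.ne')
      (mutualBraiding q φ) (pairing q φ hq hq1) where
  braiding := isAlgebraBraiding_phaseBraiding φ (U.spannedByHomogeneous q φ hq)
    (SU.spannedByHomogeneous q φ hq)
  braid_comul_left := braidsComulLeft_phaseBraiding φ (U.spannedByHomogeneous q φ hq)
    (SU.spannedByHomogeneous q φ hq) _ _ (U.hopfGenerators q φ hq.ne').comul_twist
    (U.hopfGenerators q φ hq.ne').counit_twist
  braid_comul_right := braidsComulRight_phaseBraiding φ (U.spannedByHomogeneous q φ hq) _ _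
    (SU.hopfGenerators q φ hq.ne').comul_twist (SU.hopfGenerators q φ hq.ne').counit_twist
  pair_mul := pairing_mul_right q φ hq hq1
  mul_pair := pairing_mul_left q φ hq hq1
  pair_one h := by
    rw [pairing_tmul, actHom_one_right]
    simp [Algebra.algebraMap_eq_smul_one]
  one_pair a := by
    rw [pairing_tmul, map_one]
    rfl
  antipode := pairing_antipode q φ hq hq1

end BraidedSU2

end

open BraidedSU2 in
theorem mainTheorem1 (q φ : ℝ) (hq0 : 0 < q) (hq1 : q < 1) :
    -- both algebras are braided Hopf algebras
    IsBraidedHopfAlgebra (U.comul q φ hq0.ne') (U.counit q φ).toLinearMap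
      (U.antipode q φ hq0.ne') (U.braiding q φ) ∧
    IsBraidedHopfAlgebra (SU.comul q φ hq0.ne') (SU.counit q φ).toLinearMap
      (SU.antipode q φ hq0.ne') (SU.braiding q φ) ∧
    -- there is exactly one braided pairing with the prescribed values on generators
    ∃ p : U q φ ⊗[ℂ] SU q φ →ₗ[ℂ] ℂ,
      IsBraidedPairing (U.comul q φ hq0.ne') (U.counit q φ).toLinearMap (U.antipode q φ hq0.ne')
        (SU.comul q φ hq0.ne') (SU.counit q φ).toLinearMap (SU.antipode q φ hq0.ne')
        (mutualBraiding q φ) p ∧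
      (∀ (x : UGen) (y : SUGen), p (U.gen q φ x ⊗ₜ SU.gen q φ y) = pairingGen q φ x y) ∧
      (∀ p' : U q φ ⊗[ℂ] SU q φ →ₗ[ℂ] ℂ,
        IsBraidedPairing (U.comul q φ hq0.ne') (U.counit q φ).toLinearMap
          (U.antipode q φ hq0.ne') (SU.comul q φ hq0.ne') (SU.counit q φ).toLinearMap
          (SU.antipode q φ hq0.ne') (mutualBraiding q φ) p' →
        (∀ (x : UGen) (y : SUGen), p' (U.gen q φ x ⊗ₜ SU.gen q φ y) = pairingGen q φ x y) →
        p' = p) ∧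
      PairingIsBraidInvariant (U.braiding q φ) (SU.braiding q φ) (mutualBraiding q φ) p ∧
      -- the left braided action
      IsLeftBraidedAction (U.comul q φ hq0.ne') (U.counit q φ).toLinearMap (U.braiding q φ)
        (mutualBraiding q φ) (leftAct (SU.comul q φ hq0.ne') (mutualBraiding q φ) p) ∧
      (∀ (x : UGen) (y : SUGen),
        leftAct (SU.comul q φ hq0.ne') (mutualBraiding q φ) p (U.gen q φ x ⊗ₜ SU.gen q φ y) =
          leftActGen q φ x y) ∧
      -- the right braided action
      IsRightBraidedAction (U.comul q φ hq0.ne') (U.counit q φ).toLinearMap (U.braiding q φ)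
        (mutualBraidingRev q φ) (rightAct (SU.comul q φ hq0.ne') (mutualBraidingRev q φ) p) ∧
      (∀ (y : SUGen) (x : UGen),
        rightAct (SU.comul q φ hq0.ne') (mutualBraidingRev q φ) p
          (SU.gen q φ y ⊗ₜ U.gen q φ x) = rightActGen q φ y x) := by
  have hp := isBraidedPairing_pairing q φ hq0 hq1
  refine ⟨(U.hopfGenerators q φ hq0.ne').isBraidedHopfAlgebra,
    (SU.hopfGenerators q φ hq0.ne').isBraidedHopfAlgebra, pairing q φ hq0 hq1, hp,
    pairing_gen q φ hq0 hq1, fun p' h' hg => isBraidedPairing_unique q φ hq0 _ p' hp h'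
      fun x y => by rw [hg, pairing_gen], pairingIsBraidInvariant_pairing q φ hq0 hq1, ?_, ?_,
    isRightBraidedAction_rightAct q φ hq0 hq1, rightAct_gen q φ hq0 hq1⟩
  · rw [leftAct_pairing]
    exact isLeftBraidedAction_act q φ hq0 hq1
  · intro x y
    rw [leftAct_pairing, act_tmul, actHom_gen, SU.actOp_gen]
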